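/- Let $L$ be a first-order language containing the language of rings, let $\mathbb K$ be an $L$-structure expanding a field of characteristic $0$, let $T$ be the complete $L$-theory of $\mathbb K$, and let $F=\operatorname{dcl}(\emptyset)\subseteq\mathbb K$. Assume that $\mathbb K$ is algebraically bounded over $F$: for every $L$-formula $\varphi(\bar x,y)$ there are finitely many polynomials $p_1,\dots,p_m\in F[\bar x,y]$ such that for every tuple $\bar a$ from $\mathbb K$ for which $\varphi(\bar a,\mathbb K)$ is finite, there is $i$ with $p_i(\bar a,y)\neq 0$ and $\varphi(\bar a,\mathbb K)\subseteq\{b : p_i(\bar a,b)=0\}$. Fix a derivation $\eta:F\to F$. Let $L^\delta=L\cup\{\delta\}$ with $\delta$ a unary function symbol, and let $T^\delta$ be the $L^\delta$-theory that extends $T$ by axioms saying that $\delta$ is a derivation extending $\eta$. For a model $M$ of $T$ and an $L$-definable (with parameters in $M$) set $X\subseteq M^n$, defined by an $L(M)$-formula $\varphi$, let $\dim X$ be the maximum of $\operatorname{rk}(\bar a/M)$ over all tuples $\bar a$ satisfying $\varphi$ in elementary extensions of $M$ (with $\dim\emptyset=-\infty$), where $\operatorname{rk}$ is the rank for the model-theoretic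 algebraic closure. Call $X$ large if $\dim X=n$. Let $\Pi_n$ denote the projection onto the first $n$ coordinates. Consider the following axiom schemes for an $L^\delta$-structure $(M,\delta)\models T^\delta$. (Deep) For every $n\in\mathbb N$ and every $Z\subseteq M^{n+1}$ that is $L$-definable with parameters in $M$: if $\Pi_n(Z)$ is large, then there is $c\in M$ with $(c,\delta c,\dots,\delta^n c)\in Z$. (Wide) For every $n\in\mathbb N$ and every $W\subseteq M^n\times M^n$ that is $L$-definable with parameters in $M$: if $\Pi_n(W)$ is large, then there is $\bar c\in M^n$ with $(\bar c,\delta\bar c)\in W$. An $L'$-theory $U^*$ is a model completion of an $L'$-theory $U$ if every model of $U^*$ is a model of $U$, every model of $U$ embeds into a model of $U^*$, and whenever $A\models U$ is a substructure of $B,C\models U^*$, the structures $B$ and $C$ are elementarily equivalent over $A$. Then there is an $L^\delta$-theory $T^\delta_g$ with the following properties. 1. $T^\delta_g$ is axiomatized by $T^\delta$ together with (Deep), and also by $T^\delta$ together with (Wide): the models of $T^\delta_g$ are exactly the models of $T^\delta$ satisfying (Deep), and exactly the models of $T^\delta$ satisfying (Wide). 2. $T^\delta_g$ is consistent and complete.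 3. For every $L^\delta$-formula $\alpha(\bar x)$ there are $n\in\mathbb N$ and an $L$-formula $\beta$ such that $T^\delta_g\models\forall\bar x\,\bigl(\alpha(\bar x)\leftrightarrow\beta(\bar x,\delta\bar x,\dots,\delta^n\bar x)\bigr)$. 4. If $T$ is model complete, then $T^\delta_g$ is a model completion of $T^\delta$. 5. If $T$ eliminates quantifiers, then $T^\delta_g$ is a model completion of $T^\delta$, it eliminates quantifiers, and the formula $\beta$ in 3 can be chosen quantifier-free. -/

import Mathlib

open FirstOrder

universe u v w x

namespace GenericDerivation

/-! ### Algebraic and definable closure, rank and dimension -/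

section Closure

variable (L : FirstOrder.Language.{u, v}) {M : Type w} [L.Structure M]

/-- Model-theoretic algebraic closure: the union of the finite `A`-definable subsets of `M`. -/
def acl (A : Set M) : Set M :=
  {b | ∃ S : Set M, A.Definable₁ L S ∧ S.Finite ∧ b ∈ S}

/-- Definable closure: the elements `b` such that `{b}` is `A`-definable. -/
def dcl (A : Set M) : Set M :=
  {b | A.Definable₁ L {b}}

/-- The set `I` is independent over `B` with respect to the closure operator `acl`. -/
def AclIndep (B I : Set M) : Prop :=
  ∀ b ∈ I, b ∉ acl L (B ∪ (I \ {b}))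

/-- The rank of a finite tuple `a` over `B`: the largest cardinality of a set of
coordinates of `a` which is `acl`-independent over `B`. -/
noncomputable def rk {n : ℕ} (B : Set M) (a : Fin n → M) : ℕ∞ :=
  ⨆ (I : Finset M) (_ : (I : Set M) ⊆ Set.range a ∧ AclIndep L B I), (I.card : ℕ∞)

/-- The dimension of the subset of `M ^ n` defined by the `L(M)`-formula `φ`.  A formula with
parameters in `M` is a formula whose free variables are indexed by `M` (the parameters) and by
`Fin n`.  The dimension is the maximum of the rank over `M` of a tuple satisfying `φ` in an
elementary extension of `M`; the empty set has dimension `⊥`. -/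
noncomputable def dim {n : ℕ} (φ : L.Formula (M ⊕ Fin n)) : WithBot ℕ∞ :=
  ⨆ (N : Type w) (_ : L.Structure N) (f : M ↪ₑ[L] N) (a : Fin n → N)
    (_ : φ.Realize (Sum.elim f a)), ((rk L (Set.range f) a : ℕ∞) : WithBot ℕ∞)

/-- A definable subset of `M ^ n` is large if its dimension is `n`. -/
def Large {n : ℕ} (φ : L.Formula (M ⊕ Fin n)) : Prop :=
  dim L φ = ((n : ℕ∞) : WithBot ℕ∞)

/-- For `Z ⊆ M ^ n × M ^ k` defined by an `L(M)`-formula, the formula defining the projection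
of `Z` to the first `n` coordinates. -/
noncomputable def proj {n k : ℕ} (Z : L.Formula ((M ⊕ Fin n) ⊕ Fin k)) :
    L.Formula (M ⊕ Fin n) :=
  Z.iExs (Fin k)

/-- The axiom scheme (Deep) for a function `δ : M → M`: for every `L(M)`-definable
`Z ⊆ M ^ (n + 1)` whose projection to the first `n` coordinates is large there is `c` with
`(c, δ c, …, δ ^ n c) ∈ Z`. -/
def Deep (δ : M → M) : Prop :=
  ∀ (n : ℕ) (Z : L.Formula ((M ⊕ Fin n) ⊕ Fin 1)), Large L (proj L Z) →
    ∃ c : M, Z.Realize (Sum.elim (Sum.elim id fun i : Fin n => δ^[(i : ℕ)] c) fun _ => δ^[n] c)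

/-- The axiom scheme (Wide) for a function `δ : M → M`: for every `L(M)`-definable
`W ⊆ M ^ n × M ^ n` whose projection to the first `n` coordinates is large there is a tuple `c`
with `(c, δ c) ∈ W`. -/
def Wide (δ : M → M) : Prop :=
  ∀ (n : ℕ) (W : L.Formula ((M ⊕ Fin n) ⊕ Fin n)), Large L (proj L W) →
    ∃ c : Fin n → M, W.Realize (Sum.elim (Sum.elim id c) fun i => δ (c i))

end Closure

/-! ### Structures expanding a field -/

section Field

open FirstOrder.Language

variable {L : FirstOrder.Language.{u, v}} (ι : FirstOrder.Language.ring →ᴸ L)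
  (K : Type w) [Field K] [Ring.CompatibleRing K] [L.Structure K] [ι.IsExpansionOn K]

theorem mem_dcl_empty_iff {K : Type w} [L.Structure K] {b : K} :
    b ∈ dcl L (∅ : Set K) ↔
      ∃ φ : L.Formula (Fin 1), ∀ x : Fin 1 → K, φ.Realize x ↔ x 0 = b := by
  unfold dcl
  rw [Set.mem_ofPred_eq, Set.Definable₁, Set.empty_definable_iff]
  refine exists_congr fun φ => ?_
  rw [Set.ext_iff]
  exact forall_congr' fun x => ⟨fun h => h.symm, fun h => h.symm⟩

/-- If `a` and `b` lie in `dcl ∅`, then so does the value at `(a, b)` of every `L`-term. -/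
theorem term_mem_dcl_empty {K : Type w} [L.Structure K] (t : L.Term (Fin 2)) {a b : K}
    (ha : a ∈ dcl L (∅ : Set K)) (hb : b ∈ dcl L (∅ : Set K)) :
    t.realize ![a, b] ∈ dcl L (∅ : Set K) := by
  rw [mem_dcl_empty_iff] at ha hb ⊢
  obtain ⟨α, hα⟩ := ha
  obtain ⟨β, hβ⟩ := hb
  refine ⟨Formula.iExs (Fin 2) ((α.relabel fun _ => (Sum.inr 0 : Fin 1 ⊕ Fin 2)) ⊓
    (β.relabel fun _ => (Sum.inr 1 : Fin 1 ⊕ Fin 2)) ⊓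
    (Term.equal (Term.var (Sum.inl 0)) (t.relabel Sum.inr))), fun x => ?_⟩
  simp only [Formula.realize_iExs, Formula.realize_inf, Formula.realize_relabel, hα, hβ,
    Formula.realize_equal, Term.realize_var, Term.realize_relabel, Function.comp_apply,
    Sum.elim_inl, Sum.elim_inr, Sum.elim_comp_inr]
  constructor
  · rintro ⟨y, ⟨h0, h1⟩, h2⟩
    rw [h2]
    congr 1
    ext i
    fin_cases i <;> simp [h0, h1]
  · intro h
    exact ⟨![a, b], ⟨rfl, rfl⟩, h⟩

/-- `dcl ∅` as a subring of `K`, where the `L`-structure `K` expands a field. -/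
def dclEmpty : Subring K where
  carrier := dcl L (∅ : Set K)
  mul_mem' {a b} ha hb := by
    have h := term_mem_dcl_empty ((ι.onFunction Ring.mulFunc).apply₂
      (Term.var 0) (Term.var 1)) ha hb
    simpa [Term.realize_functions_apply₂] using h
  add_mem' {a b} ha hb := by
    have h := term_mem_dcl_empty ((ι.onFunction Ring.addFunc).apply₂
      (Term.var 0) (Term.var 1)) ha hb
    simpa [Term.realize_functions_apply₂] using h
  neg_mem' {a} ha := by
    have h := term_mem_dcl_empty ((ι.onFunction Ring.negFunc).apply₁ (Term.var 0)) ha ha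
    simpa [Term.realize_functions_apply₁] using h
  one_mem' := mem_dcl_empty_iff.2 ⟨Term.equal (Term.var 0)
    (Constants.term (ι.onFunction Ring.oneFunc)), fun x => by
      simp [Formula.realize_equal, Term.realize_constants, constantMap]⟩
  zero_mem' := mem_dcl_empty_iff.2 ⟨Term.equal (Term.var 0)
    (Constants.term (ι.onFunction Ring.zeroFunc)), fun x => by
      simp [Formula.realize_equal, Term.realize_constants, constantMap]⟩

/-- `K` is algebraically bounded over the subring `F`: for every `L`-formula `φ(x, y)` there are
finitely many polynomials `p ∈ F[x][y]` such that, whenever `φ(a, K)` is finite, it is contained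
in the zero set of some nonzero `p(a, y)`. -/
def AlgBoundedOver (L : FirstOrder.Language.{u, v}) {K : Type w} [Field K] [L.Structure K]
    (F : Subring K) : Prop :=
  ∀ (n : ℕ) (φ : L.Formula (Fin n ⊕ Fin 1)),
    ∃ P : Finset (Polynomial (MvPolynomial (Fin n) F)), ∀ a : Fin n → K,
      {b : K | φ.Realize (Sum.elim a fun _ => b)}.Finite →
        ∃ p ∈ P, p.map (MvPolynomial.aeval a).toRingHom ≠ 0 ∧
          ∀ b : K, φ.Realize (Sum.elim a fun _ => b) →
            (p.map (MvPolynomial.aeval a).toRingHom).eval b = 0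

end Field

/-! ### The language with a derivation -/

section Derivation

open FirstOrder.Language

/-- The function symbols of the language with a single symbol `δ`, which is unary. -/
inductive DerivFunc : ℕ → Type
  | delta : DerivFunc 1

/-- The language whose only symbol is the unary function symbol `δ`. -/
def derivLang : FirstOrder.Language.{0, 0} := ⟨DerivFunc, fun _ => Empty⟩

/-- The language `L^δ`, the expansion of `L` by a unary function symbol `δ`. -/
abbrev withDeriv (L : FirstOrder.Language.{u, v}) : FirstOrder.Language.{u, v} := L.sum derivLang

variable (L : FirstOrder.Language.{u, v})

/-- The inclusion of `L` into `L^δ`. -/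
abbrev incl : L →ᴸ withDeriv L := LHom.sumInl

/-- The symbol `δ` of `L^δ`. -/
def deltaSymb : (withDeriv L).Functions 1 := Sum.inr DerivFunc.delta

/-- The interpretation of `δ` in an `L^δ`-structure. -/
def delta (M : Type w) [(withDeriv L).Structure M] (x : M) : M :=
  Structure.funMap (deltaSymb L) ![x]

/-- The `L`-reduct of an `L^δ`-structure. -/
abbrev baseStructure (M : Type w) [(withDeriv L).Structure M] : L.Structure M :=
  (incl L).reduct M

variable {L}

/-- The sum of two terms of `L^δ`. -/
def addT (ι : FirstOrder.Language.ring →ᴸ L) {α : Type} (s t : (withDeriv L).Term α) :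
    (withDeriv L).Term α :=
  Functions.apply₂ ((incl L).onFunction (ι.onFunction Ring.addFunc)) s t

/-- The product of two terms of `L^δ`. -/
def mulT (ι : FirstOrder.Language.ring →ᴸ L) {α : Type} (s t : (withDeriv L).Term α) :
    (withDeriv L).Term α :=
  Functions.apply₂ ((incl L).onFunction (ι.onFunction Ring.mulFunc)) s t

/-- The term `δ t`. -/
def deltaT {α : Type} (t : (withDeriv L).Term α) : (withDeriv L).Term α :=
  Functions.apply₁ (deltaSymb L) t

/-- The `i`-th of two variables which are going to be quantified. -/
def bvar (i : Fin 2) : (withDeriv L).Term (Empty ⊕ Fin 2) := Term.var (Sum.inr i)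

/-- `∀ x y, δ (x + y) = δ x + δ y`. -/
noncomputable def addAxiom (ι : FirstOrder.Language.ring →ᴸ L) : (withDeriv L).Sentence :=
  Formula.iAlls (Fin 2) (Term.equal (deltaT (addT ι (bvar 0) (bvar 1)))
    (addT ι (deltaT (bvar 0)) (deltaT (bvar 1))))

/-- `∀ x y, δ (x * y) = x * δ y + y * δ x`. -/
noncomputable def mulAxiom (ι : FirstOrder.Language.ring →ᴸ L) : (withDeriv L).Sentence :=
  Formula.iAlls (Fin 2) (Term.equal (deltaT (mulT ι (bvar 0) (bvar 1)))
    (addT ι (mulT ι (bvar 0) (deltaT (bvar 1))) (mulT ι (bvar 1) (deltaT (bvar 0)))))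

/-- `∀ x y, α(x) ∧ β(y) → δ x = y`, for two `L`-formulas `α` and `β`. -/
noncomputable def valueAxiom (α β : L.Formula (Fin 1)) : (withDeriv L).Sentence :=
  Formula.iAlls (Fin 2)
    (((((incl L).onFormula α).relabel fun _ => (Sum.inr 0 : Empty ⊕ Fin 2)) ⊓
      (((incl L).onFormula β).relabel fun _ => (Sum.inr 1 : Empty ⊕ Fin 2))).imp
      (Term.equal (deltaT (bvar 0)) (bvar 1)))

/-- The theory `T^δ`, where `T` is the `L`-theory of `K` and `η` is a derivation on `dcl ∅`: the
axioms of `T`, together with axioms saying that `δ` is a derivation which extends `η`, that is,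
which maps the element defined by `α` to the element defined by `β` whenever `α` and `β` are
`L`-formulas that define in `K` an element `a` of `dcl ∅` and its derivative `η a`. -/
def theoryDelta (ι : FirstOrder.Language.ring →ᴸ L)
    (K : Type w) [Field K] [Ring.CompatibleRing K] [L.Structure K] [ι.IsExpansionOn K]
    (η : Derivation ℤ (dclEmpty ι K) (dclEmpty ι K)) : (withDeriv L).Theory :=
  (incl L).onTheory (L.completeTheory K) ∪ {addAxiom ι, mulAxiom ι} ∪
    {σ | ∃ (a : dclEmpty ι K) (α β : L.Formula (Fin 1)),
      (∀ x : Fin 1 → K, α.Realize x ↔ x 0 = a) ∧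
      (∀ x : Fin 1 → K, β.Realize x ↔ x 0 = (η a : dclEmpty ι K)) ∧
      σ = valueAxiom α β}

/-- The `L^δ`-theory `U` is axiomatized by `T^δ` (given as `V`) and the scheme (Deep). -/
def AxiomatizedByDeep (V U : (withDeriv L).Theory) : Prop :=
  ∀ (M : Type (max u v w)) [(withDeriv L).Structure M],
    M ⊨ U ↔ M ⊨ V ∧ @Deep L M (baseStructure L M) (delta L M)

/-- The `L^δ`-theory `U` is axiomatized by `T^δ` (given as `V`) and the scheme (Wide). -/
def AxiomatizedByWide (V U : (withDeriv L).Theory) : Prop :=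
  ∀ (M : Type (max u v w)) [(withDeriv L).Structure M],
    M ⊨ U ↔ M ⊨ V ∧ @Wide L M (baseStructure L M) (delta L M)

/-- In all models of `U`, the `L^δ`-formula `α(x)` is equivalent to the `L`-formula `β` evaluated
at the jet `(δ ^ j x_i)`, `i < k`, `j ≤ n`. -/
def EquivOnJets (U : (withDeriv L).Theory) {k n : ℕ} (α : (withDeriv L).Formula (Fin k))
    (β : L.Formula (Fin k × Fin (n + 1))) : Prop :=
  ∀ (M : FirstOrder.Language.Theory.ModelType.{u, v, max u v w} U) (x : Fin k → M),
    α.Realize x ↔ @Formula.Realize L M (baseStructure L M) _ β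
      fun ij => (delta L M)^[(ij.2 : ℕ)] (x ij.1)

end Derivation

/-! ### Model completeness, quantifier elimination, model completions -/

section ModelTheory

variable {L : FirstOrder.Language.{u, v}}

/-- A theory is model complete if every embedding between models of it is elementary. -/
def IsModelComplete (T : L.Theory) : Prop :=
  ∀ (M N : FirstOrder.Language.Theory.ModelType.{u, v, max u v w} T) (f : M ↪[L] N) (n : ℕ)
    (φ : L.Formula (Fin n)) (x : Fin n → M), φ.Realize (f ∘ x) ↔ φ.Realize x

/-- A theory eliminates quantifiers if every formula is equivalent modulo the theory to a
quantifier-free formula in the same variables. -/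
def HasQE (T : L.Theory) : Prop :=
  ∀ (n : ℕ) (φ : L.Formula (Fin n)), ∃ ψ : L.Formula (Fin n), ψ.IsQF ∧ T.Iff φ ψ

/-- `V` is a model completion of `U`: every model of `V` is a model of `U`; every model of `U`
embeds into a model of `V`; any two models `B`, `C` of `V` which extend the same model `A` of `U`
satisfy the same formulas with parameters from `A`. -/
structure IsModelCompletion (U V : L.Theory) : Prop where
  models : ∀ A : FirstOrder.Language.Theory.ModelType.{u, v, max u v w} V, A ⊨ U
  extends_to : ∀ A : FirstOrder.Language.Theory.ModelType.{u, v, max u v w} U,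
    ∃ B : FirstOrder.Language.Theory.ModelType.{u, v, max u v w} V, Nonempty (A ↪[L] B)
  equiv : ∀ (A : FirstOrder.Language.Theory.ModelType.{u, v, max u v w} U)
    (B C : FirstOrder.Language.Theory.ModelType.{u, v, max u v w} V) (f : A ↪[L] B) (g : A ↪[L] C)
    (φ : L.Formula A), φ.Realize f ↔ φ.Realize g

end ModelTheory

end GenericDerivation

open GenericDerivation

/-!
The theory of generic derivations is `genericTheory`: `T^δ` together with (Deep).

The first point is that largeness is definable. Algebraic boundedness bounds the cardinality of the
finite fibres of a formula, so that "there are infinitely many `y`" is expressed by an `L`-formula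
(`infQ`), in all models of `T`. Iterating it gives the formula `iterInf`, saying that there are
infinitely many `x₀` for which there are infinitely many `x₁` and so on. A definable set is large if
and only if it satisfies this formula (`large_iff`), since an infinite definable set has an element
outside the algebraic closure of the model in some elementary extension. Hence (Deep) and (Wide) are
schemes of first-order axioms. Moreover the model-theoretic algebraic closure over a model is the
field-theoretic one, and in characteristic zero each of its elements is a simple root of a
polynomial with coefficients in the field generated by `dcl ∅` and the parameters
(`exists_simple_root`).

The second point is relative quantifier elimination (`exists_jet_equiv`): modulo (Deep), a formula
of `L^δ` is equivalent to an `L`-formula about the jets `(δ ^ j x_i)`. It suffices to eliminate one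
quantifier, and by compactness this may be done locally, at a given tuple `a` and a witness `c`
(`exists_elim_formula`). Let `r` be the least order of a derivative of `c` which is algebraic over
the jet of `a` and the derivatives of `c` of smaller order. It is a simple root of a differential
polynomial `p`, and as the iterated total derivatives of `p` are linear in their leading derivative,
with the separant of `p` as coefficient, all derivatives of `c` are determined by those of order at
most `r`. The derivatives of order less than `r` are independent, and so (Deep) provides a witness
in every model in which a suitable formula about the jet holds.

The third point is the existence of models. In characteristic zero, a derivation extends to any
larger field, with arbitrary values at algebraically independent elements
(`exists_derivation_extension`), because a field of characteristic zero is formally smooth over each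
of its subrings. A large projection contains an algebraically independent tuple in some elementary
extension, so that each instance of (Wide) over a model of `T^δ` is satisfied in an extension whose
`L`-reduct is elementary. By compactness and a union of a chain, every model of `T^δ` has such an
extension to a model of (Wide) (`exists_wide_extension`).

The scheme (Wide) implies (Deep): take the set of pairs `(x, y)` with `y i = x (i + 1)` whose
remaining coordinates lie in the given set (`deep_of_wide`). Conversely, a model of (Deep) has an
extension satisfying (Wide), which by relative quantifier elimination is elementary for `L^δ`; so
the model satisfies (Wide) itself. Completeness, model completion and quantifier elimination follow
from relative quantifier elimination and the existence of extensions.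
-/

namespace GenericDerivation

open FirstOrder.Language

/-! ### Finite support, compactness and chains -/

section Parameters

variable {L : FirstOrder.Language.{u, v}} {A : Type*} {σ : Type*}

open Classical in
/-- The number of variables of the first kind that occur in a formula. -/
noncomputable def paramCount (φ : L.Formula (A ⊕ σ)) : ℕ :=
  (BoundedFormula.freeVarFinset φ).toLeft.card

open Classical in
/-- An enumeration of the variables of the first kind that occur in a formula. -/
noncomputable def paramEnum (φ : L.Formula (A ⊕ σ)) (i : Fin (paramCount φ)) : A :=
  ((BoundedFormula.freeVarFinset φ).toLeft.equivFin.symm i : A)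

open Classical in
/-- The formula `φ`, in which the variables of the first kind are replaced by their numbers in
the enumeration `paramEnum φ`. -/
noncomputable def paramForm (φ : L.Formula (A ⊕ σ)) : L.Formula (Fin (paramCount φ) ⊕ σ) :=
  BoundedFormula.restrictFreeVar φ fun z => match z with
    | ⟨Sum.inl a, h⟩ => Sum.inl ((BoundedFormula.freeVarFinset φ).toLeft.equivFin
        ⟨a, Finset.mem_toLeft.2 h⟩)
    | ⟨Sum.inr s, _⟩ => Sum.inr s

theorem realize_paramForm {M : Type*} [L.Structure M] (φ : L.Formula (A ⊕ σ)) (v : A → M)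
    (x : σ → M) :
    (paramForm φ).Realize (Sum.elim (v ∘ paramEnum φ) x) ↔ φ.Realize (Sum.elim v x) := by
  classical
  unfold paramForm Formula.Realize
  refine BoundedFormula.realize_restrictFreeVar (Sum.elim v x) ?_
  rintro ⟨a | s, h⟩
  · simp only [Sum.elim_inl]
    unfold paramEnum
    exact congrArg v (congrArg Subtype.val (Equiv.symm_apply_apply _ _))
  · simp

end Parameters

section Compactness

/-- Compactness for sets of formulas: a set of formulas, every finite subset of which is
satisfiable, is satisfiable. -/
theorem exists_realize_of_finset {L : FirstOrder.Language.{u, v}} {β : Type x}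
    (p : Set (L.Formula β))
    (h : ∀ s : Finset (L.Formula β), (s : Set (L.Formula β)) ⊆ p →
      ∃ (M : Type w) (_ : L.Structure M) (_ : Nonempty M) (v : β → M), ∀ φ ∈ s, φ.Realize v) :
    ∃ (N : Type (max u v x w)) (_ : L.Structure N) (_ : Nonempty N) (v : β → N),
      ∀ φ ∈ p, φ.Realize v := by
  classical
  let T : L[[β]].Theory := Formula.equivSentence '' p
  have hT : T.IsSatisfiable := by
    rw [Theory.isSatisfiable_iff_isFinitelySatisfiable]
    intro t ht
    obtain ⟨s, hs, rfl⟩ := Finset.subset_set_image_iff.1 ht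
    obtain ⟨M, _, _, v, hv⟩ := h s hs
    let _ : (constantsOn β).Structure M := constantsOn.structure v
    have : M ⊨ ((s.image Formula.equivSentence : Finset _) : Set L[[β]].Sentence) := by
      refine ⟨fun σ hσ => ?_⟩
      obtain ⟨φ, hφ, rfl⟩ := Finset.mem_image.1 (Finset.mem_coe.1 hσ)
      exact (Formula.realize_equivSentence M φ).2 (hv φ hφ)
    exact Theory.Model.isSatisfiable M
  obtain ⟨N0⟩ := hT
  let N := Theory.ModelType.ulift.{_, _, _, w} N0
  let _ : L.Structure N := (L.lhomWithConstants β).reduct N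
  refine ⟨N, inferInstance, inferInstance, fun a => (L.con a : N), fun φ hφ => ?_⟩
  rw [← Formula.realize_equivSentence]
  exact Theory.realize_sentence_of_mem T ⟨φ, hφ, rfl⟩

/-- A map that preserves the truth of all formulas in one direction is an elementary embedding. -/
def elementaryOfRealize {L : FirstOrder.Language.{u, v}} {M N : Type*} [L.Structure M]
    [L.Structure N] (f : M → N) (h : ∀ φ : L.Formula M, φ.Realize id → φ.Realize f) :
    M ↪ₑ[L] N where
  toFun := f
  map_formula' n φ x := by
    have h1 := h (φ.relabel x)
    have h2 := h (φ.relabel x).not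
    simp only [Formula.realize_not, Formula.realize_relabel, Function.id_comp] at h1 h2
    exact ⟨fun h3 => by_contra fun h4 => h2 h4 h3, h1⟩

/-- A set of formulas with parameters in `M` every finite subset of which is satisfiable in `M`
is satisfiable in an elementary extension of `M`. -/
theorem exists_elementary_realize {L : FirstOrder.Language.{u, v}} {M : Type (max u v w)}
    [L.Structure M] [Nonempty M] {β : Type} (p : Set (L.Formula (M ⊕ β)))
    (h : ∀ s : Finset (L.Formula (M ⊕ β)), (s : Set (L.Formula (M ⊕ β))) ⊆ p →
      ∃ v : β → M, ∀ φ ∈ s, φ.Realize (Sum.elim id v)) :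
    ∃ (N : Type (max u v w)) (_ : L.Structure N) (f : M ↪ₑ[L] N) (v : β → N),
      ∀ φ ∈ p, φ.Realize (Sum.elim f v) := by
  classical
  obtain ⟨N, _, _, v, hv⟩ := exists_realize_of_finset.{u, v, max u v w, max u v w}
    (p ∪ {φ | ∃ ψ : L.Formula M, ψ.Realize id ∧ φ = ψ.relabel Sum.inl}) (fun s hs => by
      obtain ⟨v, hv⟩ := h (s.filter (· ∈ p)) (by intro φ hφ; simp at hφ; exact hφ.2)
      refine ⟨M, inferInstance, inferInstance, Sum.elim id v, fun φ hφ => ?_⟩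
      rcases hs hφ with h1 | ⟨ψ, hψ, rfl⟩
      · exact hv φ (by simp [hφ, h1])
      · simpa using hψ)
  have hel : ∀ φ : L.Formula M, φ.Realize id → φ.Realize (v ∘ Sum.inl) := fun φ hφ => by
    simpa using hv _ (Or.inr ⟨φ, hφ, rfl⟩)
  refine ⟨N, inferInstance, elementaryOfRealize _ hel, v ∘ Sum.inr, fun φ hφ => ?_⟩
  have : Sum.elim (elementaryOfRealize (v ∘ Sum.inl) hel) (v ∘ Sum.inr) = v :=
    Sum.elim_comp_inl_inr v
  rw [this]
  exact hv φ (Or.inl hφ)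

end Compactness

section DirectLimit

/-- Tarski's chain lemma, for the reducts of an `ω`-chain of structures of a larger language. -/
theorem realize_directLimit_of {L L' : FirstOrder.Language.{u, v}} (i : L →ᴸ L')
    {G : ℕ → Type w} [∀ n, L.Structure (G n)]
    [∀ n, L'.Structure (G n)] [∀ n, i.IsExpansionOn (G n)]
    (f : ∀ m n, m ≤ n → G m ↪[L'] G n) [DirectedSystem G fun m n h => f m n h]
    [L.Structure (Language.DirectLimit G f)] [i.IsExpansionOn (Language.DirectLimit G f)]
    (hf : ∀ m n h, ∃ e : G m ↪ₑ[L] G n, (e : G m → G n) = f m n h)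
    {α : Type x} {k : ℕ} (φ : L.BoundedFormula α k) (n : ℕ) (v : α → G n) (y : Fin k → G n) :
    φ.Realize (DirectLimit.of L' ℕ G f n ∘ v) (DirectLimit.of L' ℕ G f n ∘ y) ↔
      φ.Realize v y := by
  induction φ generalizing n with
  | falsum => rfl
  | equal t₁ t₂ =>
    rw [← LHom.realize_onBoundedFormula i, ← LHom.realize_onBoundedFormula i]
    exact BoundedFormula.IsQF.realize_embedding
      (BoundedFormula.IsAtomic.equal (i.onTerm t₁) (i.onTerm t₂)).isQF _
  | rel R ts =>
    rw [← LHom.realize_onBoundedFormula i, ← LHom.realize_onBoundedFormula i]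
    exact BoundedFormula.IsQF.realize_embedding
      (BoundedFormula.IsAtomic.rel (i.onRelation R) fun j => i.onTerm (ts j)).isQF _
  | imp φ ψ ih1 ih2 => rw [BoundedFormula.realize_imp, BoundedFormula.realize_imp, ih1, ih2]
  | @all k φ ih =>
    rw [BoundedFormula.realize_all, BoundedFormula.realize_all]
    constructor
    · intro h a
      rw [← ih]
      have := h (DirectLimit.of L' ℕ G f n a)
      rwa [← Fin.comp_snoc] at this
    · intro h a
      obtain ⟨m, a, rfl⟩ := DirectLimit.exists_of a
      -- The element `a` and the parameters are moved to a common stage of the chain.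
      let l := max m n
      have hn : ∀ z : G n, DirectLimit.of L' ℕ G f n z =
        DirectLimit.of L' ℕ G f l (f n l (le_max_right m n) z) := fun z => DirectLimit.of_f.symm
      have hm : DirectLimit.of L' ℕ G f m a =
        DirectLimit.of L' ℕ G f l (f m l (le_max_left m n) a) := DirectLimit.of_f.symm
      have hv : DirectLimit.of L' ℕ G f n ∘ v =
        DirectLimit.of L' ℕ G f l ∘ (f n l (le_max_right m n) ∘ v) := funext fun z => hn _
      have hy : DirectLimit.of L' ℕ G f n ∘ y =
        DirectLimit.of L' ℕ G f l ∘ (f n l (le_max_right m n) ∘ y) := funext fun z => hn _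
      rw [hv, hy, hm, ← Fin.comp_snoc, ih]
      obtain ⟨e, he⟩ := hf n l (le_max_right m n)
      have h2 := (e.map_boundedFormula φ.all v y).2 h
      rw [he] at h2
      exact h2 _

end DirectLimit

/-! ### Transfer from `K` to the models of its theory -/

section Transfer

variable {L : FirstOrder.Language.{u, v}} {K : Type x} [L.Structure K]
  {M : Type*} [L.Structure M] [M ⊨ L.completeTheory K]

theorem realize_sentence_of_completeTheory {σ : L.Sentence} (h : K ⊨ σ) : M ⊨ σ :=
  Theory.realize_sentence_of_mem (L.completeTheory K) h

/-- A universally quantified formula without parameters transfers from `K` to all models of the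
theory of `K`. -/
theorem realize_of_forall_realize {α : Type*} [Finite α] (φ : L.Formula α)
    (h : ∀ v : α → K, φ.Realize v) (v : α → M) : φ.Realize v := by
  have h1 : K ⊨ (Formula.iAlls α (φ.relabel Sum.inr) : L.Sentence) := by
    simp only [Sentence.Realize, Formula.realize_iAlls, Formula.realize_relabel, Sum.elim_comp_inr]
    exact h
  have h2 : M ⊨ (Formula.iAlls α (φ.relabel Sum.inr) : L.Sentence) :=
    realize_sentence_of_completeTheory h1
  simp only [Sentence.Realize, Formula.realize_iAlls, Formula.realize_relabel,
    Sum.elim_comp_inr] at h2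
  exact h2 v

end Transfer

section Constants

variable {L : FirstOrder.Language.{u, v}} (ι : FirstOrder.Language.ring →ᴸ L)
  (K : Type x) [Field K] [Ring.CompatibleRing K] [L.Structure K] [ι.IsExpansionOn K]
  (M : Type w) [L.Structure M] [M ⊨ L.completeTheory K]

/-- A formula that defines the element `a` of `dcl ∅`. -/
noncomputable def cstForm {ι : FirstOrder.Language.ring →ᴸ L}
    {K : Type x} [Field K] [Ring.CompatibleRing K] [L.Structure K] [ι.IsExpansionOn K]
    (a : dclEmpty ι K) : L.Formula (Fin 1) :=
  (mem_dcl_empty_iff.1 a.2).choose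

variable {ι K} in
theorem realize_cstForm (a : dclEmpty ι K) (x : Fin 1 → K) :
    (cstForm a).Realize x ↔ x 0 = a :=
  (mem_dcl_empty_iff.1 a.2).choose_spec x

variable {ι K} in
/-- The formula `cstForm a` defines an element of every model of the theory of `K`. -/
theorem exists_cst (a : dclEmpty ι K) :
    ∃ z : M, ∀ x : Fin 1 → M, (cstForm a).Realize x ↔ x 0 = z := by
  let φ : L.Formula (Fin 1) := Formula.iAlls (Fin 1)
    (((cstForm a).relabel Sum.inr).iff
      (Term.equal (Term.var (Sum.inr 0)) (Term.var (Sum.inl 0))))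
  let ψ : L.Formula (Fin 0) := Formula.iExs (Fin 1) (φ.relabel Sum.inr)
  have h : ψ.Realize (default : Fin 0 → M) := by
    refine realize_of_forall_realize (K := K) ψ (fun v => ?_) _
    simp only [ψ, φ, Formula.realize_iExs, Formula.realize_relabel, Formula.realize_iAlls,
      Formula.realize_iff, Formula.realize_equal, Term.realize_var, Sum.elim_comp_inr,
      Sum.elim_inl, Sum.elim_inr, realize_cstForm]
    exact ⟨fun _ => a, fun _ => Iff.rfl⟩
  simp only [ψ, φ, Formula.realize_iExs, Formula.realize_relabel, Formula.realize_iAlls,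
      Formula.realize_iff, Formula.realize_equal, Term.realize_var, Sum.elim_comp_inr,
      Sum.elim_inl, Sum.elim_inr] at h
  obtain ⟨z, hz⟩ := h
  exact ⟨z 0, hz⟩

variable {ι K} in
/-- The element of the model `M` of the theory of `K` that corresponds to the element `a` of
`dcl ∅` in `K`. -/
noncomputable def cst (a : dclEmpty ι K) : M :=
  (exists_cst M a).choose

variable {ι K M}

theorem realize_cstForm_iff (a : dclEmpty ι K) (x : Fin 1 → M) :
    (cstForm a).Realize x ↔ x 0 = cst M a :=
  (exists_cst M a).choose_spec x

/-- Any formula that defines `a` in `K` defines `cst M a` in `M`. -/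
theorem realize_iff_eq_cst {a : dclEmpty ι K} {φ : L.Formula (Fin 1)}
    (h : ∀ x : Fin 1 → K, φ.Realize x ↔ x 0 = a) (x : Fin 1 → M) :
    φ.Realize x ↔ x 0 = cst M a := by
  rw [← realize_cstForm_iff, ← Formula.realize_iff]
  refine realize_of_forall_realize (K := K) _ (fun x => ?_) x
  rw [Formula.realize_iff, h, realize_cstForm]

theorem map_cst {N : Type*} [L.Structure N] [N ⊨ L.completeTheory K] (f : M ↪ₑ[L] N)
    (a : dclEmpty ι K) : f (cst M a) = cst N a := by
  have h := (realize_cstForm_iff a (fun _ => cst M a)).2 rfl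
  rw [← f.map_formula] at h
  exact (realize_cstForm_iff a _).1 h

instance completeTheory_model_self : K ⊨ L.completeTheory K := ⟨fun _ h => h⟩

theorem cst_self (a : dclEmpty ι K) : cst K a = a :=
  ((realize_cstForm a _).1 ((realize_cstForm_iff a fun _ => cst K a).2 rfl))

/-- The formula `φ`, in which the variables indexed by `dcl ∅` are replaced by the corresponding
elements, as a formula without parameters. -/
noncomputable def elimCst {σ : Type*} (φ : L.Formula (dclEmpty ι K ⊕ σ)) : L.Formula σ :=
  Formula.iExs (Fin (paramCount φ))
    ((Formula.iInf fun i => (cstForm (paramEnum φ i)).relabel fun _ => Sum.inr i) ⊓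
      (paramForm φ).relabel Sum.swap)

theorem realize_elimCst {σ : Type*} (φ : L.Formula (dclEmpty ι K ⊕ σ)) (x : σ → M) :
    (elimCst φ).Realize x ↔ φ.Realize (Sum.elim (cst M) x) := by
  rw [← realize_paramForm φ]
  simp only [elimCst, Formula.realize_iExs, Formula.realize_inf, Formula.realize_iInf,
    Formula.realize_relabel, realize_cstForm_iff, Function.comp_apply, Sum.elim_inr]
  constructor
  · rintro ⟨z, hz, h⟩
    have : z = cst M ∘ paramEnum φ := funext hz
    subst this
    convert h using 1
    ext (i | i) <;> rfl
  · intro h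
    refine ⟨_, fun _ => rfl, ?_⟩
    convert h using 1
    ext (i | i) <;> rfl

/-- A universally quantified formula with parameters in `dcl ∅` transfers from `K` to all models
of the theory of `K`. -/
theorem realize_cst_of_forall {α : Type*} [Finite α] (φ : L.Formula (dclEmpty ι K ⊕ α))
    (h : ∀ v : α → K, φ.Realize (Sum.elim (fun a : dclEmpty ι K => (a : K)) v)) (v : α → M) :
    φ.Realize (Sum.elim (cst M) v) := by
  rw [← realize_elimCst]
  refine realize_of_forall_realize (K := K) _ (fun v => ?_) v
  have hc : (cst K : dclEmpty ι K → K) = fun a : dclEmpty ι K => (a : K) :=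
    funext cst_self
  rw [realize_elimCst, hc]
  exact h v

end Constants

section Infinite

variable {L : FirstOrder.Language.{u, v}}

/-- The formula saying that at least `N` elements `y` satisfy `φ(x, y)`. -/
noncomputable def exGe {α : Type*} (φ : L.Formula (α ⊕ Fin 1)) (N : ℕ) : L.Formula α :=
  Formula.iExs (Fin N)
    ((Formula.iInf fun i : {p : Fin N × Fin N // p.1 ≠ p.2} =>
      (Term.equal (Term.var (Sum.inr i.1.1)) (Term.var (Sum.inr i.1.2))).not) ⊓
    (Formula.iInf fun i : Fin N => φ.relabel (Sum.map id fun _ => i)))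

theorem realize_exGe {α M : Type*} [L.Structure M] (φ : L.Formula (α ⊕ Fin 1)) (N : ℕ)
    (a : α → M) : (exGe φ N).Realize a ↔ ∃ y : Fin N → M, Function.Injective y ∧
      ∀ i, φ.Realize (Sum.elim a fun _ => y i) := by
  simp only [exGe, Formula.realize_iExs, Formula.realize_inf, Formula.realize_iInf,
    Formula.realize_not, Formula.realize_equal, Term.realize_var, Sum.elim_inr,
    Formula.realize_relabel, Sum.elim_comp_map, Function.comp_id]
  refine exists_congr fun y => and_congr ?_ Iff.rfl
  constructor
  · intro h i j hij
    by_contra hne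
    exact h ⟨(i, j), hne⟩ hij
  · rintro h ⟨⟨i, j⟩, hne⟩ hij
    exact hne (h hij)

theorem realize_exGe_of_infinite {α M : Type*} [L.Structure M] {φ : L.Formula (α ⊕ Fin 1)}
    {a : α → M} (h : {b : M | φ.Realize (Sum.elim a fun _ => b)}.Infinite) (N : ℕ) :
    (exGe φ N).Realize a := by
  rw [realize_exGe]
  let e := h.natEmbedding
  exact ⟨fun i => e i, fun i j hij => Fin.ext (e.injective (Subtype.ext hij)), fun i => (e i).2⟩

theorem infinite_of_forall_realize_exGe {α M : Type*} [L.Structure M]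
    {φ : L.Formula (α ⊕ Fin 1)} {a : α → M} (h : ∀ N, (exGe φ N).Realize a) :
    {b : M | φ.Realize (Sum.elim a fun _ => b)}.Infinite := by
  intro hf
  obtain ⟨y, hy, hφ⟩ := (realize_exGe φ _ a).1 (h (hf.toFinset.card + 1))
  have := Finset.card_le_card_of_injOn (s := Finset.univ) (t := hf.toFinset) y
    (fun i _ => by simpa using hφ i) hy.injOn
  simp at this

variable {ι : FirstOrder.Language.ring →ᴸ L}
  {K : Type x} [Field K] [Ring.CompatibleRing K] [L.Structure K] [ι.IsExpansionOn K]

/-- Algebraic boundedness gives a uniform bound for the cardinality of finite fibres. -/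
theorem exists_infinite_of_realize_exGe (hK : AlgBoundedOver L (dclEmpty ι K)) {n : ℕ}
    (φ : L.Formula (Fin n ⊕ Fin 1)) : ∃ N, ∀ a : Fin n → K, (exGe φ N).Realize a →
      {b : K | φ.Realize (Sum.elim a fun _ => b)}.Infinite := by
  obtain ⟨P, hP⟩ := hK n φ
  refine ⟨P.sup Polynomial.natDegree + 1, fun a ha hf => ?_⟩
  obtain ⟨p, hp, hp0, h⟩ := hP a hf
  obtain ⟨y, hy, hφ⟩ := (realize_exGe φ _ a).1 ha
  have h1 := Polynomial.card_le_degree_of_subset_roots (Z := Finset.univ.map ⟨y, hy⟩)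
    (p := p.map (MvPolynomial.aeval a).toRingHom) (by
      intro b hb
      simp only [Finset.map_val, Multiset.mem_map, Finset.mem_val] at hb
      obtain ⟨i, -, rfl⟩ := hb
      exact (Polynomial.mem_roots hp0).2 (h _ (hφ i)))
  have h2 := Polynomial.natDegree_map_le (p := p) (f := (MvPolynomial.aeval a).toRingHom)
  have h3 := Finset.le_sup (f := Polynomial.natDegree) hp
  simp only [Finset.card_map, Finset.card_univ, Fintype.card_fin] at h1
  omega

/-- The formula saying that infinitely many `y` satisfy `φ(x, y)`. Such a formula exists since the
cardinality of the finite fibres is bounded; the variables of `φ` that do not occur are dropped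
first, because the bound depends on a formula in finitely many variables. -/
noncomputable def infQ (hK : AlgBoundedOver L (dclEmpty ι K)) {α : Type*}
    (φ : L.Formula (α ⊕ Fin 1)) : L.Formula α :=
  (exGe (paramForm φ) (exists_infinite_of_realize_exGe hK (paramForm φ)).choose).relabel
    (paramEnum φ)

theorem realize_infQ (hK : AlgBoundedOver L (dclEmpty ι K)) {M : Type*} [L.Structure M]
    [M ⊨ L.completeTheory K] {α : Type*} (φ : L.Formula (α ⊕ Fin 1)) (a : α → M) :
    (infQ hK φ).Realize a ↔ {b : M | φ.Realize (Sum.elim a fun _ => b)}.Infinite := by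
  rw [infQ, Formula.realize_relabel]
  simp only [← realize_paramForm φ]
  constructor
  · intro h
    refine infinite_of_forall_realize_exGe (φ := paramForm φ) fun N => ?_
    have h1 := realize_of_forall_realize (M := M) (K := K)
      ((exGe (paramForm φ) (exists_infinite_of_realize_exGe hK (paramForm φ)).choose).imp
        (exGe (paramForm φ) N)) (fun v => ?_) (a ∘ paramEnum φ)
    · exact h1 h
    · rw [Formula.realize_imp]
      intro h2
      exact realize_exGe_of_infinite
        ((exists_infinite_of_realize_exGe hK (paramForm φ)).choose_spec v h2) N
  · exact fun h => realize_exGe_of_infinite h _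

end Infinite

/-! ### Algebraic boundedness in the models of the theory -/

section Polynomials

variable {L : FirstOrder.Language.{u, v}} (ι : FirstOrder.Language.ring →ᴸ L)

/-- An integer polynomial as an `L`-term. -/
noncomputable def polyTerm {V : Type*} (q : MvPolynomial V ℤ) : L.Term V :=
  ι.onTerm (Ring.termOfFreeCommRing ((freeCommRingEquivMvPolynomialInt V).symm q))

theorem realize_polyTerm {M : Type*} [Field M] [Ring.CompatibleRing M] [L.Structure M]
    [ι.IsExpansionOn M] {V : Type*} (q : MvPolynomial V ℤ) (a : V → M) :
    (polyTerm ι q).realize a = MvPolynomial.aeval a q := by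
  rw [polyTerm, LHom.realize_onTerm, Ring.realize_termOfFreeCommRing]
  have h : FreeCommRing.lift a = ((MvPolynomial.aeval a : MvPolynomial V ℤ →ₐ[ℤ] M) :
      MvPolynomial V ℤ →+* M).comp (freeCommRingEquivMvPolynomialInt V : _ →+* _) := by
    ext i
    simp [freeCommRingEquivMvPolynomialInt]
  rw [h]
  simp

/-- The formula saying that the integer polynomial `q` vanishes. -/
noncomputable def polyZero {V : Type*} (q : MvPolynomial V ℤ) : L.Formula V :=
  Term.equal (polyTerm ι q) (polyTerm ι 0)

theorem realize_polyZero {M : Type*} [Field M] [Ring.CompatibleRing M] [L.Structure M]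
    [ι.IsExpansionOn M] {V : Type*} (q : MvPolynomial V ℤ) (a : V → M) :
    (polyZero ι q).Realize a ↔ MvPolynomial.aeval a q = 0 := by
  rw [polyZero, Formula.realize_equal, realize_polyTerm, realize_polyTerm, map_zero]

/-- A polynomial in one variable over the polynomial ring in the variables `V`, as a polynomial in
the variables `W`: the variables `V` are renamed by `g`, and the additional variable becomes `w`. -/
noncomputable def joinPoly {V W : Type*} (g : V → W) (w : W)
    (p : Polynomial (MvPolynomial V ℤ)) : MvPolynomial W ℤ :=
  p.eval₂ (MvPolynomial.rename g).toRingHom (MvPolynomial.X w)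

theorem aeval_joinPoly {M : Type*} [CommRing M] {V W : Type*} (g : V → W) (w : W)
    (p : Polynomial (MvPolynomial V ℤ)) (a : W → M) :
    MvPolynomial.aeval a (joinPoly g w p) =
      (p.map (MvPolynomial.aeval (a ∘ g) : MvPolynomial V ℤ →ₐ[ℤ] M).toRingHom).eval (a w) := by
  rw [joinPoly, Polynomial.eval_map, ← AlgHom.coe_toRingHom, Polynomial.hom_eval₂]
  congr 1
  · ext i <;> simp
  · simp

theorem pderiv_joinPoly {V W : Type*} (g : V → W) {w : W} (hw : w ∉ Set.range g)
    (p : Polynomial (MvPolynomial V ℤ)) :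
    MvPolynomial.pderiv w (joinPoly g w p) = joinPoly g w (Polynomial.derivative p) := by
  have hr : ∀ q : MvPolynomial V ℤ, MvPolynomial.pderiv w (MvPolynomial.rename g q) = 0 := by
    intro q
    induction q using MvPolynomial.induction_on with
    | C a => simp
    | add p q hp hq => simp [hp, hq]
    | mul_X p i hp =>
      have : g i ≠ w := fun h => hw ⟨i, h⟩
      simp [hp, MvPolynomial.pderiv_X_of_ne this]
  induction p using Polynomial.induction_on' with
  | add p q hp hq => simp only [joinPoly, Polynomial.eval₂_add, map_add] at *; rw [hp, hq]
  | monomial n a =>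
    simp [joinPoly, Polynomial.derivative_monomial, Polynomial.eval₂_monomial, hr]
    ring

variable {K : Type x} [Field K] [Ring.CompatibleRing K] [L.Structure K] [ι.IsExpansionOn K]

variable {ι}

/-- A polynomial over `dcl ∅` comes from an integer polynomial with additional variables, which are
indexed by the elements of `dcl ∅`. It can thus be evaluated in all models of the theory of `K`. -/
theorem exists_lift_polynomial {n : ℕ} (p : Polynomial (MvPolynomial (Fin n) (dclEmpty ι K))) :
    ∃ q : Polynomial (MvPolynomial (dclEmpty ι K ⊕ Fin n) ℤ), ∀ a : Fin n → K,
      q.map (MvPolynomial.aeval (Sum.elim (fun c : dclEmpty ι K => (c : K)) a) :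
        _ →ₐ[ℤ] K).toRingHom = p.map (MvPolynomial.aeval a).toRingHom := by
  let θ : MvPolynomial (dclEmpty ι K ⊕ Fin n) ℤ →ₐ[ℤ] MvPolynomial (Fin n) (dclEmpty ι K) :=
    MvPolynomial.aeval (Sum.elim MvPolynomial.C MvPolynomial.X)
  have hθ : Function.Surjective θ := by
    intro r
    induction r using MvPolynomial.induction_on with
    | C c => exact ⟨MvPolynomial.X (Sum.inl c), by simp [θ]⟩
    | add r s hr hs =>
      obtain ⟨⟨r, rfl⟩, ⟨s, rfl⟩⟩ := hr, hs
      exact ⟨r + s, map_add _ _ _⟩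
    | mul_X r i hr =>
      obtain ⟨r, rfl⟩ := hr
      exact ⟨r * MvPolynomial.X (Sum.inr i), by simp [θ]⟩
  obtain ⟨q, rfl⟩ := Polynomial.map_surjective θ.toRingHom hθ p
  refine ⟨q, fun a => ?_⟩
  rw [Polynomial.map_map]
  congr 1
  ext i
  · simp
  · rcases i with i | i
    · simp [θ]
      rfl
    · simp [θ]

/-- In characteristic zero, a root of a nonzero polynomial is a simple root of one of the iterated
derivatives of the polynomial. -/
theorem exists_simple_root_of_root {M : Type*} [Field M] [CharZero M] {R : Type*} [CommRing R]
    (f : R →+* M) (p : Polynomial R) (hp : p.map f ≠ 0) {b : M} (hb : (p.map f).eval b = 0) :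
    ∃ q : Polynomial R, (q.map f).eval b = 0 ∧ (q.derivative.map f).eval b ≠ 0 := by
  classical
  have hex : ∃ n, ¬ (Polynomial.derivative^[n] (p.map f)).IsRoot b := by
    by_contra! h
    have := (Polynomial.lt_rootMultiplicity_iff_isRoot_iterate_derivative (t := b)
      (n := (p.map f).rootMultiplicity b) hp).2 fun m _ => h m
    exact lt_irrefl _ this
  have h0 : Nat.find hex ≠ 0 := by
    intro h
    have := Nat.find_spec hex
    rw [h] at this
    exact this hb
  obtain ⟨m, hm⟩ := Nat.exists_eq_succ_of_ne_zero h0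
  refine ⟨Polynomial.derivative^[m] p, ?_, ?_⟩
  · have := Nat.find_min hex (m := m) (by omega)
    rw [not_not] at this
    rw [← Polynomial.iterate_derivative_map]
    exact this
  · have := Nat.find_spec hex
    rw [hm] at this
    rw [← Function.iterate_succ_apply' Polynomial.derivative, ← Polynomial.iterate_derivative_map]
    exact this

variable (ι) in
/-- The formula saying that the polynomial `p`, whose coefficients are polynomials in `c` and `v`,
is nonzero and vanishes at all `y` which satisfy `ψ(v, y)`. -/
noncomputable def fibreForm {C : Type*} {k : ℕ} (ψ : L.Formula (Fin k ⊕ Fin 1))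
    (p : Polynomial (MvPolynomial (C ⊕ Fin k) ℤ)) : L.Formula (C ⊕ Fin k) :=
  (Formula.iSup fun i : Fin (p.natDegree + 1) => (polyZero ι (p.coeff i)).not) ⊓
    Formula.iAlls (Fin 1) ((ψ.relabel (Sum.map Sum.inr id)).imp
      (polyZero ι (joinPoly Sum.inl (Sum.inr 0) p)))

theorem realize_fibreForm {M : Type*} [Field M] [Ring.CompatibleRing M] [L.Structure M]
    [ι.IsExpansionOn M] {C : Type*} {k : ℕ} (ψ : L.Formula (Fin k ⊕ Fin 1))
    (p : Polynomial (MvPolynomial (C ⊕ Fin k) ℤ)) (c : C → M) (v : Fin k → M) :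
    (fibreForm ι ψ p).Realize (Sum.elim c v) ↔
      p.map (MvPolynomial.aeval (Sum.elim c v) : _ →ₐ[ℤ] M).toRingHom ≠ 0 ∧
      ∀ y : M, ψ.Realize (Sum.elim v fun _ => y) →
        (p.map (MvPolynomial.aeval (Sum.elim c v) : _ →ₐ[ℤ] M).toRingHom).eval y = 0 := by
  simp only [fibreForm, Formula.realize_inf, Formula.realize_iSup, Formula.realize_not,
    realize_polyZero, Formula.realize_iAlls, Formula.realize_imp, Formula.realize_relabel,
    aeval_joinPoly, Sum.elim_comp_inl, Sum.elim_inr, Sum.elim_comp_map, Function.comp_id]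
  refine and_congr ?_ ?_
  · rw [← not_iff_not]
    push Not
    constructor
    · intro h
      ext i
      rw [Polynomial.coeff_map, Polynomial.coeff_zero]
      by_cases hi : i < p.natDegree + 1
      · exact h ⟨i, hi⟩
      · rw [Polynomial.coeff_eq_zero_of_natDegree_lt (by omega), map_zero]
    · intro h i
      have := congrArg (fun r => Polynomial.coeff r i) h
      simpa using this
  · constructor
    · intro h y hy
      exact h (fun _ => y) (by simpa using hy)
    · intro h y hy
      refine h (y 0) ?_
      convert hy using 1
      ext (i | i)
      · rfl
      · exact congrArg y (Subsingleton.elim _ _)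

/-- In every model of the theory of `K`, an element of a finite fibre of a formula is a simple root
of a polynomial whose coefficients are integer polynomials in the parameters and elements
of `dcl ∅`. -/
theorem exists_simple_root (hK : AlgBoundedOver L (dclEmpty ι K)) {M : Type*}
    [Field M] [CharZero M] [Ring.CompatibleRing M] [L.Structure M] [ι.IsExpansionOn M]
    [M ⊨ L.completeTheory K]
    {α : Type*} (φ : L.Formula (α ⊕ Fin 1)) (a : α → M) (b : M)
    (hfin : {b : M | φ.Realize (Sum.elim a fun _ => b)}.Finite)
    (hb : φ.Realize (Sum.elim a fun _ => b)) :
    ∃ q : Polynomial (MvPolynomial (dclEmpty ι K ⊕ α) ℤ),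
      (q.map (MvPolynomial.aeval (Sum.elim (cst M) a) : _ →ₐ[ℤ] M).toRingHom).eval b = 0 ∧
      (q.derivative.map
        (MvPolynomial.aeval (Sum.elim (cst M) a) : _ →ₐ[ℤ] M).toRingHom).eval b ≠ 0 := by
  classical
  let ψ := paramForm φ
  let k := paramCount φ
  obtain ⟨P, hP⟩ := hK k ψ
  choose lift hlift using fun p => exists_lift_polynomial (ι := ι) (K := K) (n := k) p
  -- In `K`, every fibre is infinite or contained in the zero set of one of the polynomials in `P`.
  -- This is a formula over `dcl ∅`, and therefore holds in `M`.
  let Θ : L.Formula (dclEmpty ι K ⊕ Fin k) := (infQ hK ψ).relabel Sum.inr ⊔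
    Formula.iSup fun p : P => fibreForm ι ψ (lift p)
  have hΘ : Θ.Realize (Sum.elim (cst M) (a ∘ paramEnum φ)) := by
    refine realize_cst_of_forall Θ (fun v => ?_) _
    simp only [Θ, Formula.realize_sup, Formula.realize_relabel, Sum.elim_comp_inr, realize_infQ,
      Formula.realize_iSup, realize_fibreForm, hlift]
    by_cases hv : {b : K | ψ.Realize (Sum.elim v fun _ => b)}.Finite
    · obtain ⟨p, hp, h⟩ := hP v hv
      exact Or.inr ⟨⟨p, hp⟩, h⟩
    · exact Or.inl hv
  simp only [Θ, Formula.realize_sup, Formula.realize_relabel, Sum.elim_comp_inr, realize_infQ,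
    Formula.realize_iSup, realize_fibreForm, ψ] at hΘ
  have hpf := fun b => realize_paramForm φ a (fun _ : Fin 1 => b)
  simp only [hpf] at hΘ
  rcases hΘ with h | ⟨p, hp, h⟩
  · exact absurd hfin h
  have hcomp : (MvPolynomial.aeval (Sum.elim (cst M : dclEmpty ι K → M) (a ∘ paramEnum φ)) :
      _ →ₐ[ℤ] M).toRingHom = (MvPolynomial.aeval (Sum.elim (cst M) a) : _ →ₐ[ℤ] M).toRingHom.comp
      (MvPolynomial.rename (Sum.map id (paramEnum φ))).toRingHom := by
    ext i
    · simp
    · rcases i with i | i <;> simp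
  obtain ⟨q, hq⟩ := exists_simple_root_of_root _ _ hp (h b hb)
  refine ⟨q.map (MvPolynomial.rename (Sum.map id (paramEnum φ))).toRingHom, ?_⟩
  rw [Polynomial.derivative_map, Polynomial.map_map, Polynomial.map_map, ← hcomp]
  exact hq

end Polynomials

/-! ### Large sets and independent tuples -/

section IteratedInfinite

variable {L : FirstOrder.Language.{u, v}} {ι : FirstOrder.Language.ring →ᴸ L}
  {K : Type x} [Field K] [Ring.CompatibleRing K] [L.Structure K] [ι.IsExpansionOn K]

/-- Separates the last of `n + 1` variables from the others. -/
def splitLast {α : Type*} {n : ℕ} : α ⊕ Fin (n + 1) → (α ⊕ Fin n) ⊕ Fin 1 :=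
  Sum.elim (fun a => Sum.inl (Sum.inl a)) (Fin.lastCases (Sum.inr 0) fun i => Sum.inl (Sum.inr i))

theorem elim_comp_splitLast {α M : Type*} {n : ℕ} (a : α → M) (x : Fin n → M) (b : M) :
    Sum.elim (Sum.elim a x) (fun _ => b) ∘ splitLast =
      Sum.elim a (Fin.snoc x b : Fin (n + 1) → M) := by
  ext (i | i)
  · rfl
  · induction i using Fin.lastCases <;> simp [splitLast]

/-- The formula saying that there are infinitely many `x₀` for which there are infinitely many `x₁`
for which ... there are infinitely many `xₙ₋₁` such that `φ(a, x₀, …, xₙ₋₁)`. -/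
noncomputable def iterInf (hK : AlgBoundedOver L (dclEmpty ι K)) {α : Type*} :
    ∀ n : ℕ, L.Formula (α ⊕ Fin n) → L.Formula α
  | 0, φ => φ.relabel (Sum.elim id Fin.elim0)
  | n + 1, φ => iterInf hK n (infQ hK (φ.relabel splitLast))

/-- The property of subsets of `M ^ n` that is expressed by the formula `iterInf`. -/
def IterInf {M : Type*} : ∀ n : ℕ, Set (Fin n → M) → Prop
  | 0, S => Fin.elim0 ∈ S
  | n + 1, S => IterInf n {x | {b | (Fin.snoc x b : Fin (n + 1) → M) ∈ S}.Infinite}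

theorem realize_iterInf (hK : AlgBoundedOver L (dclEmpty ι K)) {M : Type*} [L.Structure M]
    [M ⊨ L.completeTheory K] {α : Type*} {n : ℕ} (φ : L.Formula (α ⊕ Fin n)) (a : α → M) :
    (iterInf hK n φ).Realize a ↔ IterInf n {x | φ.Realize (Sum.elim a x)} := by
  induction n with
  | zero =>
    rw [iterInf, Formula.realize_relabel, IterInf, Set.mem_ofPred_eq]
    have : a ∘ Sum.elim id Fin.elim0 = Sum.elim a Fin.elim0 := by
      ext (i | i)
      · rfl
      · exact i.elim0
    rw [this]
  | succ n ih =>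
    rw [iterInf, ih, IterInf]
    simp only [realize_infQ, Formula.realize_relabel, elim_comp_splitLast]
    rfl

variable (hK : AlgBoundedOver L (dclEmpty ι K))

theorem acl_mono {M : Type*} [L.Structure M] {A B : Set M} (h : A ⊆ B) : acl L A ⊆ acl L B := by
  rintro b ⟨S, hS, hfin, hb⟩
  exact ⟨S, hS.mono h, hfin, hb⟩

/-- The finite fibres of formulas lie in the algebraic closure of the parameters. -/
theorem mem_acl_of_finite {M : Type*} [L.Structure M] {α : Type*} {φ : L.Formula (α ⊕ Fin 1)}
    {a : α → M} {b : M} (hfin : {b : M | φ.Realize (Sum.elim a fun _ => b)}.Finite)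
    (hb : φ.Realize (Sum.elim a fun _ => b)) : b ∈ acl L (Set.range a) := by
  refine ⟨_, ?_, hfin, hb⟩
  rw [Set.Definable₁, Set.definable_iff_exists_formula_sum]
  refine ⟨φ.relabel (Sum.map (fun i => ⟨a i, i, rfl⟩) id), ?_⟩
  ext x
  simp only [Set.mem_ofPred_eq, Formula.realize_relabel, Sum.elim_comp_map, Function.comp_id]
  have : x = fun _ => x 0 := funext fun i => congrArg x (Subsingleton.elim _ _)
  rw [this]
  rfl

theorem exists_formula_of_mem_acl {M : Type*} [L.Structure M] {A : Set M} {b : M}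
    (h : b ∈ acl L A) : ∃ φ : L.Formula (A ⊕ Fin 1),
      {b : M | φ.Realize (Sum.elim (↑) fun _ => b)}.Finite ∧
      φ.Realize (Sum.elim (↑) fun _ => b) := by
  obtain ⟨S, hS, hfin, hb⟩ := h
  rw [Set.Definable₁, Set.definable_iff_exists_formula_sum] at hS
  obtain ⟨φ, hφ⟩ := hS
  have h1 : ∀ y : M, φ.Realize (Sum.elim (↑) fun _ => y) ↔ y ∈ S := fun y => by
    have := Set.ext_iff.1 hφ fun _ => y
    exact this.symm
  refine ⟨φ, ?_, (h1 b).2 hb⟩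
  simp only [h1]
  exact hfin

/-- A formula that is satisfied by an independent tuple is satisfied by infinitely many elements
for each variable in turn. -/
theorem realize_iterInf_of_indep {M : Type*} [L.Structure M] [M ⊨ L.completeTheory K]
    {α : Type*} {c : α → M} : ∀ {n : ℕ} (φ : L.Formula (α ⊕ Fin n)) {a : Fin n → M}
    (_ : ∀ i, a i ∉ acl L (Set.range c ∪ a '' {j | j < i})) (_ : φ.Realize (Sum.elim c a)),
    (iterInf hK n φ).Realize c
  | 0, φ, a, _, hφ => by
    rw [realize_iterInf]
    have : a = Fin.elim0 := funext fun i => i.elim0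
    rwa [this] at hφ
  | n + 1, φ, a, ha, hφ => by
    rw [iterInf]
    refine realize_iterInf_of_indep (a := Fin.init a) _ (fun i hi => ?_) ?_
    · refine ha i.castSucc (acl_mono (Set.union_subset_union_right _ ?_) hi)
      rintro _ ⟨j, hj, rfl⟩
      exact ⟨j.castSucc, hj, rfl⟩
    · rw [realize_infQ]
      intro hfin
      refine ha (Fin.last n) (acl_mono ?_ (mem_acl_of_finite hfin (b := a (Fin.last n)) ?_))
      · rintro _ ⟨i | i, rfl⟩
        · exact Or.inl ⟨i, rfl⟩
        · exact Or.inr ⟨i.castSucc, Fin.castSucc_lt_last i, rfl⟩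
      · rw [Formula.realize_relabel, elim_comp_splitLast, Fin.snoc_init_self]
        exact hφ

end IteratedInfinite

section Large

variable {L : FirstOrder.Language.{u, v}}

/-- A large set contains, in some elementary extension, a tuple which is independent over the
model: a tuple of length `n` and rank `n` has distinct, independent coordinates. -/
theorem exists_indep_of_large {M : Type w} [L.Structure M] {n : ℕ} {φ : L.Formula (M ⊕ Fin n)}
    (h : Large L φ) : ∃ (N : Type w) (_ : L.Structure N) (f : M ↪ₑ[L] N) (a : Fin n → N),
      φ.Realize (Sum.elim f a) ∧ ∀ i, a i ∉ acl L (Set.range f ∪ a '' {j | j ≠ i}) := by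
  rcases n with _ | n
  · have h1 : (⊥ : WithBot ℕ∞) < dim L φ := by
      rw [h]
      exact WithBot.bot_lt_coe _
    simp only [dim, lt_iSup_iff] at h1
    obtain ⟨N, _, f, a, ha, -⟩ := h1
    exact ⟨N, inferInstance, f, a, ha, fun i => i.elim0⟩
  · have h1 : ((n : ℕ∞) : WithBot ℕ∞) < dim L φ := by
      rw [h]
      exact_mod_cast Nat.lt_succ_self n
    simp only [dim, lt_iSup_iff] at h1
    obtain ⟨N, _, f, a, ha, h2⟩ := h1
    refine ⟨N, inferInstance, f, a, ha, ?_⟩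
    rw [WithBot.coe_lt_coe, rk] at h2
    simp only [lt_iSup_iff] at h2
    obtain ⟨I, ⟨hI, hind⟩, hcard⟩ := h2
    classical
    have hcard : n + 1 ≤ I.card := by exact_mod_cast hcard
    have hsub : I ⊆ Finset.univ.image a := by
      intro b hb
      obtain ⟨i, rfl⟩ := hI hb
      exact Finset.mem_image_of_mem _ (Finset.mem_univ i)
    have hle : (Finset.univ.image a).card ≤ n + 1 := by
      simpa using Finset.card_image_le (s := Finset.univ) (f := a)
    have hIeq : I = Finset.univ.image a := Finset.eq_of_subset_of_card_le hsub (by omega)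
    have hinj : Function.Injective a := by
      have : (Finset.univ.image a).card = (Finset.univ : Finset (Fin (n + 1))).card := by
        rw [← hIeq, Finset.card_univ, Fintype.card_fin]
        rw [← hIeq] at hle
        omega
      have := Finset.card_image_iff.1 this
      simpa using this
    intro i hi
    refine hind (a i) (by simp [hIeq]) (acl_mono (Set.union_subset_union_right _ ?_) hi)
    rintro _ ⟨j, hj, rfl⟩
    exact ⟨by simp [hIeq], fun h => hj (hinj h)⟩

/-- The converse of `exists_indep_of_large`; the rank of a tuple of length `n` is at most `n`. -/
theorem large_of_indep {M : Type w} [L.Structure M] {n : ℕ} {φ : L.Formula (M ⊕ Fin n)}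
    {N : Type w} [L.Structure N] (f : M ↪ₑ[L] N) {a : Fin n → N}
    (hφ : φ.Realize (Sum.elim f a)) (hinj : Function.Injective a)
    (ha : ∀ i, a i ∉ acl L (Set.range f ∪ a '' {j | j ≠ i})) : Large L φ := by
  classical
  refine le_antisymm ?_ ?_
  · simp only [dim, iSup_le_iff]
    intro N _ f a _
    rw [WithBot.coe_le_coe, rk]
    simp only [iSup_le_iff]
    rintro I ⟨hI, -⟩
    have hsub : I ⊆ Finset.univ.image a := by
      intro b hb
      obtain ⟨i, rfl⟩ := hI hb
      exact Finset.mem_image_of_mem _ (Finset.mem_univ i)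
    have := (Finset.card_le_card hsub).trans Finset.card_image_le
    simp only [Finset.card_univ, Fintype.card_fin] at this
    exact_mod_cast this
  · refine le_trans ?_ (le_iSup_of_le N (le_iSup_of_le inferInstance (le_iSup_of_le f
      (le_iSup_of_le a (le_iSup_of_le hφ le_rfl)))))
    rw [WithBot.coe_le_coe, rk]
    refine le_trans ?_ (le_iSup₂_of_le (Finset.univ.image a) ⟨by simp, ?_⟩ le_rfl)
    · rw [Finset.card_image_of_injective _ hinj]
      simp
    · intro b hb hb2
      simp only [Finset.coe_image, Finset.coe_univ, Set.image_univ] at hb hb2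
      obtain ⟨i, rfl⟩ := hb
      refine ha i (acl_mono (Set.union_subset_union_right _ ?_) hb2)
      rintro _ ⟨⟨j, rfl⟩, hj⟩
      exact ⟨j, fun h => hj (congrArg a h), rfl⟩

end Large

/-! ### Definability of largeness -/

section FieldStructure

variable {L : FirstOrder.Language.{u, v}} (ι : FirstOrder.Language.ring →ᴸ L)

/-- Every model of the theory of a field of characteristic zero is such a field. -/
theorem exists_field (K : Type x) [Field K] [CharZero K] [Ring.CompatibleRing K] [L.Structure K]
    [ι.IsExpansionOn K] (M : Type*) [L.Structure M] [M ⊨ L.completeTheory K] :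
    ∃ (_ : Field M) (_ : Ring.CompatibleRing M), CharZero M ∧ ι.IsExpansionOn M := by
  let _ : Language.ring.Structure M := ι.reduct M
  have hM : M ⊨ Theory.fieldOfChar 0 := by
    refine ⟨fun σ hσ => ?_⟩
    rw [← LHom.realize_onSentence (M := M) ι]
    refine realize_sentence_of_completeTheory (K := K) ?_
    rw [LHom.realize_onSentence]
    exact Theory.realize_sentence_of_mem (Theory.fieldOfChar 0) hσ
  have hF : M ⊨ Theory.field := (Theory.model_union_iff.1 hM).1
  let _ : Field M := Field.fieldOfModelField M
  let _ : Ring.CompatibleRing M := Field.compatibleRingOfModelField M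
  have : CharP M 0 := Field.charP_iff_model_fieldOfChar.1 hM
  exact ⟨inferInstance, inferInstance, CharP.charP_to_charZero M, inferInstance⟩

/-- An embedding of expansions of fields, as a ring homomorphism. -/
def fieldHom {M N : Type*} [Field M] [Ring.CompatibleRing M] [L.Structure M] [ι.IsExpansionOn M]
    [Field N] [Ring.CompatibleRing N] [L.Structure N] [ι.IsExpansionOn N] (f : M ↪[L] N) :
    M →+* N where
  toFun := f
  map_one' := by
    have := f.map_fun (ι.onFunction Ring.oneFunc) ![]
    simpa using this
  map_zero' := by
    have := f.map_fun (ι.onFunction Ring.zeroFunc) ![]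
    simpa using this
  map_add' a b := by
    have := f.map_fun (ι.onFunction Ring.addFunc) ![a, b]
    simpa using this
  map_mul' a b := by
    have := f.map_fun (ι.onFunction Ring.mulFunc) ![a, b]
    simpa using this

end FieldStructure

section Generic

variable {L : FirstOrder.Language.{u, v}} {ι : FirstOrder.Language.ring →ᴸ L}
  {K : Type x} [Field K] [Ring.CompatibleRing K] [L.Structure K] [ι.IsExpansionOn K]

/-- Elements outside the model-theoretic algebraic closure of a subfield are transcendental
over it. -/
theorem transcendental_of_notMem_acl {M N : Type*} [Field M] [Field N] [Algebra M N]
    [Ring.CompatibleRing N] [L.Structure N] [ι.IsExpansionOn N] {b : N}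
    (hb : b ∉ acl L (Set.range (algebraMap M N))) : Transcendental M b := by
  rintro ⟨p, hp, hpb⟩
  obtain ⟨q, rfl⟩ := Polynomial.map_surjective
    (MvPolynomial.aeval id : MvPolynomial M ℤ →ₐ[ℤ] M).toRingHom
    (fun a => ⟨MvPolynomial.X a, by simp⟩) p
  have hcomp : (MvPolynomial.aeval (algebraMap M N) : _ →ₐ[ℤ] N).toRingHom =
      (algebraMap M N).comp (MvPolynomial.aeval id : MvPolynomial M ℤ →ₐ[ℤ] M).toRingHom := by
    ext i <;> simp
  have hreal : ∀ y : N, (polyZero ι (joinPoly Sum.inl (Sum.inr (0 : Fin 1)) q)).Realize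
      (Sum.elim (algebraMap M N) fun _ => y) ↔ Polynomial.aeval y (Polynomial.map
        (MvPolynomial.aeval id : MvPolynomial M ℤ →ₐ[ℤ] M).toRingHom q) = 0 := by
    intro y
    rw [realize_polyZero, aeval_joinPoly, Sum.elim_comp_inl, Sum.elim_inr, hcomp,
      ← Polynomial.map_map, Polynomial.aeval_def, Polynomial.eval_map]
  refine hb (mem_acl_of_finite
    (φ := polyZero ι (joinPoly Sum.inl (Sum.inr (0 : Fin 1)) q)) ?_ ((hreal b).2 hpb))
  simp only [hreal]
  refine (Polynomial.rootSet_finite (Polynomial.map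
    (MvPolynomial.aeval id : MvPolynomial M ℤ →ₐ[ℤ] M).toRingHom q) N).subset fun y hy => ?_
  exact (Polynomial.mem_rootSet_of_ne hp).2 hy

/-- Algebraic boundedness: the model-theoretic algebraic closure is algebraic. -/
theorem isAlgebraic_of_mem_acl (hK : AlgBoundedOver L (dclEmpty ι K)) {M N : Type*} [Field M]
    [Field N] [CharZero N] [Algebra M N]
    [Ring.CompatibleRing N] [L.Structure N] [ι.IsExpansionOn N] [N ⊨ L.completeTheory K] {S : Set N}
    (hc : Set.range (cst N : dclEmpty ι K → N) ⊆ Set.range (algebraMap M N)) {b : N}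
    (hb : b ∈ acl L (Set.range (algebraMap M N) ∪ S)) :
    IsAlgebraic (Algebra.adjoin M S) b := by
  obtain ⟨φ, hfin, hφ⟩ := exists_formula_of_mem_acl hb
  obtain ⟨q, hq0, hq1⟩ := exists_simple_root hK φ _ b hfin hφ
  let A := Set.range (algebraMap M N) ∪ S
  have hmem : ∀ i, (Sum.elim (cst N : dclEmpty ι K → N) ((↑) : A → N)) i ∈
      Algebra.adjoin M S := by
    have hM : ∀ y ∈ Set.range (algebraMap M N), y ∈ Algebra.adjoin M S := by
      rintro _ ⟨y, rfl⟩
      exact Subalgebra.algebraMap_mem _ y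
    rintro (i | ⟨y, hy | hy⟩)
    · exact hM _ (hc ⟨i, rfl⟩)
    · exact hM _ hy
    · exact Algebra.subset_adjoin hy
  let g : dclEmpty ι K ⊕ A → Algebra.adjoin M S := fun i => ⟨_, hmem i⟩
  have hcomp : (MvPolynomial.aeval (Sum.elim (cst N : dclEmpty ι K → N) ((↑) : A → N)) :
      _ →ₐ[ℤ] N).toRingHom = (algebraMap (Algebra.adjoin M S) N).comp
        (MvPolynomial.aeval g : _ →ₐ[ℤ] Algebra.adjoin M S).toRingHom := by
    ext i
    · simp
    · simp [g]
  refine ⟨q.map (MvPolynomial.aeval g : _ →ₐ[ℤ] Algebra.adjoin M S).toRingHom, fun h0 => hq1 ?_, ?_⟩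
  · rw [hcomp, ← Polynomial.map_map, ← Polynomial.derivative_map, h0]
    simp
  · rw [Polynomial.aeval_def, ← Polynomial.eval_map, Polynomial.map_map, ← hcomp]
    exact hq0

/-- An infinite definable set has an element, in some elementary extension, outside the algebraic
closure of the model. -/
theorem exists_notMem_acl {M : Type (max u v w)} [L.Structure M] [Nonempty M]
    (φ : L.Formula (M ⊕ Fin 1))
    (h : {b : M | φ.Realize (Sum.elim id fun _ => b)}.Infinite) :
    ∃ (N : Type (max u v w)) (_ : L.Structure N) (f : M ↪ₑ[L] N) (b : N),
      φ.Realize (Sum.elim f fun _ => b) ∧ b ∉ acl L (Set.range f) := by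
  classical
  obtain ⟨N, _, f, y, hy⟩ := exists_elementary_realize.{u, v, w}
    ({φ} ∪ {ψ | ∃ χ : L.Formula (M ⊕ Fin 1),
      {b : M | χ.Realize (Sum.elim id fun _ => b)}.Finite ∧ ψ = χ.not}) (fun s hs => by
    have hs2 : ∀ χ ∈ s, χ = φ ∨ {b : M | ¬ χ.Realize (Sum.elim id fun _ => b)}.Finite := by
      intro χ hχ
      rcases hs hχ with h1 | ⟨χ, hfin, rfl⟩
      · exact Or.inl h1
      · right
        simpa using hfin
    have hfin : (⋃ χ ∈ {χ | χ ∈ s ∧ χ ≠ φ},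
        {b : M | ¬ χ.Realize (Sum.elim id fun _ => b)}).Finite := by
      refine Set.Finite.biUnion (s.finite_toSet.subset fun χ hχ => hχ.1) fun χ hχ => ?_
      exact (hs2 χ hχ.1).resolve_left hχ.2
    obtain ⟨b, hb, hb2⟩ := (h.sdiff hfin).nonempty
    refine ⟨fun _ => b, fun χ hχ => ?_⟩
    by_cases h1 : χ = φ
    · rw [h1]
      exact hb
    · by_contra h2
      exact hb2 (Set.mem_biUnion (show χ ∈ {χ | χ ∈ s ∧ χ ≠ φ} from ⟨hχ, h1⟩) h2))
  have hy0 : y = fun _ => y 0 := funext fun i => congrArg y (Subsingleton.elim _ _)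
  rw [hy0] at hy
  refine ⟨N, inferInstance, f, y 0, hy _ (Or.inl rfl), fun hb => ?_⟩
  obtain ⟨χ, hfin, hχ⟩ := exists_formula_of_mem_acl hb
  choose g hg using fun a : Set.range f => a.2
  let ψ : L.Formula (M ⊕ Fin 1) := χ.relabel (Sum.map g id)
  have hψ : ∀ b : N, ψ.Realize (Sum.elim f fun _ => b) ↔
      χ.Realize (Sum.elim ((↑) : Set.range f → N) fun _ => b) := fun b => by
    have : f ∘ g = ((↑) : Set.range f → N) := funext hg
    rw [Formula.realize_relabel, Sum.elim_comp_map, Function.comp_id, this]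
  have hψfin : {b : M | ψ.Realize (Sum.elim id fun _ => b)}.Finite := by
    simp only [← hψ] at hfin
    refine (hfin.preimage f.injective.injOn).subset fun b hb => ?_
    have := (f.map_formula ψ (Sum.elim id fun _ => b)).2 hb
    rwa [Sum.comp_elim] at this
  exact hy ψ.not (Or.inr ⟨ψ, hψfin, rfl⟩) ((hψ _).2 hχ)

/-- If `φ` has infinitely many solutions in each variable in turn, then it is satisfied, in some
elementary extension of `M`, by a tuple which is algebraically independent over `M`. -/
theorem exists_algebraicIndependent [CharZero K] (hK : AlgBoundedOver L (dclEmpty ι K))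
    {M : Type (max u v w)} [Field M] [Ring.CompatibleRing M] [L.Structure M] [ι.IsExpansionOn M]
    [M ⊨ L.completeTheory K] : ∀ (n : ℕ) (φ : L.Formula (M ⊕ Fin n))
    (_ : (iterInf hK n φ).Realize id),
    ∃ (N : Type (max u v w)) (_ : Field N) (_ : Ring.CompatibleRing N) (_ : L.Structure N)
      (_ : ι.IsExpansionOn N) (f : M ↪ₑ[L] N) (a : Fin n → N), φ.Realize (Sum.elim f a) ∧
      letI := (fieldHom ι f.toEmbedding).toAlgebra
      AlgebraicIndependent M a
  | 0, φ, hφ => by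
    rw [realize_iterInf] at hφ
    exact ⟨M, inferInstance, inferInstance, inferInstance, inferInstance,
      ElementaryEmbedding.refl L M, Fin.elim0, hφ, algebraicIndependent_empty_type⟩
  | n + 1, φ, hφ => by
    rw [iterInf] at hφ
    obtain ⟨N, _, _, _, _, f, a, ha, hind⟩ := exists_algebraicIndependent hK n _ hφ
    have hN : N ⊨ L.completeTheory K := (f.theory_model_iff _).1 inferInstance
    let ψ : L.Formula (N ⊕ Fin 1) := φ.relabel (Sum.map (Sum.elim f a) id ∘ splitLast)
    have hψ : ∀ {P : Type (max u v w)} [L.Structure P] (g : N → P) (b : P),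
        ψ.Realize (Sum.elim g fun _ => b) ↔
        φ.Realize (Sum.elim (g ∘ f) (Fin.snoc (g ∘ a) b : Fin (n + 1) → P)) := by
      intro P _ g b
      rw [Formula.realize_relabel, ← Function.comp_assoc, Sum.elim_comp_map, Function.comp_id,
        Sum.comp_elim, elim_comp_splitLast]
    rw [realize_infQ] at ha
    obtain ⟨P, _, g, b, hb, hbacl⟩ := exists_notMem_acl.{u, v, w} ψ (by
      simp only [hψ, Function.id_comp]
      simpa only [Formula.realize_relabel, elim_comp_splitLast] using ha)
    have hP : P ⊨ L.completeTheory K := (g.theory_model_iff _).1 inferInstance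
    obtain ⟨_, _, _, _⟩ := exists_field ι K P
    rw [hψ] at hb
    refine ⟨P, inferInstance, inferInstance, inferInstance, inferInstance, g.comp f,
      Fin.snoc (g ∘ a) b, hb, ?_⟩
    let _ : Algebra M N := (fieldHom ι f.toEmbedding).toAlgebra
    let _ : Algebra N P := (fieldHom ι g.toEmbedding).toAlgebra
    let _ : Algebra M P := (fieldHom ι (g.comp f).toEmbedding).toAlgebra
    have : IsScalarTower M N P := IsScalarTower.of_algebraMap_eq fun _ => rfl
    have hbt : Transcendental N b := transcendental_of_notMem_acl (ι := ι) hbacl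
    have h1 := hind.sumElim_comp (algebraicIndependent_unique_type_iff
      (x := fun _ : Fin 1 => b) |>.2 hbt)
    let e : Fin (n + 1) → Fin 1 ⊕ Fin n := Fin.lastCases (Sum.inl 0) Sum.inr
    have he : Function.Injective e := by
      intro i j
      induction i using Fin.lastCases <;> induction j using Fin.lastCases <;> simp [e]
    convert h1.comp e he using 1
    ext i
    induction i using Fin.lastCases
    · simp [e]
    · simp [e]
      rfl

/-- Largeness is definable: it is expressed by the formula `iterInf`. -/
theorem large_iff [CharZero K] (hK : AlgBoundedOver L (dclEmpty ι K)) {M : Type (max u v w)}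
    [L.Structure M] [M ⊨ L.completeTheory K] {n : ℕ} (φ : L.Formula (M ⊕ Fin n)) :
    Large L φ ↔ (iterInf hK n φ).Realize id := by
  constructor
  · intro h
    obtain ⟨N, _, f, a, hφ, ha⟩ := exists_indep_of_large h
    have hN : N ⊨ L.completeTheory K := (f.theory_model_iff _).1 inferInstance
    rw [← f.map_formula]
    exact realize_iterInf_of_indep hK (c := f) φ (fun i hi => ha i (acl_mono
      (Set.union_subset_union_right _ (Set.image_mono fun j hj => ne_of_lt hj)) hi)) hφ
  · intro h
    obtain ⟨_, _, _, _⟩ := exists_field ι K M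
    obtain ⟨N, _, _, _, _, f, a, hφ, ha⟩ := exists_algebraicIndependent.{u, v, w} hK n φ h
    have hN : N ⊨ L.completeTheory K := (f.theory_model_iff _).1 inferInstance
    let _ : Algebra M N := (fieldHom ι f.toEmbedding).toAlgebra
    have : CharZero N := charZero_of_injective_algebraMap (algebraMap M N).injective
    have ha : AlgebraicIndependent M a := ha
    refine large_of_indep f hφ ha.injective fun i hi => ?_
    refine ha.transcendental_adjoin (s := {j | j ≠ i}) (i := i) (by simp)
      (isAlgebraic_of_mem_acl hK (M := M) ?_ hi)
    rintro _ ⟨c, rfl⟩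
    exact ⟨cst M c, map_cst f c⟩

end Generic

/-! ### Differential polynomials -/

section DifferentialPolynomials

/-- A derivation acts on the values of integer polynomials, at a family of elements which it
maps into itself according to `next`, by a derivation of the polynomial ring. -/
theorem derivation_aeval {M : Type*} [Field M] (d : Derivation ℤ M M) {V : Type*} (next : V → V)
    (y : V → M) (hy : ∀ i, d (y i) = y (next i)) (q : MvPolynomial V ℤ) :
    d (MvPolynomial.aeval y q) = MvPolynomial.aeval y
      (MvPolynomial.mkDerivation ℤ (fun i => (MvPolynomial.X (next i) : MvPolynomial V ℤ)) q) := by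
  induction q using MvPolynomial.induction_on with
  | C a => simp
  | add p q hp hq => simp [hp, hq]
  | mul_X p i hp => simp [hp, hy, Derivation.leibniz]

variable {F σ : Type*} (η : F → F)

/-- The variables of differential polynomials in the unknowns `σ` and one more unknown `y`:
the elements of the base field `F`, the derivatives of the unknowns in `σ`, and the
derivatives of `y`. -/
abbrev DVar (F σ : Type*) := F ⊕ ((σ × ℕ) ⊕ ℕ)

/-- The variable for the `n`-th derivative of the unknown `y`. -/
abbrev yVar (F σ : Type*) (n : ℕ) : DVar F σ := Sum.inr (Sum.inr n)

/-- The derivative of a variable, where `η` is the derivation of `F`. -/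
def nextVar : DVar F σ → DVar F σ :=
  Sum.map η (Sum.map (Prod.map id Nat.succ) Nat.succ)

/-- The total derivative of a differential polynomial. -/
noncomputable def totalD : Derivation ℤ (MvPolynomial (DVar F σ) ℤ) (MvPolynomial (DVar F σ) ℤ) :=
  MvPolynomial.mkDerivation ℤ fun i => MvPolynomial.X (nextVar η i)

/-- The variables of order less than `n` in the unknown `y`. -/
def lowVars (F σ : Type*) (n : ℕ) : Set (DVar F σ) := {i | ∀ j, i = yVar F σ j → j < n}

theorem lowVars_mono {m n : ℕ} (h : m ≤ n) : lowVars F σ m ⊆ lowVars F σ n :=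
  fun _ hi j hj => (hi j hj).trans_le h

theorem yVar_mem_lowVars {m n : ℕ} (h : m < n) : yVar F σ m ∈ lowVars F σ n := by
  rintro j hj
  have : m = j := by simpa using hj
  omega

theorem nextVar_mem_lowVars {n : ℕ} {i : DVar F σ} (h : i ∈ lowVars F σ n) :
    nextVar η i ∈ lowVars F σ (n + 1) := by
  rintro j hj
  rcases i with i | i | i
  · simp [nextVar] at hj
  · simp [nextVar] at hj
  · have := h i rfl
    simp only [nextVar, Sum.map_inr, Sum.inr.injEq] at hj
    omega

theorem mem_lowVars_of_ne {n : ℕ} {i : DVar F σ} (h : i ∈ lowVars F σ (n + 1))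
    (hi : i ≠ yVar F σ n) : i ∈ lowVars F σ n := by
  intro j hj
  have h1 := h j hj
  have h2 : j ≠ n := fun h2 => hi (h2 ▸ hj)
  omega

theorem totalD_mem_supported {n : ℕ} {p : MvPolynomial (DVar F σ) ℤ}
    (hp : p ∈ MvPolynomial.supported ℤ (lowVars F σ n)) :
    totalD η p ∈ MvPolynomial.supported ℤ (lowVars F σ (n + 1)) := by
  have hle : MvPolynomial.supported ℤ (lowVars F σ n) ≤
    MvPolynomial.supported ℤ (lowVars F σ (n + 1)) :=
      MvPolynomial.supported_mono (lowVars_mono n.le_succ)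
  induction hp using Algebra.adjoin_induction with
  | mem q hq =>
    obtain ⟨i, hi, rfl⟩ := hq
    rw [totalD, MvPolynomial.mkDerivation_X]
    exact Algebra.subset_adjoin ⟨_, nextVar_mem_lowVars η hi, rfl⟩
  | algebraMap r => simp
  | add p q _ _ hp hq =>
    rw [map_add]
    exact add_mem hp hq
  | mul p q hp' hq' hp hq =>
    rw [Derivation.leibniz, smul_eq_mul, smul_eq_mul]
    exact add_mem (mul_mem (hle hp') hq) (mul_mem (hle hq') hp)

theorem pderiv_mem_supported {V : Type*} {s : Set V} (i : V) {p : MvPolynomial V ℤ}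
    (hp : p ∈ MvPolynomial.supported ℤ s) :
    MvPolynomial.pderiv i p ∈ MvPolynomial.supported ℤ s := by
  classical
  induction hp using Algebra.adjoin_induction with
  | mem q hq =>
    obtain ⟨j, hj, rfl⟩ := hq
    rw [MvPolynomial.pderiv_X, Pi.single_apply]
    split_ifs
    · exact one_mem _
    · exact zero_mem _
  | algebraMap r => simp
  | add p q _ _ hp hq =>
    rw [map_add]
    exact add_mem hp hq
  | mul p q hp' hq' hp hq =>
    rw [Derivation.leibniz, smul_eq_mul, smul_eq_mul]
    exact add_mem (mul_mem hp' hq) (mul_mem hq' hp)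

/-- The total derivative is linear in the highest derivative of `y`, and the coefficient is the
separant. -/
theorem totalD_sub_mem_supported {n : ℕ} {p : MvPolynomial (DVar F σ) ℤ}
    (hp : p ∈ MvPolynomial.supported ℤ (lowVars F σ (n + 1))) :
    totalD η p - MvPolynomial.pderiv (yVar F σ n) p * MvPolynomial.X (yVar F σ (n + 1)) ∈
      MvPolynomial.supported ℤ (lowVars F σ (n + 1)) := by
  classical
  induction hp using Algebra.adjoin_induction with
  | mem q hq =>
    obtain ⟨i, hi, rfl⟩ := hq
    rw [totalD, MvPolynomial.mkDerivation_X, MvPolynomial.pderiv_X]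
    by_cases h : i = yVar F σ n
    · subst h
      simp [nextVar]
    · rw [Pi.single_eq_of_ne h, zero_mul, sub_zero]
      exact Algebra.subset_adjoin ⟨_, nextVar_mem_lowVars η (mem_lowVars_of_ne hi h), rfl⟩
  | algebraMap r => simp
  | add p q _ _ hp hq =>
    rw [map_add, map_add, add_mul, add_sub_add_comm]
    exact add_mem hp hq
  | mul p q hp' hq' hp hq =>
    rw [Derivation.leibniz, Derivation.leibniz, smul_eq_mul, smul_eq_mul, smul_eq_mul, smul_eq_mul]
    have h : ∀ a b c d e : MvPolynomial (DVar F σ) ℤ, p * a + q * b - (p * c + q * d) * e =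
        p * (a - c * e) + q * (b - d * e) := fun a b c d e => by ring
    rw [h]
    exact add_mem (mul_mem hp' hq) (mul_mem hq' hp)

/-- In the iterated total derivatives of `p`, the highest derivative of `y` occurs linearly, and its
coefficient is always the separant of `p`. -/
theorem exists_iterate_totalD {r : ℕ} {p : MvPolynomial (DVar F σ) ℤ}
    (hp : p ∈ MvPolynomial.supported ℤ (lowVars F σ (r + 1))) (j : ℕ) :
    ∃ q ∈ MvPolynomial.supported ℤ (lowVars F σ (r + 1 + j)), (totalD η)^[j + 1] p =
      MvPolynomial.pderiv (yVar F σ r) p * MvPolynomial.X (yVar F σ (r + 1 + j)) + q := by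
  induction j with
  | zero => exact ⟨_, totalD_sub_mem_supported η hp, by simp⟩
  | succ j ih =>
    obtain ⟨q, hq, h⟩ := ih
    refine ⟨MvPolynomial.X (yVar F σ (r + 1 + j)) *
      totalD η (MvPolynomial.pderiv (yVar F σ r) p) + totalD η q, ?_, ?_⟩
    · refine add_mem (mul_mem ?_ ?_) (totalD_mem_supported η hq)
      · exact Algebra.subset_adjoin ⟨_, yVar_mem_lowVars (by omega), rfl⟩
      · exact MvPolynomial.supported_mono (lowVars_mono (by omega))
          (totalD_mem_supported η (pderiv_mem_supported _ hp))
    · rw [Function.iterate_succ_apply', h, map_add, Derivation.leibniz, smul_eq_mul, smul_eq_mul]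
      have : totalD η (MvPolynomial.X (yVar F σ (r + 1 + j)) : MvPolynomial (DVar F σ) ℤ) =
          MvPolynomial.X (yVar F σ (r + 1 + (j + 1))) := by
        rw [totalD, MvPolynomial.mkDerivation_X]
        rfl
      rw [this, add_assoc]

theorem aeval_congr_of_mem_supported {M : Type*} [CommRing M] {V : Type*} {s : Set V}
    {p : MvPolynomial V ℤ} (hp : p ∈ MvPolynomial.supported ℤ s) {y z : V → M}
    (h : ∀ i ∈ s, y i = z i) : MvPolynomial.aeval y p = MvPolynomial.aeval z p := by
  induction hp using Algebra.adjoin_induction with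
  | mem q hq =>
    obtain ⟨i, hi, rfl⟩ := hq
    simpa using h i hi
  | algebraMap r => simp
  | add p q _ _ hp hq => rw [map_add, map_add, hp, hq]
  | mul p q _ _ hp hq => rw [map_mul, map_mul, hp, hq]

theorem joinPoly_mem_supported {V W : Type*} {g : V → W} {i : W} {s : Set W} (hg : ∀ j, g j ∈ s)
    (hi : i ∈ s) (p : Polynomial (MvPolynomial V ℤ)) :
    joinPoly g i p ∈ MvPolynomial.supported ℤ s := by
  rw [joinPoly, Polynomial.eval₂_eq_sum_range]
  have hX : (MvPolynomial.X i : MvPolynomial W ℤ) ∈ MvPolynomial.supported ℤ s :=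
    Algebra.subset_adjoin ⟨i, hi, rfl⟩
  refine sum_mem fun n _ => mul_mem ?_ (pow_mem hX _)
  rw [MvPolynomial.mem_supported]
  intro j hj
  classical
  obtain ⟨k, -, rfl⟩ := Finset.mem_image.1 (MvPolynomial.vars_rename _ _ hj)
  exact hg k

end DifferentialPolynomials

section Support

variable {L : FirstOrder.Language.{u, v}}

/-- A formula about a sequence depends only on an initial segment of the sequence. -/
theorem exists_bound {α : Type*} (φ : L.Formula (α ⊕ ℕ)) : ∃ m : ℕ, ∀ {M : Type w} [L.Structure M]
    (a : α → M) (y z : ℕ → M), (∀ j < m, y j = z j) →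
    (φ.Realize (Sum.elim a y) ↔ φ.Realize (Sum.elim a z)) := by
  let ψ : L.Formula (ℕ ⊕ α) := φ.relabel Sum.swap
  obtain ⟨m, hm⟩ : ∃ m, ∀ i, paramEnum ψ i < m := by
    refine ⟨Finset.univ.sup (paramEnum ψ) + 1, fun i => ?_⟩
    have := Finset.le_sup (f := paramEnum ψ) (Finset.mem_univ i)
    omega
  refine ⟨m, fun a y z h => ?_⟩
  have h1 : ∀ y : ℕ → _, φ.Realize (Sum.elim a y) ↔ ψ.Realize (Sum.elim y a) := fun y => by
    rw [Formula.realize_relabel]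
    congr! 1
    ext (i | i) <;> rfl
  rw [h1, h1, ← realize_paramForm ψ y, ← realize_paramForm ψ z]
  have : y ∘ paramEnum ψ = z ∘ paramEnum ψ := funext fun i => h _ (hm i)
  rw [this]

end Support

/-! ### Elimination of one quantifier, locally -/

section Elimination

variable {L : FirstOrder.Language.{u, v}} {ι : FirstOrder.Language.ring →ᴸ L}
  {K : Type x} [Field K] [CharZero K] [Ring.CompatibleRing K] [L.Structure K] [ι.IsExpansionOn K]

/-- The iterates of `δ` at the elements of a tuple. -/
def jet {M σ : Type*} (δ : M → M) (a : σ → M) : σ × ℕ → M := fun p => δ^[p.2] (a p.1)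

/-- The iterates of `δ` at an element. -/
def orbit {M : Type*} (δ : M → M) (c : M) : ℕ → M := fun n => δ^[n] c

/-- A reformulation of the scheme (Deep), for formulas whose parameters are named by variables. -/
theorem deep_apply (hK : AlgBoundedOver L (dclEmpty ι K)) {M : Type (max u v w)} [L.Structure M]
    [M ⊨ L.completeTheory K] {δ : M → M} (h : Deep L δ) {α : Type*} {n : ℕ}
    (Z : L.Formula ((α ⊕ Fin n) ⊕ Fin 1)) (a : α → M)
    (hZ : (iterInf hK n (Z.iExs (Fin 1))).Realize a) :
    ∃ c : M, Z.Realize (Sum.elim (Sum.elim a fun i : Fin n => δ^[(i : ℕ)] c) fun _ => δ^[n] c) := by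
  let Z' : L.Formula ((M ⊕ Fin n) ⊕ Fin 1) := Z.relabel (Sum.map (Sum.map a id) id)
  have hZ' : ∀ (y : Fin n → M) (z : Fin 1 → M),
      Z'.Realize (Sum.elim (Sum.elim id y) z) ↔ Z.Realize (Sum.elim (Sum.elim a y) z) := by
    intro y z
    rw [Formula.realize_relabel]
    congr! 1
    ext ((i | i) | i) <;> rfl
  have hlarge : Large L (proj L Z') := by
    rw [large_iff.{u, v, w} hK, realize_iterInf]
    rw [realize_iterInf] at hZ
    simpa only [proj, Formula.realize_iExs, hZ'] using hZ
  obtain ⟨c, hc⟩ := h n Z' hlarge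
  exact ⟨c, (hZ' _ _).1 hc⟩

/-- If the derivatives of `c` of order less than `r` are independent over the jet of `a`, then
(Deep) applies to the formula `φ(a, y)` about sequences `y`, in which all `y j` with `r < j` are
quantified existentially: a formula `γ` about jets, which holds of `a`, implies in all models of
(Deep) that `φ` holds for some sequence which agrees with the derivatives of an element
up to order `r`. -/
theorem exists_jet_formula (hK : AlgBoundedOver L (dclEmpty ι K)) {σ : Type} (r : ℕ)
    (φ : L.Formula ((σ × ℕ) ⊕ ℕ)) {M : Type (max u v w)} [L.Structure M]
    [M ⊨ L.completeTheory K] (δ : M → M) (a : σ → M) (c : M)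
    (hφ : φ.Realize (Sum.elim (jet δ a) (orbit δ c)))
    (hc : ∀ i < r, orbit δ c i ∉ acl L (Set.range (jet δ a) ∪ orbit δ c '' {j | j < i})) :
    ∃ γ : L.Formula (σ × ℕ), γ.Realize (jet δ a) ∧
      ∀ (N : Type (max u v w)) [L.Structure N] [N ⊨ L.completeTheory K] (δ' : N → N),
        Deep L δ' → ∀ b : σ → N, γ.Realize (jet δ' b) →
        ∃ (c' : N) (z : ℕ → N), (∀ j ≤ r, z j = orbit δ' c' j) ∧
          φ.Realize (Sum.elim (jet δ' b) z) := by
  obtain ⟨m0, hm0⟩ := exists_bound.{u, v, max u v w} φ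
  let m := max m0 (r + 1)
  have hm : r + 1 ≤ m := le_max_right _ _
  -- The sequence of variables is truncated at `m`.
  let clamp : ℕ → Fin m := fun j => ⟨min j (m - 1), by omega⟩
  have hclamp : ∀ j < m, (clamp j : ℕ) = j := fun j hj => by
    simp only [clamp]
    omega
  let Z : L.Formula (((σ × ℕ) ⊕ Fin r) ⊕ Fin 1) := Formula.iExs (Fin m)
    (((φ.relabel (Sum.map (fun i => Sum.inl (Sum.inl i)) clamp)) ⊓
      (Formula.iInf fun j : Fin r => Term.equal (Term.var (Sum.inr (clamp j)))
        (Term.var (Sum.inl (Sum.inl (Sum.inr j)))))) ⊓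
      Term.equal (Term.var (Sum.inr (clamp r))) (Term.var (Sum.inl (Sum.inr 0))))
  have hZ : ∀ {N : Type (max u v w)} [L.Structure N] (δ' : N → N) (b : σ → N) (c' : N),
      Z.Realize (Sum.elim (Sum.elim (jet δ' b) fun i : Fin r => δ'^[(i : ℕ)] c')
        fun _ => δ'^[r] c') ↔
      ∃ z : Fin m → N, φ.Realize (Sum.elim (jet δ' b) (z ∘ clamp)) ∧
        ∀ j ≤ r, z (clamp j) = orbit δ' c' j := by
    intro N _ δ' b c'
    simp only [Z, Formula.realize_iExs, Formula.realize_inf, Formula.realize_iInf,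
      Formula.realize_relabel, Formula.realize_equal, Term.realize_var, Sum.elim_comp_map,
      Sum.elim_inl, Sum.elim_inr]
    refine exists_congr fun z => ?_
    rw [and_assoc]
    refine and_congr Iff.rfl ⟨fun h j hj => ?_, fun h => ⟨fun j => h j j.2.le, h r le_rfl⟩⟩
    rcases hj.lt_or_eq with hj | rfl
    · exact h.1 ⟨j, hj⟩
    · exact h.2
  refine ⟨iterInf hK r (Z.iExs (Fin 1)), ?_, ?_⟩
  · refine realize_iterInf_of_indep hK (a := fun i : Fin r => orbit δ c i) _ (fun i hi => ?_) ?_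
    · refine hc i i.2 (acl_mono (Set.union_subset_union_right _ ?_) hi)
      rintro _ ⟨j, hj, rfl⟩
      exact ⟨j, hj, rfl⟩
    · rw [Formula.realize_iExs]
      refine ⟨fun _ => δ^[r] c, (hZ δ a c).2 ⟨fun j => orbit δ c j, ?_, fun j hj => ?_⟩⟩
      · refine (hm0 _ _ _ fun j hj => ?_).2 hφ
        simp only [Function.comp_apply]
        rw [hclamp j (by omega)]
      · simp only
        rw [hclamp j (by omega)]
  · intro N _ _ δ' hδ' b hb
    obtain ⟨c', hc'⟩ := deep_apply hK hδ' Z _ hb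
    obtain ⟨z, hz, hz2⟩ := (hZ δ' b c').1 hc'
    exact ⟨c', z ∘ clamp, hz2, hz⟩

omit [CharZero K] in
/-- If the `i`-th derivative of `c` is algebraic over the jet of `a` and the lower derivatives
of `c`, then it is a simple root of a differential polynomial of order `i`. -/
theorem exists_separable_relation (hK : AlgBoundedOver L (dclEmpty ι K)) {σ : Type*}
    {M : Type*} [Field M] [CharZero M] [Ring.CompatibleRing M] [L.Structure M] [ι.IsExpansionOn M]
    [M ⊨ L.completeTheory K] (u : σ × ℕ → M) (y : ℕ → M) {i : ℕ}
    (h : y i ∈ acl L (Set.range u ∪ y '' {j | j < i})) :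
    ∃ p ∈ MvPolynomial.supported ℤ (lowVars (dclEmpty ι K) σ (i + 1)),
      MvPolynomial.aeval (Sum.elim (cst M) (Sum.elim u y)) p = 0 ∧
      MvPolynomial.aeval (Sum.elim (cst M) (Sum.elim u y))
        (MvPolynomial.pderiv (yVar (dclEmpty ι K) σ i) p) ≠ 0 := by
  obtain ⟨φ, hfin, hφ⟩ := exists_formula_of_mem_acl h
  obtain ⟨q, hq0, hq1⟩ := exists_simple_root hK φ _ _ hfin hφ
  have hex : ∀ z : dclEmpty ι K ⊕ ↥(Set.range u ∪ y '' {j | j < i}),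
      ∃ w ∈ lowVars (dclEmpty ι K) σ i,
        (Sum.elim (cst M : dclEmpty ι K → M) (Sum.elim u y)) w = Sum.elim (cst M) (↑) z := by
    rintro (z | ⟨_, ⟨z, rfl⟩ | ⟨j, hj, rfl⟩⟩)
    · exact ⟨Sum.inl z, fun j hj => by simp at hj, rfl⟩
    · exact ⟨Sum.inr (Sum.inl z), fun j hj => by simp at hj, rfl⟩
    · exact ⟨yVar _ _ j, yVar_mem_lowVars hj, rfl⟩
  choose g hg hgv using hex
  have hcomp : (Sum.elim (cst M : dclEmpty ι K → M) (Sum.elim u y)) ∘ g =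
      Sum.elim (cst M) (↑) := funext hgv
  refine ⟨joinPoly g (yVar _ _ i) q, joinPoly_mem_supported
    (fun j => lowVars_mono i.le_succ (hg j)) (yVar_mem_lowVars i.lt_succ_self) q, ?_, ?_⟩
  · rw [aeval_joinPoly, hcomp]
    exact hq0
  · rw [pderiv_joinPoly, aeval_joinPoly, hcomp]
    · exact hq1
    · rintro ⟨j, hj⟩
      have := hg j i hj
      omega

/-- The prolongations of a differential polynomial vanish at its solutions. -/
theorem aeval_iterate_totalD {F σ : Type*} {η : F → F} {N : Type*} [Field N]
    {d : Derivation ℤ N N} {k : F → N} (hk : ∀ a, d (k a) = k (η a)) (b : σ → N) (c : N)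
    {p : MvPolynomial (DVar F σ) ℤ}
    (h0 : MvPolynomial.aeval (Sum.elim k (Sum.elim (jet d b) (orbit d c))) p = 0) (j : ℕ) :
    MvPolynomial.aeval (Sum.elim k (Sum.elim (jet d b) (orbit d c))) ((totalD η)^[j] p) = 0 := by
  induction j with
  | zero => exact h0
  | succ j ih =>
    rw [Function.iterate_succ_apply', totalD, ← derivation_aeval d]
    · exact (congrArg d ih).trans d.map_zero
    · rintro (i | i | i)
      · exact hk i
      · exact (Function.iterate_succ_apply' d i.2 (b i.1)).symm
      · exact (Function.iterate_succ_apply' d i c).symm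

/-- A solution `z` of the prolongations of a separable differential equation of order `r` agrees
with the derivatives of an element if it agrees with them up to order `r`. -/
theorem eq_orbit_of_prolongations {F σ : Type*} {η : F → F} {N : Type*} [Field N]
    {d : Derivation ℤ N N} {k : F → N} (hk : ∀ a, d (k a) = k (η a)) (b : σ → N) (c : N) (z : ℕ → N)
    {r m : ℕ} {p : MvPolynomial (DVar F σ) ℤ}
    (hp : p ∈ MvPolynomial.supported ℤ (lowVars F σ (r + 1)))
    (hz : ∀ j ≤ r, z j = orbit d c j)
    (h0 : MvPolynomial.aeval (Sum.elim k (Sum.elim (jet d b) z)) p = 0)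
    (h1 : MvPolynomial.aeval (Sum.elim k (Sum.elim (jet d b) z))
      (MvPolynomial.pderiv (yVar F σ r) p) ≠ 0)
    (h2 : ∀ j < m, MvPolynomial.aeval (Sum.elim k (Sum.elim (jet d b) z))
      ((totalD η)^[j + 1] p) = 0) :
    ∀ j < r + 1 + m, z j = orbit d c j := by
  let y := Sum.elim k (Sum.elim (jet d b) z)
  let y' := Sum.elim k (Sum.elim (jet d b) (orbit d c))
  have hlow : ∀ n, (∀ j < n, z j = orbit d c j) → ∀ i ∈ lowVars F σ n, y i = y' i := by
    rintro n hn (i | i | i) hi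
    · rfl
    · rfl
    · exact hn i (hi i rfl)
  have hr := hlow (r + 1) fun j hj => hz j (by omega)
  have hy0 : ∀ j, MvPolynomial.aeval y' ((totalD η)^[j] p) = 0 :=
    aeval_iterate_totalD hk b c ((aeval_congr_of_mem_supported hp hr).symm.trans h0)
  intro n
  induction n using Nat.strong_induction_on with
  | _ n ih =>
    intro hn
    by_cases hnr : n ≤ r
    · exact hz n hnr
    · obtain ⟨j, rfl⟩ := Nat.exists_eq_add_of_le (show r + 1 ≤ n by omega)
      obtain ⟨q, hq, hD⟩ := exists_iterate_totalD η hp j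
      have e1 := h2 j (by omega)
      have e2 := hy0 (j + 1)
      rw [hD, map_add, map_mul, MvPolynomial.aeval_X] at e1 e2
      have e3 := aeval_congr_of_mem_supported hq
        (hlow (r + 1 + j) fun i hi => ih i hi (by omega))
      have e4 := aeval_congr_of_mem_supported (pderiv_mem_supported (yVar F σ r) hp) hr
      rw [← e3, ← e4] at e2
      have e5 : MvPolynomial.aeval y (MvPolynomial.pderiv (yVar F σ r) p) * z (r + 1 + j) =
          MvPolynomial.aeval y (MvPolynomial.pderiv (yVar F σ r) p) * orbit d c (r + 1 + j) :=
        add_right_cancel (e1.trans e2.symm)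
      exact mul_left_cancel₀ h1 e5

/-- Elimination of one existential quantifier: a formula about the jets of `a` and of one more
element `c` which holds in some differential model follows, in all models of (Deep) and for some
element in place of `c`, from a formula about the jet of `a`. -/
theorem exists_elim_formula (hK : AlgBoundedOver L (dclEmpty ι K))
    (η : Derivation ℤ (dclEmpty ι K) (dclEmpty ι K)) {σ : Type}
    (φ : L.Formula ((σ × ℕ) ⊕ ℕ)) {M : Type (max u v w)} [Field M] [CharZero M]
    [Ring.CompatibleRing M] [L.Structure M] [ι.IsExpansionOn M]
    [M ⊨ L.completeTheory K] (d : Derivation ℤ M M)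
    (hd : ∀ k, d (cst M k) = cst M (η k)) (a : σ → M) (c : M)
    (hφ : φ.Realize (Sum.elim (jet d a) (orbit d c))) :
    ∃ γ : L.Formula (σ × ℕ), γ.Realize (jet d a) ∧
      ∀ (N : Type (max u v w)) [Field N] [Ring.CompatibleRing N] [L.Structure N]
        [ι.IsExpansionOn N] [N ⊨ L.completeTheory K] (d' : Derivation ℤ N N),
        (∀ k, d' (cst N k) = cst N (η k)) → Deep L d' → ∀ b : σ → N, γ.Realize (jet d' b) →
        ∃ c' : N, φ.Realize (Sum.elim (jet d' b) (orbit d' c')) := by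
  classical
  obtain ⟨m, hm⟩ := exists_bound.{u, v, max u v w} φ
  by_cases hex : ∃ r, orbit d c r ∈ acl L (Set.range (jet d a) ∪ orbit d c '' {j | j < r})
  · -- The least order `r` of a derivative of `c` that is algebraic over the previous ones.
    let r := Nat.find hex
    obtain ⟨p, hp, hp0, hp1⟩ := exists_separable_relation hK _ _ (Nat.find_spec hex)
    let φ' : L.Formula ((σ × ℕ) ⊕ ℕ) := φ ⊓
      (elimCst (polyZero ι (MvPolynomial.pderiv (yVar (dclEmpty ι K) σ r) p))).not ⊓
      elimCst (polyZero ι p) ⊓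
      Formula.iInf fun j : Fin m => elimCst (polyZero ι ((totalD η)^[(j : ℕ) + 1] p))
    obtain ⟨γ, hγ, h⟩ := exists_jet_formula.{u, v, w} hK r φ' d a c (by
      simp only [φ', Formula.realize_inf, Formula.realize_not, Formula.realize_iInf,
        realize_elimCst, realize_polyZero]
      exact ⟨⟨⟨hφ, hp1⟩, hp0⟩, fun j => aeval_iterate_totalD hd a c hp0 _⟩)
      (fun i hi => Nat.find_min hex hi)
    refine ⟨γ, hγ, ?_⟩
    intro N _ _ _ _ _ d' hd' hdeep b hb
    obtain ⟨c', z, hz, hφ'⟩ := h N d' hdeep b hb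
    simp only [φ', Formula.realize_inf, Formula.realize_not, Formula.realize_iInf,
        realize_elimCst, realize_polyZero] at hφ'
    obtain ⟨⟨⟨h1, h2⟩, h3⟩, h4⟩ := hφ'
    refine ⟨c', (hm _ _ _ fun j hj => ?_).1 h1⟩
    exact eq_orbit_of_prolongations hd' b c' z hp hz h3 h2 (m := m)
      (fun j hj => h4 ⟨j, hj⟩) j (by omega)
  · -- All derivatives of `c` are independent, and `φ` depends only on those of order less than `m`.
    push Not at hex
    obtain ⟨γ, hγ, h⟩ := exists_jet_formula.{u, v, w} hK m φ d a c hφ fun i _ => hex i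
    refine ⟨γ, hγ, ?_⟩
    intro N _ _ _ _ _ d' _ hdeep b hb
    obtain ⟨c', z, hz, hφ'⟩ := h N d' hdeep b hb
    exact ⟨c', (hm _ _ _ fun j hj => hz j hj.le).1 hφ'⟩

end Elimination

/-! ### Models of `T^δ` and the theory of generic derivations -/

section DifferentialModels

variable {L : FirstOrder.Language.{u, v}} {ι : FirstOrder.Language.ring →ᴸ L}
  {K : Type x} [Field K] [CharZero K] [Ring.CompatibleRing K] [L.Structure K] [ι.IsExpansionOn K]
  {η : Derivation ℤ (dclEmpty ι K) (dclEmpty ι K)}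
  {M : Type*} [L.Structure M] [(withDeriv L).Structure M] [(incl L).IsExpansionOn M]

omit [L.Structure M] [(incl L).IsExpansionOn M] in
theorem realize_deltaT {α : Type} (t : (withDeriv L).Term α) (y : α → M) :
    (deltaT t).realize y = delta L M (t.realize y) :=
  Term.realize_functions_apply₁

section

variable [Field M] [Ring.CompatibleRing M] [ι.IsExpansionOn M]

theorem realize_addT {α : Type} (s t : (withDeriv L).Term α) (y : α → M) :
    (addT ι s t).realize y = s.realize y + t.realize y := by
  rw [addT, Term.realize_functions_apply₂, LHom.map_onFunction, LHom.map_onFunction,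
    Ring.CompatibleRing.funMap_add]
  rfl

theorem realize_mulT {α : Type} (s t : (withDeriv L).Term α) (y : α → M) :
    (mulT ι s t).realize y = s.realize y * t.realize y := by
  rw [mulT, Term.realize_functions_apply₂, LHom.map_onFunction, LHom.map_onFunction,
    Ring.CompatibleRing.funMap_mul]
  rfl

theorem forall_fin_two {A : Type*} {p : A → A → Prop} :
    (∀ i : Fin 2 → A, p (i 0) (i 1)) ↔ ∀ a b, p a b :=
  ⟨fun h a b => h ![a, b], fun h _ => h _ _⟩

theorem realize_addAxiom : M ⊨ addAxiom ι ↔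
    ∀ a b : M, delta L M (a + b) = delta L M a + delta L M b := by
  rw [addAxiom, Sentence.Realize, Formula.realize_iAlls, ← forall_fin_two]
  simp only [Formula.realize_equal, realize_deltaT, realize_addT, bvar, Term.realize_var,
    Sum.elim_inr]

theorem realize_mulAxiom : M ⊨ mulAxiom ι ↔
    ∀ a b : M, delta L M (a * b) = a * delta L M b + b * delta L M a := by
  rw [mulAxiom, Sentence.Realize, Formula.realize_iAlls, ← forall_fin_two]
  simp only [Formula.realize_equal, realize_deltaT, realize_addT, realize_mulT, bvar,
    Term.realize_var, Sum.elim_inr]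

end

omit [CharZero K] in
theorem realize_valueAxiom [M ⊨ L.completeTheory K] {a b : dclEmpty ι K}
    {α β : L.Formula (Fin 1)}
    (hα : ∀ y : Fin 1 → K, α.Realize y ↔ y 0 = a) (hβ : ∀ y : Fin 1 → K, β.Realize y ↔ y 0 = b) :
    M ⊨ valueAxiom α β ↔ delta L M (cst M a) = cst M b := by
  rw [valueAxiom, Sentence.Realize, Formula.realize_iAlls]
  simp only [Formula.realize_imp, Formula.realize_inf, Formula.realize_relabel,
    LHom.realize_onFormula, Formula.realize_equal, realize_deltaT, bvar,
    Term.realize_var, Sum.elim_inr, realize_iff_eq_cst hα, realize_iff_eq_cst hβ,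
    Function.comp_apply]
  constructor
  · intro h
    exact h ![cst M a, cst M b] ⟨rfl, rfl⟩
  · rintro h i ⟨h0, h1⟩
    rw [h0, h1, h]

omit [CharZero K] in
theorem model_completeTheory_of_theoryDelta (h : M ⊨ theoryDelta ι K η) :
    M ⊨ L.completeTheory K :=
  (LHom.onTheory_model (incl L) _).1
    (h.mono (Set.subset_union_left.trans Set.subset_union_left))

/-- A model of `T^δ` carries a derivation that extends `η`. -/
theorem exists_derivation [M ⊨ L.completeTheory K] (h : M ⊨ theoryDelta ι K η) :
    ∃ (_ : Field M) (_ : Ring.CompatibleRing M) (_ : CharZero M) (_ : ι.IsExpansionOn M)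
      (d : Derivation ℤ M M), d = delta L M ∧ ∀ k, d (cst M k) = cst M (η k) := by
  obtain ⟨_, _, _, _⟩ := exists_field ι K M
  have hadd := realize_addAxiom.1
    (h.realize_of_mem _ (Or.inl (Or.inr (Or.inl rfl))) : M ⊨ addAxiom ι)
  have hmul := realize_mulAxiom.1
    (h.realize_of_mem _ (Or.inl (Or.inr (Or.inr rfl))) : M ⊨ mulAxiom ι)
  refine ⟨inferInstance, inferInstance, inferInstance, inferInstance,
    Derivation.mk' (AddMonoidHom.mk' (delta L M) hadd).toIntLinearMap hmul, rfl, fun k => ?_⟩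
  exact (realize_valueAxiom (realize_cstForm k) (realize_cstForm (η k))).1
    (h.realize_of_mem _ (Or.inr ⟨k, _, _, realize_cstForm k, realize_cstForm (η k), rfl⟩))

omit [CharZero K] in
theorem model_theoryDelta [M ⊨ L.completeTheory K] [Field M] [Ring.CompatibleRing M]
    [ι.IsExpansionOn M] (d : Derivation ℤ M M) (hd : d = delta L M)
    (hc : ∀ k, d (cst M k) = cst M (η k)) : M ⊨ theoryDelta ι K η := by
  refine Theory.model_union_iff.2 ⟨Theory.model_union_iff.2
    ⟨(LHom.onTheory_model (incl L) _).2 inferInstance, ⟨?_⟩⟩, ⟨?_⟩⟩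
  · rintro σ (rfl | rfl)
    · refine realize_addAxiom.2 fun a b => ?_
      rw [← hd, map_add]
    · refine realize_mulAxiom.2 fun a b => ?_
      rw [← hd, Derivation.leibniz, smul_eq_mul, smul_eq_mul]
  · rintro σ ⟨a, α, β, hα, hβ, rfl⟩
    refine (realize_valueAxiom hα hβ).2 ?_
    rw [← hd, hc]

end DifferentialModels

section Axioms

variable {L : FirstOrder.Language.{u, v}} {ι : FirstOrder.Language.ring →ᴸ L}
  {K : Type x} [Field K] [Ring.CompatibleRing K] [L.Structure K] [ι.IsExpansionOn K]

/-- The `L`-formula `γ`, evaluated at the iterates of `δ` at a tuple. -/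
def jetForm {σ : Type} (γ : L.Formula (σ × ℕ)) : (withDeriv L).Formula σ :=
  ((incl L).onFormula γ).subst fun p => deltaT^[p.2] (Term.var p.1)

theorem realize_iterate_deltaT {M : Type*} [(withDeriv L).Structure M] {α : Type}
    (t : (withDeriv L).Term α) (y : α → M) (n : ℕ) :
    (deltaT^[n] t).realize y = (delta L M)^[n] (t.realize y) := by
  induction n with
  | zero => rfl
  | succ n ih => rw [Function.iterate_succ_apply', Function.iterate_succ_apply', realize_deltaT, ih]

theorem realize_jetForm {M : Type*} [L.Structure M] [(withDeriv L).Structure M]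
    [(incl L).IsExpansionOn M] {σ : Type} (γ : L.Formula (σ × ℕ)) (a : σ → M) :
    (jetForm γ).Realize a ↔ γ.Realize (jet (delta L M) a) := by
  rw [jetForm, Formula.Realize, BoundedFormula.realize_subst, ← LHom.realize_onFormula (incl L)]
  simp only [realize_iterate_deltaT]
  rfl

/-- The substitution that turns `Z(z, x, y)` into `Z(z, c, δ c, …, δ ^ n c)`, as an evaluation at
the jet of `(z, c)`. -/
def deepVar {k n : ℕ} : (Fin k ⊕ Fin n) ⊕ Fin 1 → (Fin k ⊕ Fin 1) × ℕ :=
  Sum.elim (Sum.elim (fun i => (Sum.inl i, 0)) fun i => (Sum.inr 0, i)) fun _ => (Sum.inr 0, n)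

/-- The instance of the scheme (Deep) for the formula `Z`, universally quantified over its
parameters. -/
noncomputable def deepAxiom (hK : AlgBoundedOver L (dclEmpty ι K)) {k n : ℕ}
    (Z : L.Formula ((Fin k ⊕ Fin n) ⊕ Fin 1)) : (withDeriv L).Sentence :=
  Formula.iAlls (Fin k) ((((incl L).onFormula (iterInf hK n (Z.iExs (Fin 1)))).imp
    (Formula.iExs (Fin 1) (jetForm (Z.relabel deepVar)))).relabel Sum.inr)

theorem realize_deepAxiom (hK : AlgBoundedOver L (dclEmpty ι K)) {M : Type*} [L.Structure M]
    [(withDeriv L).Structure M] [(incl L).IsExpansionOn M] {k n : ℕ}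
    (Z : L.Formula ((Fin k ⊕ Fin n) ⊕ Fin 1)) :
    M ⊨ deepAxiom hK Z ↔ ∀ z : Fin k → M, (iterInf hK n (Z.iExs (Fin 1))).Realize z →
      ∃ c : M, Z.Realize (Sum.elim (Sum.elim z fun i : Fin n => (delta L M)^[(i : ℕ)] c)
        fun _ => (delta L M)^[n] c) := by
  have h1 : ∀ (z : Fin k → M) (c : Fin 1 → M),
      jet (delta L M) (Sum.elim z c) ∘ deepVar (n := n) =
      Sum.elim (Sum.elim z fun i : Fin n => (delta L M)^[(i : ℕ)] (c 0))
        fun _ => (delta L M)^[n] (c 0) := by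
    intro z c
    ext ((i | i) | i) <;> rfl
  simp only [deepAxiom, Sentence.Realize, Formula.realize_iAlls, Formula.realize_relabel,
    Sum.elim_comp_inr, Formula.realize_imp, LHom.realize_onFormula,
    Formula.realize_iExs (γ := Fin 1) (φ := jetForm _), realize_jetForm, h1]
  exact forall_congr' fun z => imp_congr_right fun _ =>
    ⟨fun ⟨c, hc⟩ => ⟨c 0, hc⟩, fun ⟨c, hc⟩ => ⟨fun _ => c, hc⟩⟩

/-- The theory of generic derivations: `T^δ` together with the scheme (Deep). -/
def genericTheory (hK : AlgBoundedOver L (dclEmpty ι K))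
    (η : Derivation ℤ (dclEmpty ι K) (dclEmpty ι K)) : (withDeriv L).Theory :=
  theoryDelta ι K η ∪ {σ | ∃ (k n : ℕ) (Z : L.Formula ((Fin k ⊕ Fin n) ⊕ Fin 1)),
    σ = deepAxiom hK Z}

/-- A formula has only finitely many parameters. -/
theorem exists_finite_params {A B C : Type*} (Z : L.Formula ((A ⊕ B) ⊕ C)) :
    ∃ (k : ℕ) (e : Fin k → A) (Z' : L.Formula ((Fin k ⊕ B) ⊕ C)),
      ∀ {M : Type w} [L.Structure M] (a : A → M) (b : B → M) (c : C → M),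
        Z'.Realize (Sum.elim (Sum.elim (a ∘ e) b) c) ↔
          Z.Realize (Sum.elim (Sum.elim a b) c) := by
  let Y : L.Formula (A ⊕ (B ⊕ C)) := Z.relabel (Equiv.sumAssoc A B C)
  refine ⟨_, paramEnum Y, (paramForm Y).relabel (Equiv.sumAssoc _ B C).symm, fun a b c => ?_⟩
  have h := realize_paramForm Y a (Sum.elim b c)
  rw [Formula.realize_relabel] at h ⊢
  convert h using 2
  · ext (i | i | i) <;> rfl
  · ext ((i | i) | i) <;> rfl

variable [CharZero K]

/-- The theory of generic derivations is axiomatized by `T^δ` and (Deep), because largeness is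
definable uniformly in the parameters. -/
theorem model_genericTheory_iff (hK : AlgBoundedOver L (dclEmpty ι K))
    (η : Derivation ℤ (dclEmpty ι K) (dclEmpty ι K)) {M : Type (max u v w)} [L.Structure M]
    [(withDeriv L).Structure M] [(incl L).IsExpansionOn M] :
    M ⊨ genericTheory hK η ↔ M ⊨ theoryDelta ι K η ∧ Deep L (delta L M) := by
  rw [genericTheory, Theory.model_union_iff]
  refine and_congr_right fun hM => ?_
  have := model_completeTheory_of_theoryDelta hM
  constructor
  · intro h n Z hZ
    obtain ⟨k, e, Z', hZ'⟩ := exists_finite_params.{u, v, max u v w} Z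
    have h1 := (realize_deepAxiom hK Z').1 (h.realize_of_mem _ ⟨k, n, Z', rfl⟩) e (by
      rw [large_iff.{u, v, w} hK, realize_iterInf] at hZ
      rw [realize_iterInf]
      simp only [proj, Formula.realize_iExs, ← hZ' id] at hZ ⊢
      exact hZ)
    obtain ⟨c, hc⟩ := h1
    exact ⟨c, (hZ' id _ _).1 hc⟩
  · intro h
    refine ⟨?_⟩
    rintro σ ⟨k, n, Z, rfl⟩
    exact (realize_deepAxiom hK Z).2 fun z hz => deep_apply.{u, v, w} hK h Z z hz

end Axioms

/-! ### Relative quantifier elimination -/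

section JetDefinable

variable {L : FirstOrder.Language.{u, v}}

/-- The property `P` of tuples in models of `U` is expressed by an `L`-formula about jets. The
property is a predicate, rather than a formula of `L^δ`, so that the closure properties need no
manipulation of formulas of `L^δ`. -/
def JetDef (U : (withDeriv L).Theory) {σ : Type}
    (P : ∀ (M : Type (max u v w)) [(withDeriv L).Structure M], (σ → M) → Prop) : Prop :=
  ∃ γ : L.Formula (σ × ℕ), ∀ (M : Type (max u v w)) [L.Structure M] [(withDeriv L).Structure M]
    [(incl L).IsExpansionOn M], M ⊨ U → ∀ a : σ → M, P M a ↔ γ.Realize (jet (delta L M) a)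

variable {U : (withDeriv L).Theory}

theorem JetDef.congr {σ : Type}
    {P Q : ∀ (M : Type (max u v w)) [(withDeriv L).Structure M], (σ → M) → Prop}
    (hP : JetDef.{u, v, w} U P)
    (h : ∀ (M : Type (max u v w)) [(withDeriv L).Structure M] (a : σ → M), P M a ↔ Q M a) :
    JetDef.{u, v, w} U Q := by
  obtain ⟨γ, hγ⟩ := hP
  exact ⟨γ, fun M _ _ _ hM a => (h M a).symm.trans (hγ M hM a)⟩

theorem JetDef.imp {σ : Type}
    {P Q : ∀ (M : Type (max u v w)) [(withDeriv L).Structure M], (σ → M) → Prop}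
    (hP : JetDef.{u, v, w} U P) (hQ : JetDef.{u, v, w} U Q) :
    JetDef.{u, v, w} U fun M _ a => P M a → Q M a := by
  obtain ⟨γ, hγ⟩ := hP
  obtain ⟨γ', hγ'⟩ := hQ
  exact ⟨γ.imp γ', fun M _ _ _ hM a =>
    (imp_congr (hγ M hM a) (hγ' M hM a)).trans Formula.realize_imp.symm⟩

theorem JetDef.not {σ : Type}
    {P : ∀ (M : Type (max u v w)) [(withDeriv L).Structure M], (σ → M) → Prop}
    (hP : JetDef.{u, v, w} U P) : JetDef.{u, v, w} U fun M _ a => ¬ P M a := by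
  obtain ⟨γ, hγ⟩ := hP
  exact ⟨γ.not, fun M _ _ _ hM a =>
    (not_congr (hγ M hM a)).trans Formula.realize_not.symm⟩

theorem JetDef.and {σ : Type}
    {P Q : ∀ (M : Type (max u v w)) [(withDeriv L).Structure M], (σ → M) → Prop}
    (hP : JetDef.{u, v, w} U P) (hQ : JetDef.{u, v, w} U Q) :
    JetDef.{u, v, w} U fun M _ a => P M a ∧ Q M a :=
  (hP.imp hQ.not).not.congr fun M _ a => by tauto

theorem JetDef.forall_fin {σ : Type} {l : ℕ}
    {P : Fin l → ∀ (M : Type (max u v w)) [(withDeriv L).Structure M], (σ → M) → Prop}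
    (hP : ∀ i, JetDef.{u, v, w} U (P i)) : JetDef.{u, v, w} U fun M _ a => ∀ i, P i M a := by
  choose γ hγ using hP
  exact ⟨Formula.iInf γ, fun M _ _ _ hM a => by
    rw [Formula.realize_iInf]
    exact forall_congr' fun i => hγ i M hM a⟩

theorem JetDef.comp {σ τ : Type} (g : σ → τ)
    {P : ∀ (M : Type (max u v w)) [(withDeriv L).Structure M], (σ → M) → Prop}
    (hP : JetDef.{u, v, w} U P) : JetDef.{u, v, w} U fun M _ (b : τ → M) => P M (b ∘ g) := by
  obtain ⟨γ, hγ⟩ := hP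
  exact ⟨γ.relabel (Prod.map g id), fun M _ _ _ hM a => by
    rw [Formula.realize_relabel]
    exact hγ M hM _⟩

variable {ι : FirstOrder.Language.ring →ᴸ L}
  {K : Type x} [Field K] [CharZero K] [Ring.CompatibleRing K] [L.Structure K] [ι.IsExpansionOn K]
  {hK : AlgBoundedOver L (dclEmpty ι K)} {η : Derivation ℤ (dclEmpty ι K) (dclEmpty ι K)}

/-- Elimination of one existential quantifier modulo the theory of generic derivations. The formula
is obtained by compactness from the formulas of `exists_elim_formula`. -/
theorem JetDef.exists_one {σ : Type}
    {P : ∀ (M : Type (max u v w)) [(withDeriv L).Structure M], (σ ⊕ Fin 1 → M) → Prop}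
    (hP : JetDef.{u, v, w} (genericTheory hK η) P) :
    JetDef.{u, v, w} (genericTheory hK η) fun M _ a => ∃ c : M, P M (Sum.elim a fun _ => c) := by
  classical
  obtain ⟨γ0, hγ0⟩ := hP
  let φ : L.Formula ((σ × ℕ) ⊕ ℕ) := γ0.relabel fun p => match p with
    | (Sum.inl s, j) => Sum.inl (s, j)
    | (Sum.inr _, j) => Sum.inr j
  have hφ : ∀ {M : Type (max u v w)} [L.Structure M] (δ : M → M) (a : σ → M) (c : M),
      φ.Realize (Sum.elim (jet δ a) (orbit δ c)) ↔
        γ0.Realize (jet δ (Sum.elim a fun _ => c)) := by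
    intro M _ δ a c
    rw [Formula.realize_relabel]
    congr! 1
    ext ⟨i | i, j⟩ <;> rfl
  -- The formulas on jets which imply the formula with a quantifier.
  let Γ : Set (L.Formula (σ × ℕ)) := {γ | ∀ (M : Type (max u v w)) [L.Structure M]
    [(withDeriv L).Structure M] [(incl L).IsExpansionOn M], M ⊨ genericTheory hK η →
    ∀ a : σ → M, γ.Realize (jet (delta L M) a) →
      ∃ c : M, φ.Realize (Sum.elim (jet (delta L M) a) (orbit (delta L M) c))}
  have hΓ : ∀ (M : Type (max u v w)) [L.Structure M] [(withDeriv L).Structure M]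
      [(incl L).IsExpansionOn M], M ⊨ genericTheory hK η → ∀ (a : σ → M) (c : M),
      φ.Realize (Sum.elim (jet (delta L M) a) (orbit (delta L M) c)) →
      ∃ γ ∈ Γ, γ.Realize (jet (delta L M) a) := by
    intro M _ _ _ hM a c hc
    have hM' := ((model_genericTheory_iff.{u, v, w} hK η).1 hM).1
    have := model_completeTheory_of_theoryDelta hM'
    obtain ⟨_, _, _, _, d, hd, hdc⟩ := exists_derivation hM'
    rw [← hd] at hc
    obtain ⟨γ, hγ, h⟩ := exists_elim_formula.{u, v, w} hK η φ d hdc a c hc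
    rw [hd] at hγ
    refine ⟨γ, ?_, hγ⟩
    intro N _ _ _ hN b hb
    obtain ⟨hN', hdeep⟩ := (model_genericTheory_iff.{u, v, w} hK η).1 hN
    have := model_completeTheory_of_theoryDelta hN'
    obtain ⟨_, _, _, _, d', hd', hdc'⟩ := exists_derivation hN'
    rw [← hd'] at hb hdeep ⊢
    exact h N d' hdc' hdeep b hb
  have hjet : ∀ {M : Type (max u v w)} [L.Structure M] [(withDeriv L).Structure M]
      [(incl L).IsExpansionOn M] (γ : L.Formula (σ × ℕ)) (y : σ ⊕ Fin 1 → M),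
      (jetForm (γ.relabel (Prod.map Sum.inl id))).Realize y ↔
        γ.Realize (jet (delta L M) (y ∘ Sum.inl)) := by
    intro M _ _ _ γ y
    rw [realize_jetForm, Formula.realize_relabel]
    rfl
  have hP' : ∀ (M : Type (max u v w)) [L.Structure M] [(withDeriv L).Structure M]
      [(incl L).IsExpansionOn M], M ⊨ genericTheory hK η → ∀ (a : σ → M) (c : M),
      P M (Sum.elim a fun _ => c) ↔
        φ.Realize (Sum.elim (jet (delta L M) a) (orbit (delta L M) c)) :=
    fun M _ _ _ hM a c => (hγ0 M hM _).trans (hφ _ _ _).symm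
  by_contra hcon
  -- Otherwise, no finite disjunction of formulas in `Γ` is equivalent to the given formula.
  obtain ⟨N, _, _, y, hy⟩ := exists_realize_of_finset.{u, v, max u v w, 0}
    (((fun σ' : (withDeriv L).Sentence => (σ'.relabel Empty.elim :
        (withDeriv L).Formula (σ ⊕ Fin 1))) '' genericTheory hK η) ∪
      {jetForm γ0} ∪ {ψ | ∃ γ ∈ Γ, ψ = (jetForm (γ.relabel (Prod.map Sum.inl id))).not})
    (fun s hs => by
      let g : s → L.Formula (σ × ℕ) := fun ψ => if h : ∃ γ ∈ Γ,
        (ψ : (withDeriv L).Formula (σ ⊕ Fin 1)) =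
          (jetForm (γ.relabel (Prod.map Sum.inl id))).not then h.choose else ⊥
      have hg : ∀ ψ, g ψ ∈ Γ := by
        intro ψ
        simp only [g]
        split_ifs with h
        · exact h.choose_spec.1
        · intro M _ _ _ _ a ha
          exact ha.elim
      have hnot : ∃ (M : Type (max u v w)) (_ : L.Structure M) (_ : (withDeriv L).Structure M)
          (_ : (incl L).IsExpansionOn M), M ⊨ genericTheory hK η ∧ ∃ (a : σ → M) (c : M),
          P M (Sum.elim a fun _ => c) ∧ ¬ (Formula.iSup g).Realize (jet (delta L M) a) := by
        by_contra hno
        push Not at hno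
        refine hcon ⟨Formula.iSup g, fun M _ _ _ hM a => ⟨?_, fun ha => ?_⟩⟩
        · rintro ⟨c, hc⟩
          exact hno M inferInstance inferInstance inferInstance hM a c hc
        · obtain ⟨ψ, hψ⟩ := Formula.realize_iSup.1 ha
          obtain ⟨c, hc⟩ := hg ψ M hM a hψ
          exact ⟨c, (hP' M hM a c).2 hc⟩
      obtain ⟨M, _, _, _, hM, a, c, hc, hna⟩ := hnot
      refine ⟨M, inferInstance, ⟨c⟩, Sum.elim a fun _ => c, fun ψ hψ => ?_⟩
      rcases hs hψ with (⟨σ', hσ', rfl⟩ | rfl) | h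
      · rw [Formula.realize_relabel]
        convert hM.realize_of_mem σ' hσ' using 1
        unfold Sentence.Realize
        congr! 1
      · rw [realize_jetForm]
        exact (hγ0 M hM _).1 hc
      · have hgs : ψ = (jetForm ((g ⟨ψ, hψ⟩).relabel (Prod.map Sum.inl id))).not := by
          have h' : ∃ γ ∈ Γ, ψ = (jetForm (γ.relabel (Prod.map Sum.inl id))).not := h
          simp only [g]
          rw [dif_pos h']
          exact h'.choose_spec.2
        rw [hgs, Formula.realize_not, hjet]
        exact fun h1 => hna (Formula.realize_iSup.2 ⟨_, h1⟩))
  let _ : L.Structure N := baseStructure L N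
  have hN : N ⊨ genericTheory hK η := by
    refine ⟨fun σ' hσ' => ?_⟩
    have := hy _ (Or.inl (Or.inl ⟨σ', hσ', rfl⟩))
    rw [Formula.realize_relabel] at this
    convert this using 1
    unfold Sentence.Realize
    congr! 1
  have hy0 : y = Sum.elim (y ∘ Sum.inl) fun _ => y (Sum.inr 0) := by
    ext (i | i)
    · rfl
    · exact congrArg (fun i => y (Sum.inr i)) (Subsingleton.elim _ _)
  have h1 : γ0.Realize (jet (delta L N) y) :=
    (realize_jetForm γ0 y).1 (hy _ (Or.inl (Or.inr rfl)))
  rw [hy0, ← hφ] at h1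
  obtain ⟨γ, hγ, h2⟩ := hΓ N hN _ _ h1
  exact (hy _ (Or.inr ⟨γ, hγ, rfl⟩)) ((hjet γ y).2 h2)

theorem JetDef.exists_fin {l : ℕ} : ∀ {σ : Type}
    {P : ∀ (M : Type (max u v w)) [(withDeriv L).Structure M], (σ ⊕ Fin l → M) → Prop}
    (_ : JetDef.{u, v, w} (genericTheory hK η) P),
    JetDef.{u, v, w} (genericTheory hK η) fun M _ a => ∃ c : Fin l → M, P M (Sum.elim a c) := by
  induction l with
  | zero =>
    intro σ P hP
    refine (hP.comp (Sum.elim id Fin.elim0)).congr fun M _ a => ?_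
    have h : ∀ c : Fin 0 → M, a ∘ Sum.elim id Fin.elim0 = Sum.elim a c := fun c => by
      ext (i | i)
      · rfl
      · exact i.elim0
    exact ⟨fun h1 => ⟨Fin.elim0, by rwa [← h]⟩, fun ⟨c, hc⟩ => by rwa [h c]⟩
  | succ l ih =>
    intro σ P hP
    have hP' : JetDef.{u, v, w} (genericTheory hK η) fun M _
        (b : (σ ⊕ Fin l) ⊕ Fin 1 → M) => P M (b ∘ splitLast) := hP.comp splitLast
    refine (ih hP'.exists_one).congr fun M _ a => ?_
    simp only [elim_comp_splitLast]
    constructor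
    · rintro ⟨c, d, h⟩
      exact ⟨_, h⟩
    · rintro ⟨c, h⟩
      refine ⟨Fin.init c, c (Fin.last l), ?_⟩
      rwa [Fin.snoc_init_self]

/-- The graph of a term of `L^δ` is expressed by a formula about jets. -/
theorem jetDef_term {τ : Type} (t : (withDeriv L).Term τ) :
    JetDef.{u, v, w} (genericTheory hK η) fun M _ (y : τ ⊕ Fin 1 → M) =>
      y (Sum.inr 0) = t.realize (y ∘ Sum.inl) := by
  induction t with
  | var i => exact ⟨Term.equal (Term.var (Sum.inr 0, 0)) (Term.var (Sum.inl i, 0)),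
      fun M _ _ _ _ a => by rw [Formula.realize_equal]; rfl⟩
  | @func l f ts ih =>
    have h1 : JetDef.{u, v, w} (genericTheory hK η) fun M _ (y : (τ ⊕ Fin 1) ⊕ Fin l → M) =>
        ∀ i, y (Sum.inr i) = (ts i).realize (y ∘ Sum.inl ∘ Sum.inl) :=
      JetDef.forall_fin fun i => ((ih i).comp (Sum.elim (fun s => Sum.inl (Sum.inl s))
        fun _ => (Sum.inr i : (τ ⊕ Fin 1) ⊕ Fin l))).congr fun M _ a => Iff.rfl
    have h2 : JetDef.{u, v, w} (genericTheory hK η) fun M _ (y : (τ ⊕ Fin 1) ⊕ Fin l → M) =>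
        y (Sum.inl (Sum.inr 0)) = Structure.funMap f (y ∘ Sum.inr) := by
      rcases f with f | f
      · refine ⟨Term.equal (Term.var (Sum.inl (Sum.inr 0), 0))
          (Term.func f fun i => Term.var (Sum.inr i, 0)), fun M _ _ _ _ a => ?_⟩
        rw [Formula.realize_equal]
        have : Structure.funMap (L := withDeriv L) (Sum.inl f) (a ∘ Sum.inr) =
          Structure.funMap f (a ∘ Sum.inr) := LHom.map_onFunction (incl L) f _
        exact iff_of_eq (congrArg (fun z => a (Sum.inl (Sum.inr 0)) = z) this)
      · cases f
        refine ⟨Term.equal (Term.var (Sum.inl (Sum.inr 0), 0)) (Term.var (Sum.inr 0, 1)),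
          fun M _ _ _ _ a => ?_⟩
        rw [Formula.realize_equal]
        have : a ∘ Sum.inr = ![a (Sum.inr 0)] := funext fun i => by
          rw [Subsingleton.elim i 0]
          rfl
        exact iff_of_eq (congrArg
          (fun z => a (Sum.inl (Sum.inr 0)) = Structure.funMap (deltaSymb L) z) this)
    refine (h1.and h2).exists_fin.congr fun M _ a => ?_
    constructor
    · rintro ⟨c, hc1, hc2⟩
      have : c = fun i => (ts i).realize (a ∘ Sum.inl) := funext hc1
      rw [this] at hc2
      exact hc2
    · intro h
      exact ⟨fun i => (ts i).realize (a ∘ Sum.inl), fun i => rfl, h⟩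

theorem JetDef.subst {τ : Type} {l : ℕ} (ts : Fin l → (withDeriv L).Term τ)
    {P : ∀ (M : Type (max u v w)) [(withDeriv L).Structure M], (Fin l → M) → Prop}
    (hP : JetDef.{u, v, w} (genericTheory hK η) P) :
    JetDef.{u, v, w} (genericTheory hK η) fun M _ (y : τ → M) =>
      P M fun i => (ts i).realize y := by
  have h1 : JetDef.{u, v, w} (genericTheory hK η) fun M _ (y : τ ⊕ Fin l → M) =>
      ∀ i, y (Sum.inr i) = (ts i).realize (y ∘ Sum.inl) :=
    JetDef.forall_fin fun i => ((jetDef_term (ts i)).comp (Sum.elim Sum.inl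
      fun _ => (Sum.inr i : τ ⊕ Fin l))).congr fun M _ a => Iff.rfl
  have h2 : JetDef.{u, v, w} (genericTheory hK η) fun M _ (y : τ ⊕ Fin l → M) =>
    P M (y ∘ Sum.inr) := hP.comp Sum.inr
  refine (h1.and h2).exists_fin.congr fun M _ a => ?_
  constructor
  · rintro ⟨c, hc1, hc2⟩
    have : c = fun i => (ts i).realize a := funext hc1
    rw [this] at hc2
    exact hc2
  · intro h
    exact ⟨fun i => (ts i).realize a, fun i => rfl, h⟩

theorem jetDef_boundedFormula {τ : Type} {n : ℕ} (α : (withDeriv L).BoundedFormula τ n) :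
    JetDef.{u, v, w} (genericTheory hK η) fun M _ (y : τ ⊕ Fin n → M) =>
      α.Realize (y ∘ Sum.inl) (y ∘ Sum.inr) := by
  induction α with
  | falsum => exact ⟨⊥, fun M _ _ _ _ a => Iff.rfl⟩
  | @equal n t₁ t₂ =>
    have h : JetDef.{u, v, w} (genericTheory hK η) fun M _ (y : Fin 2 → M) => y 0 = y 1 :=
      ⟨Term.equal (Term.var (0, 0)) (Term.var (1, 0)),
        fun M _ _ _ _ a => by rw [Formula.realize_equal]; rfl⟩
    refine (h.subst ![t₁, t₂]).congr fun M _ a => ?_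
    simp only [Matrix.cons_val_zero, Matrix.cons_val_one, BoundedFormula.Realize,
      Sum.elim_comp_inl_inr]
  | @rel n l R ts =>
    have h : JetDef.{u, v, w} (genericTheory hK η) fun M _ (y : Fin l → M) =>
        Structure.RelMap R y := by
      rcases R with R | R
      · refine ⟨Relations.formula R fun i => Term.var (i, 0), fun M _ _ _ _ a => ?_⟩
        rw [Formula.realize_rel]
        exact iff_of_eq (LHom.map_onRelation (incl L) R _)
      · exact R.elim
    refine (h.subst ts).congr fun M _ a => ?_
    simp only [BoundedFormula.Realize, Sum.elim_comp_inl_inr]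
  | imp φ ψ ih1 ih2 => exact (ih1.imp ih2).congr fun M _ a => Iff.rfl
  | @all n φ ih =>
    have h1 : JetDef.{u, v, w} (genericTheory hK η) fun M _ (b : (τ ⊕ Fin n) ⊕ Fin 1 → M) =>
        φ.Realize ((b ∘ splitLast) ∘ Sum.inl) ((b ∘ splitLast) ∘ Sum.inr) := ih.comp splitLast
    refine h1.not.exists_one.not.congr fun M _ a => ?_
    rw [BoundedFormula.realize_all]
    push Not
    refine forall_congr' fun c => ?_
    have := elim_comp_splitLast (a ∘ Sum.inl) (a ∘ Sum.inr) c
    rw [Sum.elim_comp_inl_inr] at this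
    rw [this, Sum.elim_comp_inl, Sum.elim_comp_inr]

/-- Relative quantifier elimination: modulo the theory of generic derivations, every formula of
`L^δ` is equivalent to an `L`-formula about jets. -/
theorem exists_jet_equiv (hK : AlgBoundedOver L (dclEmpty ι K))
    (η : Derivation ℤ (dclEmpty ι K) (dclEmpty ι K)) {τ : Type} (α : (withDeriv L).Formula τ) :
    ∃ γ : L.Formula (τ × ℕ), ∀ (M : Type (max u v w)) [L.Structure M] [(withDeriv L).Structure M]
      [(incl L).IsExpansionOn M], M ⊨ genericTheory hK η → ∀ y : τ → M,
      α.Realize y ↔ γ.Realize (jet (delta L M) y) := by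
  refine ((jetDef_boundedFormula (hK := hK) (η := η) α).comp
    (Sum.elim id Fin.elim0)).congr fun M _ a => ?_
  unfold Formula.Realize
  congr! 1

end JetDefinable

/-! ### Extension of derivations -/

section DerivationExtension

/-- A field of characteristic zero is formally smooth over each of its subrings. -/
theorem formallySmooth_of_injective {S N : Type*} [CommRing S] [Field N] [CharZero N] [Algebra S N]
    (hS : Function.Injective (algebraMap S N)) : Algebra.FormallySmooth S N := by
  have : IsDomain S := hS.isDomain (algebraMap S N)
  have : FaithfulSMul S N := (faithfulSMul_iff_algebraMap_injective S N).2 hS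
  let := FractionRing.liftAlgebra S N
  have := FractionRing.isScalarTower_liftAlgebra S N
  have : CharZero (FractionRing S) := by
    have h : CharZero S := ⟨fun m n h => by
      have := congrArg (algebraMap S N) h
      simpa using this⟩
    exact charZero_of_injective_algebraMap (IsFractionRing.injective S (FractionRing S))
  obtain ⟨s, hs⟩ := exists_isTranscendenceBasis (FractionRing S) N
  have halg := hs.isAlgebraic_field
  have : Algebra.IsSeparable (IntermediateField.adjoin (FractionRing S) (Set.range
    ((↑) : s → N))) N := inferInstance
  have h1 : Algebra.FormallySmooth (FractionRing S) N :=
    .of_algebraicIndependent_of_isSeparable hs.1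
  have h2 : Algebra.FormallySmooth S (FractionRing S) :=
    .of_isLocalization (nonZeroDivisors S)
  exact .comp S (FractionRing S) N

/-- A ring homomorphism from `S` to `B` extends along a surjection `B → N` with nilpotent kernel to
a section over `N`, if `N` is formally smooth over `S`. -/
theorem exists_section {S N B : Type*} [CommRing S] [CommRing N] [CommRing B] [Algebra S N]
    [Algebra.FormallySmooth S N] (h : S →+* B) (g : B →+* N) (hg : Function.Surjective g)
    (hk : IsNilpotent (RingHom.ker g)) (hc : ∀ s, g (h s) = algebraMap S N s) :
    ∃ l : N →+* B, (∀ x, g (l x) = x) ∧ ∀ s, l (algebraMap S N s) = h s := by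
  let := h.toAlgebra
  let g' : B →ₐ[S] N := { g with commutes' := hc }
  let l := Algebra.FormallySmooth.liftOfSurjective (AlgHom.id S N) g' hg hk
  exact ⟨l, fun x => Algebra.FormallySmooth.liftOfSurjective_apply (AlgHom.id S N) g' hg hk x,
    fun s => l.commutes s⟩

/-- In characteristic zero, a derivation extends to a larger field with arbitrarily prescribed
values at algebraically independent elements. -/
theorem exists_derivation_extension {A N σ : Type*} [CommRing A] [Field N] [CharZero N]
    [Algebra A N] {a : σ → N} (ha : AlgebraicIndependent A a) (d : Derivation ℤ A N) (b : σ → N) :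
    ∃ D : Derivation ℤ N N, (∀ m, D (algebraMap A N m) = d m) ∧ ∀ i, D (a i) = b i := by
  let : Algebra (MvPolynomial σ A) N := (MvPolynomial.aeval a).toRingHom.toAlgebra
  have : Algebra.FormallySmooth (MvPolynomial σ A) N := formallySmooth_of_injective ha
  -- A derivation with values in `N` is a ring homomorphism to the dual numbers over `N`.
  let h0 : A →+* TrivSqZeroExt N N :=
    { toFun := fun m => TrivSqZeroExt.inl (algebraMap A N m) + TrivSqZeroExt.inr (d m)
      map_one' := by ext <;> simp
      map_zero' := by ext <;> simp
      map_add' := fun x y => by ext <;> simp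
      map_mul' := fun x y => by
        ext
        · simp
        · simp only [map_mul, Derivation.leibniz, Algebra.smul_def, TrivSqZeroExt.snd_add,
            TrivSqZeroExt.snd_inl, TrivSqZeroExt.snd_inr, zero_add, TrivSqZeroExt.snd_mul,
            TrivSqZeroExt.fst_add, TrivSqZeroExt.fst_inl, TrivSqZeroExt.fst_inr, add_zero,
            op_smul_eq_smul, Algebra.algebraMap_self, RingHom.id_apply] }
  let h : MvPolynomial σ A →+* TrivSqZeroExt N N := MvPolynomial.eval₂Hom h0
    fun i => TrivSqZeroExt.inl (a i) + TrivSqZeroExt.inr (b i)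
  let g : TrivSqZeroExt N N →+* N := (TrivSqZeroExt.fstHom N N N).toRingHom
  have hgf : ∀ z, g z = z.fst := fun _ => rfl
  obtain ⟨l, hl, hs⟩ := exists_section h g (fun z => ⟨TrivSqZeroExt.inl z, rfl⟩)
    ⟨2, TrivSqZeroExt.kerIdeal_sq N N⟩ (fun s => by
      have : g.comp h = (MvPolynomial.aeval a : MvPolynomial σ A →ₐ[A] N).toRingHom := by
        refine MvPolynomial.ringHom_ext (fun m => ?_) fun i => ?_
        · simp [h, h0, hgf]
        · simp [h, hgf]
      exact congrArg (fun f : MvPolynomial σ A →+* N => f s) this)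
  have hl' : ∀ z, (l z).fst = z := hl
  refine ⟨Derivation.mk' (AddMonoidHom.mk' (fun z => (l z).snd) fun y z => by
    rw [map_add, TrivSqZeroExt.snd_add]).toIntLinearMap fun y z => ?_, fun m => ?_, fun i => ?_⟩
  · change (l (y * z)).snd = y • (l z).snd + z • (l y).snd
    rw [map_mul, TrivSqZeroExt.snd_mul, hl', hl', op_smul_eq_smul]
  · have h1 := hs (MvPolynomial.C m)
    have h2 : algebraMap (MvPolynomial σ A) N (MvPolynomial.C m) = algebraMap A N m :=
      MvPolynomial.aeval_C a m
    change (l (algebraMap A N m)).snd = d m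
    rw [← h2, h1]
    simp [h, h0]
  · have h1 := hs (MvPolynomial.X i)
    have h2 : algebraMap (MvPolynomial σ A) N (MvPolynomial.X i) = a i :=
      MvPolynomial.aeval_X a i
    change (l (a i)).snd = b i
    rw [← h2, h1]
    simp [h]

end DerivationExtension

/-! ### Extensions that satisfy an instance of (Wide) -/

section Extensions

variable {L : FirstOrder.Language.{u, v}}

/-- The structure of `derivLang` given by a function. -/
@[reducible]
def derivStructure {M : Type*} (d : M → M) : derivLang.Structure M where
  funMap | .delta => fun y => d (y 0)
  RelMap r := r.elim

/-- An `L`-elementary embedding which commutes with `δ`, as an embedding of `L^δ`-structures. -/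
def deltaEmbedding {M N : Type*} [L.Structure M] [(withDeriv L).Structure M]
    [(incl L).IsExpansionOn M] [L.Structure N] [(withDeriv L).Structure N]
    [(incl L).IsExpansionOn N] (f : M ↪ₑ[L] N) (hf : ∀ m, f (delta L M m) = delta L N (f m)) :
    M ↪[withDeriv L] N where
  toFun := f
  inj' := f.injective
  map_fun' := fun {n} g y => by
    rcases g with g | g
    · have h1 : Structure.funMap (L := withDeriv L) (Sum.inl g) y = Structure.funMap g y :=
        LHom.map_onFunction (incl L) g _
      have h2 : Structure.funMap (L := withDeriv L) (Sum.inl g) (f ∘ y) =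
        Structure.funMap g (f ∘ y) := LHom.map_onFunction (incl L) g _
      change f _ = Structure.funMap (L := withDeriv L) (Sum.inl g) (f ∘ y)
      rw [h1, h2, f.map_fun]
    · cases g
      have hy : y = ![y 0] := funext fun i => by rw [Subsingleton.elim i 0]; rfl
      have hy2 : f ∘ y = ![f (y 0)] := funext fun i => by rw [Subsingleton.elim i 0]; rfl
      have := hf (y 0)
      unfold delta at this
      rw [← hy, ← hy2] at this
      exact this
  map_rel' := fun {n} r y => by
    rcases r with r | r
    · have h1 : Structure.RelMap (L := withDeriv L) (Sum.inl r) y ↔ Structure.RelMap r y :=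
        iff_of_eq (LHom.map_onRelation (incl L) r _)
      have h2 : Structure.RelMap (L := withDeriv L) (Sum.inl r) (f ∘ y) ↔
        Structure.RelMap r (f ∘ y) := iff_of_eq (LHom.map_onRelation (incl L) r _)
      exact (h2.trans (f.map_rel r y)).trans h1.symm
    · exact r.elim

/-- The existence of a tuple `c` with `W(z, c, δ c)`, as a formula in the parameters `z`. -/
noncomputable def wideForm {k n : ℕ} (W : L.Formula ((Fin k ⊕ Fin n) ⊕ Fin n)) :
    (withDeriv L).Formula (Fin k) :=
  Formula.iExs (Fin n) (jetForm (W.relabel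
    (Sum.elim (fun i => (i, 0)) fun i => (Sum.inr i, 1) :
      (Fin k ⊕ Fin n) ⊕ Fin n → (Fin k ⊕ Fin n) × ℕ)))

theorem realize_wideForm {M : Type*} [L.Structure M] [(withDeriv L).Structure M]
    [(incl L).IsExpansionOn M] {k n : ℕ} (W : L.Formula ((Fin k ⊕ Fin n) ⊕ Fin n))
    (z : Fin k → M) : (wideForm W).Realize z ↔
      ∃ c : Fin n → M, W.Realize (Sum.elim (Sum.elim z c) fun i => delta L M (c i)) := by
  rw [wideForm, Formula.realize_iExs]
  refine exists_congr fun c => ?_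
  rw [realize_jetForm, Formula.realize_relabel]
  congr! 1
  ext ((i | i) | i) <;> rfl

theorem realize_wideForm_map {M N : Type*} [L.Structure M] [(withDeriv L).Structure M]
    [(incl L).IsExpansionOn M] [L.Structure N] [(withDeriv L).Structure N]
    [(incl L).IsExpansionOn N] (f : M ↪ₑ[L] N) (hf : ∀ m, f (delta L M m) = delta L N (f m))
    {k n : ℕ} {W : L.Formula ((Fin k ⊕ Fin n) ⊕ Fin n)} {z : Fin k → M}
    (h : (wideForm W).Realize z) : (wideForm W).Realize (f ∘ z) := by
  obtain ⟨c, hc⟩ := (realize_wideForm W z).1 h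
  refine (realize_wideForm W _).2 ⟨f ∘ c, ?_⟩
  rw [← f.map_formula, Sum.comp_elim, Sum.comp_elim] at hc
  convert hc using 3
  exact (hf _).symm

variable {ι : FirstOrder.Language.ring →ᴸ L}
  {K : Type x} [Field K] [CharZero K] [Ring.CompatibleRing K] [L.Structure K] [ι.IsExpansionOn K]
  (hK : AlgBoundedOver L (dclEmpty ι K)) {η : Derivation ℤ (dclEmpty ι K) (dclEmpty ι K)}

/-- The scheme (Wide), for formulas with finitely many parameters which are displayed. -/
def WideParams (M : Type*) [L.Structure M] [(withDeriv L).Structure M] : Prop :=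
  ∀ (k n : ℕ) (W : L.Formula ((Fin k ⊕ Fin n) ⊕ Fin n)) (z : Fin k → M),
    (iterInf hK n (W.iExs (Fin n))).Realize z → (wideForm W).Realize z

theorem wide_iff {M : Type (max u v w)} [L.Structure M] [(withDeriv L).Structure M]
    [(incl L).IsExpansionOn M] [M ⊨ L.completeTheory K] :
    Wide L (delta L M) ↔ WideParams hK M := by
  constructor
  · intro h k n W z hz
    rw [realize_wideForm]
    have := h n (W.relabel (Sum.map (Sum.map z id) id)) (by
      rw [large_iff.{u, v, w} hK, realize_iterInf]
      rw [realize_iterInf] at hz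
      simp only [proj, Formula.realize_iExs, Formula.realize_relabel, Sum.elim_comp_map,
        Function.id_comp, Function.comp_id] at hz ⊢
      exact hz)
    simpa only [Formula.realize_relabel, Sum.elim_comp_map, Function.id_comp,
      Function.comp_id] using this
  · intro h n W hW
    obtain ⟨k, e, W', hW'⟩ := exists_finite_params.{u, v, max u v w} W
    have h1 := h k n W' e (by
      rw [large_iff.{u, v, w} hK, realize_iterInf] at hW
      rw [realize_iterInf]
      simp only [proj, Formula.realize_iExs, ← hW' id] at hW ⊢
      exact hW)
    obtain ⟨c, hc⟩ := (realize_wideForm W' e).1 h1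
    exact ⟨c, (hW' id _ _).1 hc⟩

/-- A single instance of (Wide) is satisfied in an extension of a given model of `T^δ`: the tuple
`c` is algebraically independent, so that its derivatives can be prescribed. -/
theorem exists_extension_wideForm {M : Type (max u v w)} [L.Structure M]
    [(withDeriv L).Structure M] [(incl L).IsExpansionOn M] (hM : M ⊨ theoryDelta ι K η)
    {k n : ℕ} (W : L.Formula ((Fin k ⊕ Fin n) ⊕ Fin n)) (z : Fin k → M)
    (hz : (iterInf hK n (W.iExs (Fin n))).Realize z) :
    ∃ (N : Type (max u v w)) (_ : L.Structure N) (_ : (withDeriv L).Structure N)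
      (_ : (incl L).IsExpansionOn N) (f : M ↪ₑ[L] N), N ⊨ theoryDelta ι K η ∧
      (∀ m, f (delta L M m) = delta L N (f m)) ∧ (wideForm W).Realize (f ∘ z) := by
  have := model_completeTheory_of_theoryDelta hM
  obtain ⟨_, _, _, _, d, hd, hdc⟩ := exists_derivation hM
  obtain ⟨N, _, _, _, _, f, a, ha, hind⟩ := exists_algebraicIndependent.{u, v, w} hK n
    ((W.iExs (Fin n)).relabel (Sum.map z id)) (by
      rw [realize_iterInf] at hz ⊢
      simpa only [Formula.realize_relabel, Sum.elim_comp_map, Function.id_comp,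
        Function.comp_id] using hz)
  have hN : N ⊨ L.completeTheory K := (f.theory_model_iff _).1 inferInstance
  rw [Formula.realize_relabel, Sum.elim_comp_map, Function.comp_id, Formula.realize_iExs] at ha
  obtain ⟨b, hb⟩ := ha
  let _ : Algebra M N := (fieldHom ι f.toEmbedding).toAlgebra
  have : CharZero N := charZero_of_injective_algebraMap (algebraMap M N).injective
  obtain ⟨D, hD, hDa⟩ := exists_derivation_extension hind ((Algebra.linearMap M N).compDer d) b
  have hD : ∀ m, D (f m) = f (d m) := hD
  let _ : derivLang.Structure N := derivStructure D
  have hdelta : delta L N = D := rfl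
  refine ⟨N, inferInstance, inferInstance, inferInstance, f,
    model_theoryDelta D hdelta.symm fun k => ?_, fun m => ?_, ?_⟩
  · rw [← map_cst f, ← map_cst f, hD, hdc]
  · rw [hdelta, hD, hd]
  · refine (realize_wideForm W _).2 ⟨a, ?_⟩
    convert hb using 2
    ext i
    rw [hdelta, hDa]

end Extensions

/-! ### Extensions that satisfy all instances of (Wide) -/

section Chain

variable {L : FirstOrder.Language.{u, v}} {ι : FirstOrder.Language.ring →ᴸ L}
  {K : Type x} [Field K] [CharZero K] [Ring.CompatibleRing K] [L.Structure K] [ι.IsExpansionOn K]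
  (hK : AlgBoundedOver L (dclEmpty ι K)) {η : Derivation ℤ (dclEmpty ι K) (dclEmpty ι K)}

/-- Finitely many instances of (Wide) over a model of `T^δ` are satisfied in an extension. -/
theorem exists_extension_finset {M : Type (max u v w)} [L.Structure M]
    [(withDeriv L).Structure M] [(incl L).IsExpansionOn M] (hM : M ⊨ theoryDelta ι K η)
    (s : Finset ((withDeriv L).Formula M))
    (hs : ∀ ψ ∈ s, ∃ (k n : ℕ) (W : L.Formula ((Fin k ⊕ Fin n) ⊕ Fin n)) (z : Fin k → M),
      (iterInf hK n (W.iExs (Fin n))).Realize z ∧ ψ = (wideForm W).relabel z) :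
    ∃ (N : Type (max u v w)) (_ : L.Structure N) (_ : (withDeriv L).Structure N)
      (_ : (incl L).IsExpansionOn N) (f : M ↪ₑ[L] N), N ⊨ theoryDelta ι K η ∧
      (∀ m, f (delta L M m) = delta L N (f m)) ∧ ∀ ψ ∈ s, ψ.Realize f := by
  classical
  induction s using Finset.induction_on with
  | empty => exact ⟨M, inferInstance, inferInstance, inferInstance, ElementaryEmbedding.refl L M,
      hM, fun _ => rfl, by simp⟩
  | insert ψ s _ ih =>
    obtain ⟨N, _, _, _, f, hN, hf, h⟩ := ih fun ψ hψ => hs ψ (Finset.mem_insert_of_mem hψ)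
    obtain ⟨k, n, W, z, hz, rfl⟩ := hs ψ (Finset.mem_insert_self _ _)
    obtain ⟨P, _, _, _, g, hP, hg, hW⟩ := exists_extension_wideForm.{u, v, w} hK hN W (f ∘ z)
      ((f.map_formula _ _).2 hz)
    refine ⟨P, inferInstance, inferInstance, inferInstance, g.comp f, hP, fun m => ?_, ?_⟩
    · rw [ElementaryEmbedding.comp_apply, hf, hg]
      rfl
    · intro ψ hψ
      rcases Finset.mem_insert.1 hψ with rfl | hψ
      · exact Formula.realize_relabel.2 hW
      · have h1 := h ψ hψ
        obtain ⟨k, n, W, z, -, rfl⟩ := hs ψ (Finset.mem_insert_of_mem hψ)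
        rw [Formula.realize_relabel] at h1 ⊢
        exact realize_wideForm_map g hg h1

/-- All instances of (Wide) over a given model of `T^δ` are satisfied in an extension. -/
theorem exists_extension_forall {M : Type (max u v w)} [L.Structure M]
    [(withDeriv L).Structure M] [(incl L).IsExpansionOn M] (hM : M ⊨ theoryDelta ι K η) :
    ∃ (N : Type (max u v w)) (_ : L.Structure N) (_ : (withDeriv L).Structure N)
      (_ : (incl L).IsExpansionOn N) (f : M ↪ₑ[L] N), N ⊨ theoryDelta ι K η ∧
      (∀ m, f (delta L M m) = delta L N (f m)) ∧
      ∀ (k n : ℕ) (W : L.Formula ((Fin k ⊕ Fin n) ⊕ Fin n)) (z : Fin k → M),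
        (iterInf hK n (W.iExs (Fin n))).Realize z → (wideForm W).Realize (f ∘ z) := by
  classical
  have := model_completeTheory_of_theoryDelta hM
  let p : Set ((withDeriv L).Formula M) := {ψ | ∃ (k n : ℕ)
    (W : L.Formula ((Fin k ⊕ Fin n) ⊕ Fin n)) (z : Fin k → M),
      (iterInf hK n (W.iExs (Fin n))).Realize z ∧ ψ = (wideForm W).relabel z}
  obtain ⟨N, _, _, y, hy⟩ := exists_realize_of_finset.{u, v, max u v w, max u v w}
    (p ∪ {ψ | ∃ φ : L.Formula M, φ.Realize id ∧ ψ = (incl L).onFormula φ} ∪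
      {ψ | ∃ m : M, ψ = Term.equal ((deltaSymb L).apply₁ (Term.var m)) (Term.var (delta L M m))} ∪
      {ψ | ∃ σ ∈ theoryDelta ι K η, ψ = σ.relabel Empty.elim}) (fun s hs => by
      obtain ⟨N, _, _, _, f, hN, hf, h⟩ := exists_extension_finset.{u, v, w} hK hM
        (s.filter (· ∈ p)) fun ψ hψ => (Finset.mem_filter.1 hψ).2
      have := model_completeTheory_of_theoryDelta hN
      obtain ⟨_, _, _, _⟩ := exists_field ι K N
      refine ⟨N, inferInstance, inferInstance, f, fun ψ hψ => ?_⟩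
      rcases hs hψ with ((h1 | ⟨φ, hφ, rfl⟩) | ⟨m, rfl⟩) | ⟨σ, hσ, rfl⟩
      · exact h ψ (Finset.mem_filter.2 ⟨hψ, h1⟩)
      · rw [LHom.realize_onFormula]
        exact (f.map_formula φ id).2 hφ
      · rw [Formula.realize_equal, Term.realize_functions_apply₁]
        exact (hf m).symm
      · rw [Formula.realize_relabel]
        convert hN.realize_of_mem σ hσ using 1
        unfold Sentence.Realize
        congr! 1)
  let _ : L.Structure N := baseStructure L N
  refine ⟨N, inferInstance, inferInstance, inferInstance, elementaryOfRealize y fun φ hφ => ?_,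
    ⟨fun σ hσ => ?_⟩, fun m => ?_, fun k n W z hz => ?_⟩
  · rw [← LHom.realize_onFormula (incl L)]
    exact hy _ (Or.inl (Or.inl (Or.inr ⟨φ, hφ, rfl⟩)))
  · have := hy _ (Or.inr ⟨σ, hσ, rfl⟩)
    rw [Formula.realize_relabel] at this
    convert this using 1
    unfold Sentence.Realize
    congr! 1
  · have := hy _ (Or.inl (Or.inr ⟨m, rfl⟩))
    rw [Formula.realize_equal, Term.realize_functions_apply₁] at this
    exact this.symm
  · have := hy _ (Or.inl (Or.inl (Or.inl ⟨k, n, W, z, hz, rfl⟩)))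
    rwa [Formula.realize_relabel] at this

/-- A structure which is locally a model of `T^δ` is a model of `T^δ`. -/
theorem model_theoryDelta_of_locally {D : Type*} [L.Structure D]
    [(withDeriv L).Structure D] [(incl L).IsExpansionOn D] [D ⊨ L.completeTheory K]
    (h : ∀ a b : D, ∃ (M : Type w) (_ : L.Structure M) (_ : (withDeriv L).Structure M)
      (_ : (incl L).IsExpansionOn M) (f : M ↪ₑ[L] D), M ⊨ theoryDelta ι K η ∧
      (∀ m, f (delta L M m) = delta L D (f m)) ∧ a ∈ Set.range f ∧ b ∈ Set.range f) :
    D ⊨ theoryDelta ι K η := by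
  obtain ⟨_, _, _, _⟩ := exists_field ι K D
  have hadd : ∀ a b : D, delta L D (a + b) = delta L D a + delta L D b := by
    intro a b
    obtain ⟨M, _, _, _, f, hM, hf, ⟨a, rfl⟩, ⟨b, rfl⟩⟩ := h a b
    have := model_completeTheory_of_theoryDelta hM
    obtain ⟨_, _, _, _, d, hd, hdc⟩ := exists_derivation hM
    have hr : ∀ m, f m = fieldHom ι f.toEmbedding m := fun _ => rfl
    rw [hr, hr, ← map_add, ← hr, ← hf, ← hd, map_add, hr, map_add, ← hr, ← hr, ← hr, ← hr, hd,
      hf, hf]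
  have hmul : ∀ a b : D, delta L D (a * b) = a • delta L D b + b • delta L D a := by
    intro a b
    obtain ⟨M, _, _, _, f, hM, hf, ⟨a, rfl⟩, ⟨b, rfl⟩⟩ := h a b
    have := model_completeTheory_of_theoryDelta hM
    obtain ⟨_, _, _, _, d, hd, hdc⟩ := exists_derivation hM
    have hr : ∀ m, f m = fieldHom ι f.toEmbedding m := fun _ => rfl
    rw [← hf, ← hf, ← hd, smul_eq_mul, smul_eq_mul, hr, hr, hr, hr, ← map_mul, ← hr, ← hf, ← hd,
      Derivation.leibniz, hr, map_add, smul_eq_mul, smul_eq_mul, map_mul, map_mul]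
  refine model_theoryDelta
    (Derivation.mk' (AddMonoidHom.mk' (delta L D) hadd).toIntLinearMap hmul) rfl fun k => ?_
  obtain ⟨M, _, _, _, f, hM, hf, -, -⟩ := h 0 0
  have := model_completeTheory_of_theoryDelta hM
  obtain ⟨_, _, _, _, d, hd, hdc⟩ := exists_derivation hM
  change delta L D (cst D k) = _
  rw [← map_cst f, ← map_cst f, ← hf, ← hdc, hd]

end Chain

/-! ### Unions of chains -/

section Limit

variable {L : FirstOrder.Language.{u, v}} {ι : FirstOrder.Language.ring →ᴸ L}
  {K : Type x} [Field K] [CharZero K] [Ring.CompatibleRing K] [L.Structure K] [ι.IsExpansionOn K]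
  (hK : AlgBoundedOver L (dclEmpty ι K)) {η : Derivation ℤ (dclEmpty ι K) (dclEmpty ι K)}

/-- Every model of `T^δ` has an extension, elementary for `L`, to a model of `T^δ` that satisfies
the scheme (Wide): the union of a chain of models, each of which satisfies the instances of (Wide)
over its predecessor. -/
theorem exists_wide_extension {M : Type (max u v w)} [L.Structure M]
    [(withDeriv L).Structure M] [(incl L).IsExpansionOn M] (hM : M ⊨ theoryDelta ι K η) :
    ∃ (N : Type (max u v w)) (_ : L.Structure N) (_ : (withDeriv L).Structure N)
      (_ : (incl L).IsExpansionOn N) (f : M ↪ₑ[L] N), N ⊨ theoryDelta ι K η ∧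
      (∀ m, f (delta L M m) = delta L N (f m)) ∧ WideParams hK N := by
  -- Models of `T^δ`, bundled for the recursion.
  let Mod := Σ' (A : Type (max u v w)) (_ : L.Structure A) (_ : (withDeriv L).Structure A)
    (_ : (incl L).IsExpansionOn A), A ⊨ theoryDelta ι K η
  let _ : ∀ A : Mod, L.Structure A.1 := fun A => A.2.1
  let _ : ∀ A : Mod, (withDeriv L).Structure A.1 := fun A => A.2.2.1
  have : ∀ A : Mod, (incl L).IsExpansionOn A.1 := fun A => A.2.2.2.1
  have hstep : ∀ A : Mod, ∃ (B : Mod) (f : A.1 ↪ₑ[L] B.1),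
      (∀ m, f (delta L A.1 m) = delta L B.1 (f m)) ∧
      ∀ (k n : ℕ) (W : L.Formula ((Fin k ⊕ Fin n) ⊕ Fin n)) (z : Fin k → A.1),
        (iterInf hK n (W.iExs (Fin n))).Realize z → (wideForm W).Realize (f ∘ z) := fun A => by
    obtain ⟨N, i1, i2, i3, f, hN, hf, h⟩ := exists_extension_forall.{u, v, w} hK A.2.2.2.2
    exact ⟨⟨N, i1, i2, i3, hN⟩, f, hf, h⟩
  choose next f hf hW using hstep
  let G : ℕ → Mod := fun n => Nat.rec ⟨M, inferInstance, inferInstance, inferInstance, hM⟩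
    (fun _ A => next A) n
  let C : ℕ → Type (max u v w) := fun n => (G n).1
  let e : ∀ n, C n ↪ₑ[L] C (n + 1) := fun n => f (G n)
  have he : ∀ n m, e n (delta L (C n) m) = delta L (C (n + 1)) (e n m) := fun n => hf (G n)
  let g : ∀ n, C n ↪[withDeriv L] C (n + 1) := fun n => deltaEmbedding (e n) (he n)
  let F : ∀ m n, m ≤ n → C m ↪[withDeriv L] C n := DirectedSystem.natLERec g
  have hdir : DirectedSystem C fun m n h => F m n h := DirectedSystem.natLERec.directedSystem g
  have hFs : ∀ m n (h : m ≤ n) z, F m (n + 1) (h.trans n.le_succ) z = e n (F m n h z) := by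
    intro m n h z
    have h1 := hdir.map_map h n.le_succ z
    rw [← h1]
    have h2 : F n (n + 1) n.le_succ = g n := by
      ext z
      change DirectedSystem.natLERec g n (n + 1) n.le_succ z = _
      rw [DirectedSystem.coe_natLERec]
      exact Nat.leRecOn_succ' z
    rw [h2]
    rfl
  have hF : ∀ m n h, ∃ E : C m ↪ₑ[L] C n, (E : C m → C n) = F m n h := by
    intro m n h
    induction n, h using Nat.le_induction with
    | base =>
      exact ⟨ElementaryEmbedding.refl L _, funext fun z => (hdir.map_self z).symm⟩
    | succ n h ih =>
      obtain ⟨E, hE⟩ := ih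
      refine ⟨(e n).comp E, funext fun z => ?_⟩
      rw [hFs m n h, ← hE]
      rfl
  let D := Language.DirectLimit C F
  let _ : L.Structure D := baseStructure L D
  let o : ∀ n, C n ↪ₑ[L] D := fun n =>
    { toFun := DirectLimit.of (withDeriv L) ℕ C F n
      map_formula' := fun k φ y => by
        have := realize_directLimit_of (incl L) F hF φ n y default
        rw [Subsingleton.elim (DirectLimit.of (withDeriv L) ℕ C F n ∘ default) default] at this
        exact this }
  have ho : ∀ n m, o n (delta L (C n) m) = delta L D (o n m) := fun n m => by
    have := (DirectLimit.of (withDeriv L) ℕ C F n).map_fun (deltaSymb L) ![m]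
    change DirectLimit.of (withDeriv L) ℕ C F n _ = _
    unfold delta
    rw [this]
    congr 1
    ext i
    rw [Subsingleton.elim i 0]
    rfl
  have hos : ∀ n m, o (n + 1) (e n m) = o n m := by
    intro n m
    have h1 := DirectLimit.of_f (L := withDeriv L) (f := F) (hij := n.le_succ) (x := m)
    have h2 := hFs n n le_rfl m
    rw [h2, hdir.map_self] at h1
    exact h1
  have hfin : ∀ (k : ℕ) (z : Fin k → D), ∃ n, ∃ y : Fin k → C n, z = o n ∘ y := by
    intro k z
    obtain ⟨n, y, hy⟩ := DirectLimit.exists_quotient_mk'_sigma_mk'_eq C F z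
    exact ⟨n, y, hy⟩
  have hDT : D ⊨ L.completeTheory K :=
    have : C 0 ⊨ L.completeTheory K := model_completeTheory_of_theoryDelta hM
    ((o 0).theory_model_iff _).1 inferInstance
  refine ⟨D, inferInstance, inferInstance, inferInstance, o 0, ?_, ho 0, ?_⟩
  · refine model_theoryDelta_of_locally.{u, v, max u v w} fun a b => ?_
    obtain ⟨n, y, hy⟩ := hfin 2 ![a, b]
    exact ⟨C n, inferInstance, inferInstance, inferInstance, o n, (G n).2.2.2.2, ho n,
      ⟨y 0, (congrFun hy 0).symm⟩, ⟨y 1, (congrFun hy 1).symm⟩⟩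
  · intro k n W z hz
    obtain ⟨m, y, rfl⟩ := hfin k z
    rw [(o m).map_formula] at hz
    have h1 := realize_wideForm_map (o (m + 1)) (ho (m + 1)) (hW (G m) k n W y hz)
    convert h1 using 1
    ext i
    exact (hos m (y i)).symm

end Limit

/-! ### Deep and wide models, consistency and completeness -/

section WideDeep

variable {L : FirstOrder.Language.{u, v}} {ι : FirstOrder.Language.ring →ᴸ L}
  {K : Type x} [Field K] [CharZero K] [Ring.CompatibleRing K] [L.Structure K] [ι.IsExpansionOn K]

/-- The instance of (Deep) for `Z` is the instance of (Wide) for the set of all `(x, y)` such that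
`y i = x (i + 1)` for all `i` except the last one, and such that `(x, y)` with `y` restricted to
its last coordinate lies in `Z`. -/
theorem deep_of_wide (hK : AlgBoundedOver L (dclEmpty ι K)) {M : Type (max u v w)} [L.Structure M]
    [M ⊨ L.completeTheory K] {δ : M → M} (h : Wide L δ) : Deep L δ := by
  rintro (_ | n) Z hZ
  · rw [large_iff.{u, v, w} hK, realize_iterInf] at hZ
    obtain ⟨c, hc⟩ := Formula.realize_iExs.1 (show (proj L Z).Realize _ from hZ)
    refine ⟨c 0, ?_⟩
    convert hc using 2
    · ext (i | i)
      · rfl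
      · exact i.elim0
    · ext i
      rw [Subsingleton.elim i 0]
      rfl
  · let W : L.Formula ((M ⊕ Fin (n + 1)) ⊕ Fin (n + 1)) :=
      Z.relabel (Sum.map id fun _ => Fin.last n) ⊓ Formula.iInf fun i : Fin n =>
        Term.equal (Term.var (Sum.inr i.castSucc)) (Term.var (Sum.inl (Sum.inr i.succ)))
    have hWr : ∀ a b : Fin (n + 1) → M, W.Realize (Sum.elim (Sum.elim id a) b) ↔
        Z.Realize (Sum.elim (Sum.elim id a) fun _ => b (Fin.last n)) ∧
          ∀ i : Fin n, b i.castSucc = a i.succ := by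
      intro a b
      simp only [W, Formula.realize_inf, Formula.realize_iInf, Formula.realize_relabel,
        Sum.elim_comp_map, Function.comp_id, Formula.realize_equal, Term.realize_var,
        Sum.elim_inl, Sum.elim_inr]
      rfl
    obtain ⟨c, hc⟩ := h (n + 1) W (by
      rw [large_iff.{u, v, w} hK, realize_iterInf] at hZ ⊢
      convert hZ using 1
      ext a
      simp only [proj, Formula.realize_iExs, hWr, Set.mem_ofPred_eq]
      constructor
      · rintro ⟨b, hb, -⟩
        exact ⟨_, hb⟩
      · rintro ⟨b, hb⟩
        -- The projection to the `x`-coordinates is the same for both sets.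
        refine ⟨Fin.snoc (fun i => a i.succ) (b 0), ?_, fun i => by simp⟩
        convert hb using 2
        ext i
        rw [Subsingleton.elim i 0, Fin.snoc_last])
    obtain ⟨hc1, hc2⟩ := (hWr _ _).1 hc
    have hit : ∀ i : Fin (n + 1), c i = δ^[(i : ℕ)] (c 0) := by
      intro i
      induction i using Fin.induction with
      | zero => rfl
      | succ i ih =>
        rw [← hc2, ih, Fin.val_succ, Function.iterate_succ_apply']
        rfl
    refine ⟨c 0, ?_⟩
    convert hc1 using 2
    · exact congrArg _ (funext fun i => (hit i).symm)
    · rw [hit (Fin.last n), Fin.val_last, Function.iterate_succ_apply']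

variable {hK : AlgBoundedOver L (dclEmpty ι K)} {η : Derivation ℤ (dclEmpty ι K) (dclEmpty ι K)}

theorem comp_jet {M N σ : Type*} {δ : M → M} {ε : N → N} {f : M → N}
    (hf : ∀ m, f (δ m) = ε (f m)) (z : σ → M) : jet ε (f ∘ z) = f ∘ jet δ z :=
  funext fun p => ((Function.Semiconj.iterate_right hf p.2) (z p.1)).symm

theorem WideParams.model_genericTheory {M : Type (max u v w)} [L.Structure M]
    [(withDeriv L).Structure M] [(incl L).IsExpansionOn M] (hM : M ⊨ theoryDelta ι K η)
    (h : WideParams hK M) : M ⊨ genericTheory hK η := by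
  have := model_completeTheory_of_theoryDelta hM
  exact (model_genericTheory_iff.{u, v, w} hK η).2
    ⟨hM, deep_of_wide.{u, v, w} hK ((wide_iff.{u, v, w} hK).2 h)⟩

/-- A model of the theory of generic derivations satisfies (Wide): it has an extension which does,
and this extension is elementary for `L^δ` by relative quantifier elimination. -/
theorem wideParams_of_model_genericTheory {M : Type (max u v w)} [L.Structure M]
    [(withDeriv L).Structure M] [(incl L).IsExpansionOn M] (hM : M ⊨ genericTheory hK η) :
    WideParams hK M := by
  obtain ⟨N, _, _, _, f, hN, hf, hW⟩ := exists_wide_extension.{u, v, w} hK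
    ((model_genericTheory_iff.{u, v, w} hK η).1 hM).1
  intro k n W z hz
  obtain ⟨γ, hγ⟩ := exists_jet_equiv.{u, v, w} hK η (wideForm W)
  rw [hγ M hM, ← f.map_formula, ← comp_jet hf, ← hγ N (hW.model_genericTheory hN)]
  exact hW k n W _ ((f.map_formula _ _).2 hz)

theorem deep_iff_wide {M : Type (max u v w)} [L.Structure M]
    [(withDeriv L).Structure M] [(incl L).IsExpansionOn M] (hK : AlgBoundedOver L (dclEmpty ι K))
    (hM : M ⊨ theoryDelta ι K η) : Deep L (delta L M) ↔ Wide L (delta L M) := by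
  have := model_completeTheory_of_theoryDelta hM
  refine ⟨fun h => ?_, deep_of_wide.{u, v, w} hK⟩
  exact (wide_iff.{u, v, w} hK).2 (wideParams_of_model_genericTheory.{u, v, w}
    ((model_genericTheory_iff.{u, v, w} hK η).2 ⟨hM, h⟩))

/-- `T^δ` is consistent: the derivation `η` extends to `K`. -/
theorem isSatisfiable_theoryDelta (η : Derivation ℤ (dclEmpty ι K) (dclEmpty ι K)) :
    (theoryDelta ι K η).IsSatisfiable := by
  obtain ⟨D, hD, -⟩ := exists_derivation_extension (A := dclEmpty ι K) (N := K)
    (a := (Empty.elim : Empty → K))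
    (algebraicIndependent_empty_type_iff.2 Subtype.val_injective)
    ((Algebra.linearMap (dclEmpty ι K) K).compDer η) Empty.elim
  let _ : derivLang.Structure K := derivStructure D
  have : K ⊨ theoryDelta ι K η := model_theoryDelta D rfl fun k => by
    rw [cst_self, cst_self]
    exact hD k
  exact Theory.Model.isSatisfiable K

theorem isSatisfiable_genericTheory (hK : AlgBoundedOver L (dclEmpty ι K))
    (η : Derivation ℤ (dclEmpty ι K) (dclEmpty ι K)) : (genericTheory hK η).IsSatisfiable := by
  obtain ⟨M⟩ := isSatisfiable_theoryDelta (ι := ι) η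
  let _ : L.Structure M := baseStructure L M
  obtain ⟨N, _, _, _, f, hN, hf, hW⟩ := exists_wide_extension.{u, v, 0} hK
    (M := M) (η := η) inferInstance
  have := hW.model_genericTheory hN
  have : Nonempty N := ⟨f M.nonempty'.some⟩
  exact Theory.Model.isSatisfiable N

/-- By relative quantifier elimination, a sentence of `L^δ` is equivalent to a sentence of `L`:
there are no jets of the empty tuple. -/
theorem isComplete_genericTheory (hK : AlgBoundedOver L (dclEmpty ι K))
    (η : Derivation ℤ (dclEmpty ι K) (dclEmpty ι K)) : (genericTheory hK η).IsComplete := by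
  refine ⟨isSatisfiable_genericTheory hK η, fun φ => ?_⟩
  obtain ⟨γ, hγ⟩ := exists_jet_equiv.{u, v, 0} hK η φ
  let σ : L.Sentence := γ.relabel fun p => p.1
  have key : ∀ M : Theory.ModelType.{u, v, max u v} (genericTheory hK η),
      M ⊨ φ ↔ K ⊨ σ := by
    intro M
    let _ : L.Structure M := baseStructure L M
    have hM := model_completeTheory_of_theoryDelta
      ((model_genericTheory_iff.{u, v, 0} hK η (M := M)).1 inferInstance).1
    have h1 : M ⊨ φ ↔ M ⊨ σ := by
      unfold Sentence.Realize
      rw [Formula.realize_relabel]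
      refine (hγ M inferInstance _).trans (iff_of_eq (congrArg _ (funext fun p => p.1.elim)))
    rw [h1]
    refine ⟨fun h => by_contra fun h2 => ?_, realize_sentence_of_completeTheory⟩
    have := realize_sentence_of_completeTheory (M := M) ((Sentence.realize_not K).2 h2)
    exact (Sentence.realize_not M).1 this h
  by_cases h : K ⊨ σ
  · exact Or.inl (Theory.models_sentence_iff.2 fun M => (key M).2 h)
  · exact Or.inr (Theory.models_sentence_iff.2 fun M =>
      (Sentence.realize_not _).2 fun h2 => h ((key M).1 h2))

end WideDeep

/-! ### Quantifier elimination and model completion -/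

section QuantifierFree

variable {L L' : FirstOrder.Language.{u, v}}

theorem isQF_onFormula (i : L →ᴸ L') {α : Type*} {φ : L.Formula α} (h : φ.IsQF) :
    (i.onFormula φ).IsQF := by
  unfold LHom.onFormula
  induction h with
  | falsum => exact .falsum
  | of_isAtomic h =>
    cases h with
    | equal t₁ t₂ => exact (BoundedFormula.IsAtomic.equal _ _).isQF
    | rel R ts => exact (BoundedFormula.IsAtomic.rel _ _).isQF
  | imp _ _ h1 h2 => exact h1.imp h2

theorem isQF_subst {α β : Type*} {φ : L.Formula α} (h : φ.IsQF) (f : α → L.Term β) :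
    (BoundedFormula.subst φ f).IsQF := by
  induction h with
  | falsum => exact .falsum
  | of_isAtomic h =>
    cases h with
    | equal t₁ t₂ => exact (BoundedFormula.IsAtomic.equal _ _).isQF
    | rel R ts => exact (BoundedFormula.IsAtomic.rel _ _).isQF
  | imp _ _ h1 h2 => exact h1.imp h2

theorem isQF_jetForm {σ : Type} {γ : L.Formula (σ × ℕ)} (h : γ.IsQF) : (jetForm γ).IsQF :=
  isQF_subst (isQF_onFormula _ h) _

theorem HasQE.isModelComplete {T : L.Theory} (h : HasQE T) : IsModelComplete.{u, v, w} T := by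
  intro M N f n φ y
  obtain ⟨ψ, hψ, hφ⟩ := h n φ
  have h1 : ∀ (P : Theory.ModelType.{u, v, max u v w} T) (y : Fin n → P),
      φ.Realize y ↔ ψ.Realize y := fun P y =>
    Formula.realize_iff.1 (Theory.ModelsBoundedFormula.realize_formula hφ P)
  rw [h1, h1]
  have := hψ.realize_embedding f (v := y) (xs := default)
  rwa [Subsingleton.elim (f ∘ default) default] at this

/-- A theory that eliminates quantifiers does so for formulas in any finite set of variables. -/
theorem HasQE.exists_isQF {T : L.Theory} (h : HasQE T) {α : Type*} [Finite α] (φ : L.Formula α) :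
    ∃ ψ : L.Formula α, ψ.IsQF ∧ ∀ (M : Type w) [L.Structure M] [M ⊨ T] [Nonempty M] (y : α → M),
      φ.Realize y ↔ ψ.Realize y := by
  obtain ⟨n, ⟨e⟩⟩ := Finite.exists_equiv_fin α
  obtain ⟨ψ, hψ, hφ⟩ := h n (φ.relabel e)
  refine ⟨ψ.relabel e.symm, hψ.relabel _, fun M _ _ _ y => ?_⟩
  have := Formula.realize_iff.1
    (Theory.ModelsBoundedFormula.realize_formula hφ M (v := y ∘ e.symm))
  rw [Formula.realize_relabel] at this
  rw [Formula.realize_relabel, ← this]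
  congr! 1
  ext i
  simp

/-- A formula has only finitely many free variables. -/
theorem exists_finite_support {A : Type*} (φ : L.Formula A) :
    ∃ (k : ℕ) (e : Fin k → A) (ψ : L.Formula (Fin k)), ∀ {M : Type w} [L.Structure M] (a : A → M),
      ψ.Realize (a ∘ e) ↔ φ.Realize a := by
  let Z : L.Formula (A ⊕ Empty) := φ.relabel Sum.inl
  refine ⟨_, paramEnum Z, (paramForm Z).relabel (Sum.elim id Empty.elim), fun a => ?_⟩
  have h := realize_paramForm Z a Empty.elim
  rw [Formula.realize_relabel, Sum.elim_comp_inl] at h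
  rw [Formula.realize_relabel, ← h]
  congr! 1
  ext (i | i)
  · rfl
  · exact i.elim

/-- An embedding of `L^δ`-structures, as an embedding of their `L`-reducts. -/
def reductEmbedding {M N : Type*} [L.Structure M] [(withDeriv L).Structure M]
    [(incl L).IsExpansionOn M] [L.Structure N] [(withDeriv L).Structure N]
    [(incl L).IsExpansionOn N] (f : M ↪[withDeriv L] N) : M ↪[L] N where
  toFun := f
  inj' := f.injective
  map_fun' g y := by
    rw [← LHom.map_onFunction (incl L), ← LHom.map_onFunction (incl L)]
    exact f.map_fun _ y
  map_rel' r y := by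
    rw [← LHom.map_onRelation (incl L), ← LHom.map_onRelation (incl L)]
    exact f.map_rel _ y

theorem embedding_delta {M N : Type*} [(withDeriv L).Structure M] [(withDeriv L).Structure N]
    (f : M ↪[withDeriv L] N) (m : M) : f (delta L M m) = delta L N (f m) := by
  unfold delta
  rw [f.map_fun]
  congr 1
  ext i
  rw [Subsingleton.elim i 0]
  rfl

end QuantifierFree

section Completion

variable {L : FirstOrder.Language.{u, v}} {ι : FirstOrder.Language.ring →ᴸ L}
  {K : Type x} [Field K] [CharZero K] [Ring.CompatibleRing K] [L.Structure K] [ι.IsExpansionOn K]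

omit [CharZero K] in
theorem model_theoryDelta_of_genericTheory {hK : AlgBoundedOver L (dclEmpty ι K)}
    {η : Derivation ℤ (dclEmpty ι K) (dclEmpty ι K)} {M : Type*} [(withDeriv L).Structure M]
    (h : M ⊨ genericTheory hK η) : M ⊨ theoryDelta ι K η :=
  h.mono Set.subset_union_left

theorem exists_equivOnJets (hK : AlgBoundedOver L (dclEmpty ι K))
    (η : Derivation ℤ (dclEmpty ι K) (dclEmpty ι K)) {k : ℕ} (α : (withDeriv L).Formula (Fin k)) :
    ∃ (n : ℕ) (β : L.Formula (Fin k × Fin (n + 1))),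
      EquivOnJets.{u, v, w} (genericTheory hK η) α β := by
  obtain ⟨γ, hγ⟩ := exists_jet_equiv.{u, v, w} hK η α
  obtain ⟨l, e, ψ, hψ⟩ := exists_finite_support.{u, v, max u v w} γ
  -- A bound for the order of the derivatives that occur in `γ`.
  let n : ℕ := Finset.univ.sup fun i => (e i).2
  have hn : ∀ i, (e i).2 < n + 1 := fun i =>
    Nat.lt_succ_of_le (Finset.le_sup (f := fun i => (e i).2) (Finset.mem_univ i))
  refine ⟨n, ψ.relabel fun i => ((e i).1, ⟨(e i).2, hn i⟩), fun M y => ?_⟩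
  let _ : L.Structure M := baseStructure L M
  rw [hγ M inferInstance, ← hψ, Formula.realize_relabel]
  rfl

theorem exists_isQF_equivOnJets (hK : AlgBoundedOver L (dclEmpty ι K))
    (η : Derivation ℤ (dclEmpty ι K) (dclEmpty ι K)) (h : HasQE (L.completeTheory K)) {k : ℕ}
    (α : (withDeriv L).Formula (Fin k)) :
    ∃ (n : ℕ) (β : L.Formula (Fin k × Fin (n + 1))), β.IsQF ∧
      EquivOnJets.{u, v, w} (genericTheory hK η) α β := by
  obtain ⟨n, β, hβ⟩ := exists_equivOnJets.{u, v, w} hK η α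
  obtain ⟨β', hβ', h'⟩ := h.exists_isQF.{u, v, max u v w} β
  refine ⟨n, β', hβ', fun M y => ?_⟩
  let _ : L.Structure M := baseStructure L M
  have := model_completeTheory_of_theoryDelta
    (model_theoryDelta_of_genericTheory (hK := hK) (η := η) (M := M) inferInstance)
  exact (hβ M y).trans (h' M _)

/-- Jets are tuples of terms of `L^δ`, so that a quantifier-free formula about jets is a
quantifier-free formula of `L^δ`. -/
theorem hasQE_genericTheory (hK : AlgBoundedOver L (dclEmpty ι K))
    (η : Derivation ℤ (dclEmpty ι K) (dclEmpty ι K)) (h : HasQE (L.completeTheory K)) :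
    HasQE (genericTheory hK η) := by
  intro k α
  obtain ⟨n, β, hβ, hαβ⟩ := exists_isQF_equivOnJets.{u, v, 0} hK η h α
  refine ⟨jetForm (β.relabel (Prod.map id Fin.val)), isQF_jetForm (hβ.relabel _),
    fun M y xs => ?_⟩
  let _ : L.Structure M := baseStructure L M
  rw [BoundedFormula.realize_iff, Subsingleton.elim xs default]
  have h1 := realize_jetForm (M := M) (β.relabel (Prod.map id Fin.val)) y
  rw [Formula.realize_relabel] at h1
  exact (hαβ M y).trans h1.symm

theorem isModelCompletion_genericTheory (hK : AlgBoundedOver L (dclEmpty ι K))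
    (η : Derivation ℤ (dclEmpty ι K) (dclEmpty ι K))
    (h : IsModelComplete.{u, v, w} (L.completeTheory K)) :
    IsModelCompletion.{u, v, w} (theoryDelta ι K η) (genericTheory hK η) where
  models A := model_theoryDelta_of_genericTheory (hK := hK) inferInstance
  extends_to A := by
    let _ : L.Structure A := baseStructure L A
    obtain ⟨N, _, _, _, f, hN, hf, hW⟩ := exists_wide_extension.{u, v, w} hK
      (M := A) (η := η) inferInstance
    have := hW.model_genericTheory hN
    have : Nonempty N := ⟨f A.nonempty'.some⟩
    have g := deltaEmbedding f hf
    exact ⟨Theory.ModelType.of _ N, ⟨g⟩⟩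
  equiv A B C f g φ := by
    let _ : L.Structure A := baseStructure L A
    have hA : A ⊨ L.completeTheory K :=
      model_completeTheory_of_theoryDelta (η := η) (M := A) inferInstance
    -- The truth of `φ` at the image of `A` depends only on the `L`-type of finitely many jets,
    -- which model completeness transfers from `A`.
    have key : ∀ (k : ℕ) (e : Fin k → A) (ψ : (withDeriv L).Formula (Fin k)), ∃ P : Prop,
        ∀ (B : Theory.ModelType.{u, v, max u v w} (genericTheory hK η))
        (f : A ↪[withDeriv L] B), ψ.Realize (f ∘ e) ↔ P := by
      intro k e ψ
      obtain ⟨γ, hγ⟩ := exists_jet_equiv.{u, v, w} hK η ψ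
      obtain ⟨l, i, γ', hγ'⟩ := exists_finite_support.{u, v, max u v w} γ
      refine ⟨γ'.Realize (jet (delta L A) e ∘ i), fun B f => ?_⟩
      let _ : L.Structure B := baseStructure L B
      have hB : B ⊨ L.completeTheory K := model_completeTheory_of_theoryDelta
        (model_theoryDelta_of_genericTheory (hK := hK) (η := η) (M := B) inferInstance)
      rw [hγ B inferInstance, comp_jet (embedding_delta f), ← hγ']
      let g : A ↪[L] B := reductEmbedding f
      exact h (.of _ A) (.of _ B) g l γ' _
    obtain ⟨k, e, ψ, hψ⟩ := exists_finite_support.{u, v, max u v w} φ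
    obtain ⟨P, hP⟩ := key k e ψ
    rw [← hψ, ← hψ, hP, hP]

end Completion

end GenericDerivation

theorem mainTheorem1 {L : FirstOrder.Language.{u, v}} (ι : FirstOrder.Language.ring →ᴸ L)
    (K : Type x) [Field K] [CharZero K] [Ring.CompatibleRing K] [L.Structure K]
    [ι.IsExpansionOn K] (hK : AlgBoundedOver L (dclEmpty ι K))
    (η : Derivation ℤ (dclEmpty ι K) (dclEmpty ι K)) :
    ∃ Tg : (withDeriv L).Theory,
      AxiomatizedByDeep.{u, v, w} (theoryDelta ι K η) Tg ∧
      AxiomatizedByWide.{u, v, w} (theoryDelta ι K η) Tg ∧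
      Tg.IsComplete ∧
      (∀ (k : ℕ) (α : (withDeriv L).Formula (Fin k)),
        ∃ (n : ℕ) (β : L.Formula (Fin k × Fin (n + 1))), EquivOnJets.{u, v, w} Tg α β) ∧
      (IsModelComplete.{u, v, w} (L.completeTheory K) →
        IsModelCompletion.{u, v, w} (theoryDelta ι K η) Tg) ∧
      (HasQE (L.completeTheory K) →
        IsModelCompletion.{u, v, w} (theoryDelta ι K η) Tg ∧ HasQE Tg ∧
        ∀ (k : ℕ) (α : (withDeriv L).Formula (Fin k)),
          ∃ (n : ℕ) (β : L.Formula (Fin k × Fin (n + 1))),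
            β.IsQF ∧ EquivOnJets.{u, v, w} Tg α β) := by
  refine ⟨genericTheory hK η, fun M _ => ?_, fun M _ => ?_, isComplete_genericTheory hK η,
    fun k α => exists_equivOnJets hK η α, isModelCompletion_genericTheory hK η,
    fun h => ⟨isModelCompletion_genericTheory hK η h.isModelComplete,
      hasQE_genericTheory hK η h, fun k α => exists_isQF_equivOnJets hK η h α⟩⟩
  · let _ : L.Structure M := baseStructure L M
    exact model_genericTheory_iff.{u, v, w} hK η
  · let _ : L.Structure M := baseStructure L M
    exact (model_genericTheory_iff.{u, v, w} hK η).trans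
      (and_congr_right fun hM => deep_iff_wide.{u, v, w} hK hM)
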